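/- For a planar convex body $K$ (a compact convex subset of $\mathbb{R}^2$ with nonempty interior) write $A(K)$ for its area. A chord of $K$ is an \emph{affine diameter} if it is at least as long as every chord of $K$ parallel to it; its length is called the length of $K$ in its direction. A \emph{half-length parallelogram} of $K$ is a nondegenerate parallelogram with its four vertices on the boundary of $K$, one pair of whose opposite sides is half as long as the length of $K$ in the direction of these sides. Let $\Delta(K)$ be the least area of a half-length parallelogram of $K$. Let $M$ be the regular heptagon with vertices $\left(\cos\frac{2\pi i}{7},\sin\frac{2\pi i}{7}\right)$, $i=0,\dots,6$. Theorem. There exists $\varepsilon$ with $0<\varepsilon<1$ such that every convex heptagon $M'$ with $(1-\varepsilon)M\subseteq M'\subseteq(1+\varepsilon)M$ satisfies $$\frac{A(M')}{2\Delta(M')}\;\ge\;\frac{A(M)}{2\Delta(M)},$$ with equality only if $M'$ is affinely equivalent to $M$, that is, $M'$ is the image of $M$ under an invertible affine map of the plane. -/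

import Mathlib

open scoped Pointwise

/-- The Euclidean plane. -/
abbrev Plane : Type := EuclideanSpace ℝ (Fin 2)

/-- A convex heptagon: the convex hull of seven points in convex position
(none of them lies in the convex hull of the others). -/
def IsConvexHeptagon (K : Set Plane) : Prop :=
  ∃ p : Fin 7 → Plane, ConvexIndependent ℝ p ∧ K = convexHull ℝ (Set.range p)

/-- The regular heptagon with vertices `(cos (2πi/7), sin (2πi/7))`, `i = 0, …, 6`. -/
noncomputable def regularHeptagon : Set Plane :=
  convexHull ℝ (Set.range fun i : Fin 7 =>
    (!₂[Real.cos (2 * Real.pi * (i : ℝ) / 7), Real.sin (2 * Real.pi * (i : ℝ) / 7)] : Plane))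

/-- The area of a plane set. -/
noncomputable def planeArea (K : Set Plane) : ℝ :=
  MeasureTheory.volume.real K

/-- The chord of `K` from the boundary point `x` to the boundary point `y` is an affine diameter:
it is at least as long as every chord of `K` parallel to it. -/
def IsAffineDiameter (K : Set Plane) (x y : Plane) : Prop :=
  x ∈ frontier K ∧ y ∈ frontier K ∧ x ≠ y ∧
    ∀ x' ∈ frontier K, ∀ y' ∈ frontier K,
      (∃ c : ℝ, y' - x' = c • (y - x)) → dist x' y' ≤ dist x y

/-- The (nondegenerate) parallelogram with vertices `p`, `p + s`, `p + s + t`, `p + t` is inscribed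
in `K`, and its pair of sides parallel to `s` is half as long as `K` is in the direction of `s`,
that is, half as long as an affine diameter of `K` in that direction. -/
def IsHalfLengthParallelogram (K : Set Plane) (p s t : Plane) : Prop :=
  LinearIndependent ℝ ![s, t] ∧
    p ∈ frontier K ∧ p + s ∈ frontier K ∧ p + s + t ∈ frontier K ∧ p + t ∈ frontier K ∧
    ∃ x y : Plane, IsAffineDiameter K x y ∧ s = (1 / 2 : ℝ) • (y - x)

/-- The area of a parallelogram with side vectors `s` and `t`. -/
def parallelogramArea (s t : Plane) : ℝ :=
  |s 0 * t 1 - s 1 * t 0|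

/-- The least area of a half-length parallelogram inscribed in `K`. -/
noncomputable def leastHalfLengthArea (K : Set Plane) : ℝ :=
  sInf {a : ℝ | ∃ p s t : Plane, IsHalfLengthParallelogram K p s t ∧ a = parallelogramArea s t}

/-- The sets `K` and `L` are affinely equivalent: an invertible affine map of the plane carries
`K` onto `L`. -/
def AffinelyEquivalent (K L : Set Plane) : Prop :=
  ∃ f : Plane ≃ᵃ[ℝ] Plane, f '' K = L

/-! Clearing denominators, the claim is A(M)·Δ(M') ≤ Δ(M)·A(M'). This needs a lower bound for Δ(M)
and, for M' near M, an upper bound for Δ(M') by explicit parallelograms.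

Lower bound. Let d = `paraArea root (1 / 2)` be the area of the half-length parallelogram of M
parallel to a symmetry axis. Up to sign, every affine diameter vector of M joins some vertex to a
point of the opposite edge (`exists_direction`). If s is half of it, M contains two chords equal to
s whose supporting lines span with s an area at least d (`exists_root_chords`). A convexity argument
(`le_area_of_inscribed`) shows that an inscribed parallelogram with side s cannot be thinner than
the strip between two such chords, so Δ(M) ≥ d.

Upper bound. A heptagon near M has seven explicit parallelograms, one for each vertex: the direction
runs from the vertex to a point of the opposite edge near its midpoint, and the two sides are cut
off at two corners. Their areas are rational functions of the vertices (`paraArea`). By affine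
invariance the discrete Fourier coefficients 0, 1 and 6 of the vertex sequence can be normalized to
0, 1 and 0, which leaves modes 2, 3, 4, 5 as a vector c. If c = 0, M' is an affine image of M.
Otherwise let the excess of a parallelogram be d·A(M') - A(M)·(its area); it suffices that one of
the seven excesses is positive.

The excess of the i-th parallelogram is that of the 0-th evaluated at the rotated modes `rotM i c`.
The direction is tilted by a linear function of c, and the excess is expanded to second order.
Summed over the rotations, the first order parts cancel by orthogonality of the seventh roots of
unity. The plain average of the second order parts is not positive definite, so the average is taken
with weights 1 + `weight`. Here `weight` is linear in c and nearly a positive multiple of the first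
order excess, so the additional term behaves like the square of that excess. The weighted quadratic
form dominates ‖c‖² (`norm_sq_le_sum_gap₂`), which is checked by decimal enclosures of a few
trigonometric constants. The remainder is O(‖c‖³) and the weights are positive for small c, so some
excess is positive (`exists_gap_pos`).

Finally, a heptagon squeezed between (1-ε)M and (1+ε)M has its vertices, suitably labelled, close to
those of M (`exists_vertex_near`). -/

open Filter Topology MeasureTheory Asymptotics

/-! ### Signed area of complex numbers and the identification with the plane -/

/-- The signed area of the parallelogram spanned by two complex numbers. -/
def cross (z w : ℂ) : ℝ := z.re * w.im - z.im * w.re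

lemma cross_add_left (a b c : ℂ) : cross (a + b) c = cross a c + cross b c := by
  simp [cross]; ring
lemma cross_add_right (a b c : ℂ) : cross a (b + c) = cross a b + cross a c := by
  simp [cross]; ring
lemma cross_sub_left (a b c : ℂ) : cross (a - b) c = cross a c - cross b c := by
  simp [cross]; ring
lemma cross_sub_right (a b c : ℂ) : cross a (b - c) = cross a b - cross a c := by
  simp [cross]; ring
lemma cross_real_mul_left (r : ℝ) (a b : ℂ) : cross (r * a) b = r * cross a b := by
  simp [cross]; ring
lemma cross_real_mul_right (r : ℝ) (a b : ℂ) : cross a (r * b) = r * cross a b := by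
  simp [cross]; ring
lemma cross_neg_left (a b : ℂ) : cross (-a) b = -cross a b := by simp [cross]; ring
lemma cross_neg_right (a b : ℂ) : cross a (-b) = -cross a b := by simp [cross]; ring
lemma cross_same (a : ℂ) : cross a a = 0 := by simp [cross]; ring
lemma cross_swap (a b : ℂ) : cross a b = -cross b a := by simp [cross]; ring
lemma cross_mul_mul (u a b : ℂ) : cross (u * a) (u * b) = Complex.normSq u * cross a b := by
  simp [cross, Complex.normSq_apply]; ring
lemma cross_conj (a b : ℂ) :
    cross (starRingEnd ℂ a) (starRingEnd ℂ b) = -cross a b := by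
  simp [cross]; ring

@[fun_prop]
lemma continuous_cross {X : Type*} [TopologicalSpace X] {f g : X → ℂ} (hf : Continuous f)
    (hg : Continuous g) : Continuous fun x => cross (f x) (g x) := by
  unfold cross; fun_prop

/-- The identification of the complex numbers with the plane. -/
noncomputable def toPlane : ℂ ≃ₗᵢ[ℝ] Plane := Complex.orthonormalBasisOneI.repr

lemma toPlane_zero (z : ℂ) : toPlane z 0 = z.re := by simp [toPlane]
lemma toPlane_one (z : ℂ) : toPlane z 1 = z.im := by simp [toPlane]

lemma parallelogramArea_toPlane (s t : ℂ) :
    parallelogramArea (toPlane s) (toPlane t) = |cross s t| := by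
  simp [parallelogramArea, toPlane_zero, toPlane_one, cross]

/-! ### The vertices as seventh roots of unity -/

/-- The vertices of the regular heptagon as complex numbers. -/
noncomputable def root (k : Fin 7) : ℂ := Complex.exp (2 * Real.pi * Complex.I / 7) ^ (k : ℕ)

lemma root_one_pow : Complex.exp (2 * Real.pi * Complex.I / 7) ^ 7 = 1 := by
  rw [← Complex.exp_nat_mul]
  convert Complex.exp_two_pi_mul_I using 2
  push_cast; ring

lemma root_zero : root 0 = 1 := by simp [root]

lemma root_add (i j : Fin 7) : root (i + j) = root i * root j := by
  unfold root
  rw [← pow_add, Fin.val_add, ← pow_mod_orderOf]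
  conv_rhs => rw [← pow_mod_orderOf]
  congr 1
  have : orderOf (Complex.exp (2 * Real.pi * Complex.I / 7)) ∣ 7 :=
    orderOf_dvd_of_pow_eq_one root_one_pow
  exact Nat.mod_mod_of_dvd _ this

lemma root_eq_exp (k : Fin 7) :
    root k = Complex.exp ((2 * Real.pi * ((k : ℕ) : ℝ) / 7 : ℝ) * Complex.I) := by
  unfold root
  rw [← Complex.exp_nat_mul]
  congr 1; push_cast; ring

lemma root_re (k : Fin 7) : (root k).re = Real.cos (2 * Real.pi * ((k : ℕ) : ℝ) / 7) := by
  rw [root_eq_exp, Complex.exp_ofReal_mul_I_re]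
lemma root_im (k : Fin 7) : (root k).im = Real.sin (2 * Real.pi * ((k : ℕ) : ℝ) / 7) := by
  rw [root_eq_exp, Complex.exp_ofReal_mul_I_im]

lemma normSq_root (k : Fin 7) : Complex.normSq (root k) = 1 := by
  rw [Complex.normSq_apply, root_re, root_im, ← sq, ← sq, Real.cos_sq_add_sin_sq]

lemma norm_root (k : Fin 7) : ‖root k‖ = 1 := by
  rw [← sq_eq_sq₀ (norm_nonneg _) zero_le_one, ← Complex.normSq_eq_norm_sq, normSq_root, one_pow]

lemma root_ne_zero (k : Fin 7) : root k ≠ 0 := by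
  intro h; simpa [h] using norm_root k

lemma root_neg (k : Fin 7) : root (-k) = starRingEnd ℂ (root k) := by
  have h1 : root k * root (-k) = 1 := by rw [← root_add]; simp [root_zero]
  have h2 : root k * starRingEnd ℂ (root k) = 1 := by rw [Complex.mul_conj, normSq_root]; simp
  exact mul_left_cancel₀ (root_ne_zero k) (h1.trans h2.symm)

lemma regularHeptagon_eq :
    regularHeptagon = convexHull ℝ (Set.range fun k => toPlane (root k)) := by
  unfold regularHeptagon
  congr 2
  ext k i
  fin_cases i
  · simp [toPlane_zero, root_re]
  · simp [toPlane_one, root_im]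

/-! ### Trigonometric constants and decimal enclosures -/

/-- `cos (2π/7)`. -/
noncomputable def C1 : ℝ := Real.cos (2 * Real.pi / 7)
/-- `sin (2π/7)`. -/
noncomputable def S1 : ℝ := Real.sin (2 * Real.pi / 7)
/-- `cos (4π/7)`. -/
noncomputable def C2 : ℝ := 2 * C1 ^ 2 - 1
/-- `sin (4π/7)`. -/
noncomputable def S2 : ℝ := 2 * S1 * C1
/-- `cos (6π/7)`. -/
noncomputable def C3 : ℝ := 4 * C1 ^ 3 - 3 * C1
/-- `sin (6π/7)`. -/
noncomputable def S3 : ℝ := 3 * S1 - 4 * S1 ^ 3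

lemma root1 : root 1 = ⟨C1, S1⟩ := by
  apply Complex.ext <;> simp [root_re, root_im, C1, S1]
lemma root2 : root 2 = ⟨C2, S2⟩ := by
  have h : 2 * Real.pi * 2 / 7 = 2 * (2 * Real.pi / 7) := by ring
  apply Complex.ext
  · simp [root_re, h, Real.cos_two_mul, C1, C2]
  · simp [root_im, h, Real.sin_two_mul, C1, S1, S2]
lemma root3 : root 3 = ⟨C3, S3⟩ := by
  have h : 2 * Real.pi * 3 / 7 = 3 * (2 * Real.pi / 7) := by ring
  apply Complex.ext
  · simp [root_re, h, Real.cos_three_mul, C1, C3]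
  · simp [root_im, h, Real.sin_three_mul, S1, S3]
lemma root4 : root 4 = ⟨C3, -S3⟩ := by
  rw [show (4 : Fin 7) = -3 from rfl, root_neg, root3]; rfl
lemma root5 : root 5 = ⟨C2, -S2⟩ := by
  rw [show (5 : Fin 7) = -2 from rfl, root_neg, root2]; rfl
lemma root6 : root 6 = ⟨C1, -S1⟩ := by
  rw [show (6 : Fin 7) = -1 from rfl, root_neg, root1]; rfl

lemma S1_sq : S1 ^ 2 = 1 - C1 ^ 2 := Real.sin_sq _

lemma S1_pos : 0 < S1 := Real.sin_pos_of_pos_of_lt_pi (by positivity)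
  (by have := Real.pi_pos; linarith)

/-- With ζ = `root 1`, compare imaginary parts in ζ³ζ = ζ⁴, where ζ⁴ is the conjugate of ζ³, and
cancel the factor sin(2π/7). -/
lemma C1_cubic : 8 * C1 ^ 3 + 4 * C1 ^ 2 - 4 * C1 - 1 = 0 := by
  have h43 : root 3 * root 1 = root 4 := by rw [← root_add]; rfl
  have h := congrArg Complex.im h43
  rw [root3, root1, root4] at h
  simp only [Complex.mul_im, C3, S3] at h
  have hS := S1_sq
  have : S1 * (8 * C1 ^ 3 + 4 * C1 ^ 2 - 4 * C1 - 1) = 0 := by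
    have h3 : S1 ^ 3 = S1 * (1 - C1 ^ 2) := by rw [pow_succ, hS]; ring
    linear_combination h + (4 * C1 + 4) * h3
  exact (mul_eq_zero.mp this).resolve_left S1_pos.ne'

lemma C1_pos : 0 < C1 := Real.cos_pos_of_mem_Ioo
  ⟨by have := Real.pi_pos; linarith, by have := Real.pi_pos; linarith⟩

/-- The cubic has a single positive root, so its sign at a positive decimal decides on which side of
`C1` the decimal lies. -/
lemma C1_lower : 0.6234898 < C1 := by
  by_contra! h
  have := C1_cubic
  nlinarith [C1_pos, mul_nonneg C1_pos.le (sub_nonneg.2 h), mul_nonneg (mul_nonneg C1_pos.le C1_pos.le) (sub_nonneg.2 h)]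
lemma C1_upper : C1 < 0.6234899 := by
  by_contra! h
  have := C1_cubic
  nlinarith [C1_pos, mul_nonneg C1_pos.le (sub_nonneg.2 h), mul_nonneg (mul_nonneg C1_pos.le C1_pos.le) (sub_nonneg.2 h)]
lemma S1_lower : 0.7818314 < S1 := by
  have := S1_sq
  nlinarith [C1_lower, C1_upper, S1_pos, C1_pos]
lemma S1_upper : S1 < 0.7818316 := by
  have := S1_sq
  nlinarith [C1_lower, C1_upper, S1_pos, C1_pos]

/-- `x` differs from `q` by at most `ε`. -/
def Near (x q ε : ℝ) : Prop := q - ε ≤ x ∧ x ≤ q + ε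

/-- Interval arithmetic with rounding: `p` is a rounded decimal for `q * r`, and the hypothesis on
`η` involves only numerals in applications, so that `norm_num` settles it. -/
lemma Near.mul {x y q r ε δ p η : ℝ} (hx : Near x q ε) (hy : Near y r δ)
    (h : |q * r - p| + |q| * δ + |r| * ε + ε * δ ≤ η) : Near (x * y) p η := by
  have hx' : |x - q| ≤ ε := abs_le.2 ⟨by linarith [hx.1], by linarith [hx.2]⟩
  have hy' : |y - r| ≤ δ := abs_le.2 ⟨by linarith [hy.1], by linarith [hy.2]⟩
  have e1 : |x * y - p| ≤ η := by
    have : x * y - p = (x - q) * (y - r) + q * (y - r) + r * (x - q) + (q * r - p) := by ring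
    rw [this]
    refine (abs_add_le _ _).trans ?_
    refine (add_le_add_left ((abs_add_le _ _).trans (add_le_add_left (abs_add_le _ _) _)) _).trans ?_
    rw [abs_mul, abs_mul, abs_mul]
    have h1 := mul_le_mul hx' hy' (abs_nonneg _) ((abs_nonneg _).trans hx')
    have h2 := mul_le_mul_of_nonneg_left hy' (abs_nonneg q)
    have h3 := mul_le_mul_of_nonneg_left hx' (abs_nonneg r)
    linarith
  have := abs_le.1 e1
  exact ⟨by linarith [this.1], by linarith [this.2]⟩

lemma near_C1 : Near C1 0.6234898 (1 / 10 ^ 6) := by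
  constructor <;> norm_num <;> linarith [C1_lower, C1_upper]
lemma near_S1 : Near S1 0.7818315 (1 / 10 ^ 6) := by
  constructor <;> norm_num <;> linarith [S1_lower, S1_upper]
lemma near_C2 : Near C2 (-0.2225209) (1 / 10 ^ 6) := by
  constructor <;> rw [C2] <;> norm_num <;> nlinarith [C1_lower, C1_upper]
lemma near_S2 : Near S2 0.9749279 (1 / 10 ^ 6) := by
  constructor <;> rw [S2] <;> norm_num <;> nlinarith [C1_lower, C1_upper, S1_lower, S1_upper]
lemma C_sum : C1 + C2 + C3 = -1 / 2 := by
  rw [C2, C3]; linear_combination C1_cubic / 2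
lemma near_C3 : Near C3 (-0.9009689) (2 / 10 ^ 6) := by
  have h1 := near_C1; have h2 := near_C2; have := C_sum
  constructor <;> norm_num <;> norm_num [Near] at h1 h2 <;> linarith
lemma near_S3 : Near S3 0.4338837 (6 / 10 ^ 6) := by
  have e : S3 = S1 * (4 * C1 ^ 2 - 1) := by
    rw [S3, pow_succ, S1_sq]; ring
  have h2 : Near (4 * C1 ^ 2 - 1) 0.5549581 (2 / 10 ^ 6) := by
    constructor <;> norm_num <;> nlinarith [C1_lower, C1_upper]
  rw [e]
  exact near_S1.mul h2 (by norm_num [abs_of_pos, abs_of_neg])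

/-! ### Parallelograms inscribed in a planar convex body -/

/-- The signed area of the parallelogram spanned by two vectors of the plane. -/
def area2 (s t : Plane) : ℝ := s 0 * t 1 - s 1 * t 0

lemma area2_toPlane (s t : ℂ) : area2 (toPlane s) (toPlane t) = cross s t := by
  simp [area2, toPlane_zero, toPlane_one, cross]

lemma area2_add (s a b : Plane) : area2 s (a + b) = area2 s a + area2 s b := by
  simp [area2]; ring
lemma area2_sub (s a b : Plane) : area2 s (a - b) = area2 s a - area2 s b := by
  simp [area2]; ring
lemma area2_smul (s a : Plane) (r : ℝ) : area2 s (r • a) = r * area2 s a := by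
  simp [area2]; ring
lemma area2_neg (s a : Plane) : area2 s (-a) = - area2 s a := by
  simp [area2]; ring
lemma area2_neg_left (s a : Plane) : area2 (-s) a = - area2 s a := by
  simp [area2]; ring
lemma area2_self (s : Plane) : area2 s s = 0 := by simp [area2]; ring

lemma parallelogramArea_eq (s t : Plane) : parallelogramArea s t = |area2 s t| := rfl

lemma plane_ext {a b : Plane} (h0 : a 0 = b 0) (h1 : a 1 = b 1) : a = b := by
  ext i; fin_cases i <;> assumption

/-- Any two vectors `s ≠ 0`, `d` with `area2 s d = 0` are parallel. -/
lemma exists_smul_of_area2_eq_zero {s d : Plane} (hs : s ≠ 0) (h : area2 s d = 0) :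
    ∃ r : ℝ, d = r • s := by
  by_cases h0 : s 0 = 0
  · have h1 : s 1 ≠ 0 := fun h1 => hs (plane_ext h0 h1)
    refine ⟨d 1 / s 1, plane_ext ?_ ?_⟩
    · have : s 1 * d 0 = 0 := by simp [area2, h0] at h; simpa using h
      simp [h0, (mul_eq_zero.mp this).resolve_left h1]
    · simp; field_simp
  · refine ⟨d 0 / s 0, plane_ext ?_ ?_⟩
    · simp; field_simp
    · simp only [area2] at h
      simp; field_simp; linarith

lemma linearIndependent_pair_iff_area2 (s t : Plane) :
    LinearIndependent ℝ ![s, t] ↔ area2 s t ≠ 0 := by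
  rw [LinearIndependent.pair_iff]
  constructor
  · intro h hz
    by_cases hs : s = 0
    · have := h 1 0 (by simp [hs]); simp at this
    · obtain ⟨r, hr⟩ := exists_smul_of_area2_eq_zero hs hz
      have := h r (-1) (by rw [hr]; simp)
      simp at this
  · intro hz a b hab
    have h1 : area2 s (a • s + b • t) = 0 := by rw [hab]; simp [area2]
    have h2 : area2 t (a • s + b • t) = 0 := by rw [hab]; simp [area2]
    have h3 : area2 t s = - area2 s t := by simp [area2]; ring
    rw [area2_add, area2_smul, area2_smul, area2_self] at h1 h2
    rw [h3] at h2
    constructor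
    · have : a * area2 s t = 0 := by linarith
      exact (mul_eq_zero.mp this).resolve_right hz
    · have : b * area2 s t = 0 := by linarith
      exact (mul_eq_zero.mp this).resolve_right hz

/-- A linear functional on the plane that vanishes on `s ≠ 0` is a multiple of `area2 s`. -/
lemma exists_eq_area2_of_apply_eq_zero (f : Plane →L[ℝ] ℝ) {s : Plane} (hs : s ≠ 0)
    (h : f s = 0) : ∃ r : ℝ, ∀ z, f z = r * area2 s z := by
  have hn : 0 < s 0 ^ 2 + s 1 ^ 2 := by
    by_contra! hle
    exact hs (plane_ext (by simp; nlinarith [sq_nonneg (s 0), sq_nonneg (s 1)])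
      (by simp; nlinarith [sq_nonneg (s 0), sq_nonneg (s 1)]))
  let t : Plane := !₂[-s 1, s 0]
  refine ⟨f t / (s 0 ^ 2 + s 1 ^ 2), fun z => ?_⟩
  have hz : z = ((s 0 * z 0 + s 1 * z 1) / (s 0 ^ 2 + s 1 ^ 2)) • s
      + (area2 s z / (s 0 ^ 2 + s 1 ^ 2)) • t := by
    apply plane_ext
    · simp [t, area2]; field_simp; ring
    · simp [t, area2]; field_simp; ring
  conv_lhs => rw [hz]
  rw [map_add, map_smul, map_smul, h]
  simp; ring

/-- A boundary point of a planar convex body in the open segment between two of its points: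
the body lies on one side of the line through them. -/
lemma one_side_of_mem_frontier {K : Set Plane} (hK : Convex ℝ K) (hint : (interior K).Nonempty)
    {z s : Plane} (hs : s ≠ 0) (hz : z ∈ frontier K) {a b : ℝ} (ha : 0 < a) (hb : 0 < b)
    (h1 : z - a • s ∈ K) (h2 : z + b • s ∈ K) :
    (∀ k ∈ K, area2 s k ≤ area2 s z) ∨ (∀ k ∈ K, area2 s z ≤ area2 s k) := by
  obtain ⟨f, hf⟩ := geometric_hahn_banach_open_point hK.interior isOpen_interior hz.2
  have hle : ∀ k ∈ K, f k ≤ f z := by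
    intro k hk
    have hk' : k ∈ closure (interior K) := by
      rw [hK.closure_interior_eq_closure_of_nonempty_interior hint]; exact subset_closure hk
    exact closure_minimal (fun y hy => (hf y hy).le)
      (isClosed_le f.continuous continuous_const) hk'
  have e1 := hle _ h1
  have e2 := hle _ h2
  simp only [map_sub, map_add, map_smul, smul_eq_mul] at e1 e2
  -- The supporting functional is maximal at `z`, and `K` has points on both sides of `z` along `s`,
  -- so it cannot increase in either direction.
  have hfs : f s = 0 := by
    apply le_antisymm
    · by_contra! h; nlinarith
    · by_contra! h; nlinarith
  obtain ⟨r, hr⟩ := exists_eq_area2_of_apply_eq_zero f hs hfs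
  obtain ⟨k0, hk0⟩ := hint
  have hlt := hf k0 hk0
  rw [hr, hr] at hlt
  rcases lt_trichotomy r 0 with h | h | h
  · right; intro k hk; have := hle k hk; rw [hr, hr] at this; nlinarith
  · simp [h] at hlt
  · left; intro k hk; have := hle k hk; rw [hr, hr] at this; nlinarith

/-- Heights are measured by `area2 s`. Between a chord `2s` and a chord `s`, convexity provides a
chord longer than `s` at every height strictly below that of the short one. If a chord `s` had both
ends on the boundary there, one end would lie strictly inside a longer segment of `K`, and its line
would support `K`. This is impossible with `q` above the line and `b` below it. -/
lemma chord_height {K : Set Plane} (hK : Convex ℝ K) (hint : (interior K).Nonempty)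
    {s x q p b : Plane} (hs : s ≠ 0) (hx : x ∈ K) (hy : x + (2 : ℝ) • s ∈ K)
    (hq : q ∈ K) (hqs : q + s ∈ K) (hp : p ∈ frontier K) (hps : p + s ∈ frontier K)
    (hpK : p ∈ K) (hpsK : p + s ∈ K)
    (hxq : area2 s x < area2 s q) (hxp : area2 s x ≤ area2 s p)
    (hb : b ∈ K) (hbp : area2 s b < area2 s p) : area2 s q ≤ area2 s p := by
  by_contra! hlt
  -- Relative height of `p` between `x` and `q`; at this height `K` contains the chord from `a` to
  -- `a + (2 - μ) • s`, where `2 - μ > 1`.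
  set μ := (area2 s p - area2 s x) / (area2 s q - area2 s x) with hμ
  have hd : 0 < area2 s q - area2 s x := by linarith
  have hμ0 : 0 ≤ μ := div_nonneg (by linarith) hd.le
  have hμ1 : μ < 1 := by rw [hμ, div_lt_one hd]; linarith
  have ha : (1 - μ) • x + μ • q ∈ K := hK hx hq (by linarith) hμ0 (by ring)
  have hb' : (1 - μ) • (x + (2 : ℝ) • s) + μ • (q + s) ∈ K :=
    hK hy hqs (by linarith) hμ0 (by ring)
  have hha : area2 s (p - ((1 - μ) • x + μ • q)) = 0 := by
    have : μ * (area2 s q - area2 s x) = area2 s p - area2 s x := by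
      rw [hμ]; field_simp
    rw [area2_sub, area2_add, area2_smul, area2_smul]; linarith
  obtain ⟨r, hr⟩ := exists_smul_of_area2_eq_zero hs hha
  set a := (1 - μ) • x + μ • q with ha_def
  have hpa : p = a + r • s := by rw [← hr]; abel
  have hb2 : a + (2 - μ) • s ∈ K := by
    convert hb' using 1
    rw [ha_def]; module
  -- The long chord extends strictly beyond `p + s` if `r ≤ 0`, and strictly beyond `p` if `r > 0`.
  by_cases hcase : r ≤ 0
  · rcases one_side_of_mem_frontier hK hint hs hps one_pos (b := 1 - μ - r) (by linarith)
      (by simpa using hpK) (by convert hb2 using 1; rw [hpa]; module) with h | h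
    · have := h _ hq; rw [area2_add, area2_self] at this; linarith
    · have := h _ hb; rw [area2_add, area2_self] at this; linarith
  · push Not at hcase
    rcases one_side_of_mem_frontier hK hint hs hp hcase one_pos
      (by convert ha using 1; rw [hpa]; module) (by simpa using hpsK) with h | h
    · have := h _ hq; linarith
    · have := h _ hb; linarith

/-- If `K` contains chords `2s`, `s`, `s` at the heights `h(q₁) ≤ h(x) ≤ h(q₂)`, then every
parallelogram inscribed in `K` with a side `s` has area at least `h(q₂) - h(q₁)`. -/
lemma le_area_of_inscribed {K : Set Plane} (hK : Convex ℝ K) (hcl : IsClosed K)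
    (hint : (interior K).Nonempty)
    {s t x q₁ q₂ p : Plane} (hs : s ≠ 0) (hx : x ∈ K) (hy : x + (2 : ℝ) • s ∈ K)
    (hq₁ : q₁ ∈ K) (hq₁s : q₁ + s ∈ K) (hq₂ : q₂ ∈ K) (hq₂s : q₂ + s ∈ K)
    (hp : p ∈ frontier K) (hps : p + s ∈ frontier K) (hpst : p + s + t ∈ frontier K)
    (hpt : p + t ∈ frontier K) (hne : area2 s t ≠ 0) :
    area2 s q₂ - area2 s q₁ ≤ |area2 s t| := by
  -- With `area2 s t > 0` the chord at `p` is the lower side and the one at `p + t` the upper side.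
  -- The upper side is shown to lie at least as high as `q₂`, the lower one at most as high as `q₁`.
  have key : ∀ p t : Plane, p ∈ frontier K → p + s ∈ frontier K → p + t + s ∈ frontier K →
      p + t ∈ frontier K → 0 < area2 s t → area2 s q₂ - area2 s q₁ ≤ area2 s t := by
    intro p t hp hps hpts hpt hpos
    have sub := hcl.frontier_subset
    have flip : ∀ z : Plane, area2 (-s) z = - area2 s z := area2_neg_left s
    have hadd := area2_add s p t
    -- the flipped version of `chord_height`
    have down : ∀ P q b : Plane, P ∈ frontier K → P + s ∈ frontier K → q ∈ K → q + s ∈ K →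
        area2 s q < area2 s x → area2 s P ≤ area2 s x → b ∈ K → area2 s P < area2 s b →
        area2 s P ≤ area2 s q := by
      intro P q b hP hPs hq hqs hqx hPx hb hPb
      have := chord_height hK hint (s := -s) (x := x + (2 : ℝ) • s) (q := q + s) (p := P + s)
        (b := b) (neg_ne_zero.2 hs) hy (by convert hx using 1; module) hqs (by simpa using hq)
        hPs (by simpa using hP) (sub hPs) (by simpa using sub hP)
        (by simp only [flip, area2_add, area2_smul, area2_self]; linarith)
        (by simp only [flip, area2_add, area2_smul, area2_self]; linarith) hb
        (by simp only [flip, area2_add, area2_self]; linarith)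
      simp only [flip, area2_add, area2_self] at this
      linarith
    have up : ∀ P q b : Plane, P ∈ frontier K → P + s ∈ frontier K → q ∈ K → q + s ∈ K →
        area2 s x < area2 s q → area2 s x ≤ area2 s P → b ∈ K → area2 s b < area2 s P →
        area2 s q ≤ area2 s P := fun P q b hP hPs hq hqs hqx hPx hb hPb =>
      chord_height hK hint hs hx hy hq hqs hP hPs (sub hP) (sub hPs) hqx hPx hb hPb
    -- An upper side below the level of `x` is excluded by taking the lower side of the
    -- parallelogram itself as the comparison chord in `down`.
    have top : area2 s q₂ ≤ area2 s (p + t) := by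
      by_contra! hlt
      rcases le_or_gt (area2 s x) (area2 s (p + t)) with h | h
      · have := up (p + t) q₂ p hpt hpts hq₂ hq₂s (by linarith) h (sub hp) (by linarith)
        linarith
      · have := down (p + t) p x hpt hpts (sub hp) (sub hps) (by linarith) h.le hx h
        linarith
    have bot : area2 s p ≤ area2 s q₁ := by
      by_contra! hlt
      rcases le_or_gt (area2 s p) (area2 s x) with h | h
      · have := down p q₁ (p + t) hp hps hq₁ hq₁s (by linarith) h (sub hpt) (by linarith)
        linarith
      · have := up p (p + t) x hp hps (sub hpt) (sub hpts) (by linarith) h.le hx h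
        linarith
    linarith
  rcases lt_or_gt_of_ne hne with h | h
  · have := key (p + t) (-t) hpt (by convert hpst using 1; abel) (by simpa using hps)
      (by simpa using hp) (by rw [area2_neg]; linarith)
    rw [area2_neg] at this
    rwa [abs_of_neg h]
  · rw [abs_of_pos h]
    exact key p t hp hps (by convert hpst using 1; abel) hpt h

/-! ### Affine diameters and the least half-length area -/

lemma IsAffineDiameter.dist_eq {K : Set Plane} {x y x' y' : Plane} (h : IsAffineDiameter K x y)
    (h' : IsAffineDiameter K x' y') {c : ℝ} (hc : y' - x' = c • (y - x)) :
    dist x y = dist x' y' := by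
  have hc0 : c ≠ 0 := by
    rintro rfl
    rw [zero_smul, sub_eq_zero] at hc
    exact h'.2.2.1 hc.symm
  apply le_antisymm
  · exact h'.2.2.2 x h.1 y h.2.1 ⟨c⁻¹, by rw [hc, smul_smul, inv_mul_cancel₀ hc0, one_smul]⟩
  · exact h.2.2.2 x' h'.1 y' h'.2.1 ⟨c, hc⟩

lemma IsAffineDiameter.eq_or_eq_neg {K : Set Plane} {x y x' y' : Plane}
    (h : IsAffineDiameter K x y)
    (h' : IsAffineDiameter K x' y') {c : ℝ} (hc : y' - x' = c • (y - x)) :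
    y' - x' = y - x ∨ y' - x' = -(y - x) := by
  have h1 := h.dist_eq h' hc
  rw [dist_comm, dist_eq_norm, dist_comm x', dist_eq_norm, hc, norm_smul] at h1
  have hn : 0 < ‖y - x‖ := norm_pos_iff.2 (sub_ne_zero.2 h.2.2.1.symm)
  have h2 : |c| = 1 := by
    rw [Real.norm_eq_abs] at h1
    exact mul_right_cancel₀ hn.ne' (by linarith)
  rcases (abs_eq zero_le_one).1 h2 with h | h
  · left; rw [hc, h, one_smul]
  · right; rw [hc, h]; simp

lemma bddBelow_halfLengthArea (K : Set Plane) : BddBelow {a : ℝ | ∃ p s t : Plane,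
    IsHalfLengthParallelogram K p s t ∧ a = parallelogramArea s t} :=
  ⟨0, by rintro a ⟨p, s, t, -, rfl⟩; exact abs_nonneg _⟩

lemma leastHalfLengthArea_le {K : Set Plane} {p s t : Plane}
    (h : IsHalfLengthParallelogram K p s t) : leastHalfLengthArea K ≤ parallelogramArea s t :=
  csInf_le (bddBelow_halfLengthArea K) ⟨p, s, t, h, rfl⟩

lemma le_leastHalfLengthArea {K : Set Plane} {p s t : Plane}
    (h : IsHalfLengthParallelogram K p s t) {d : ℝ}
    (hd : ∀ p s t, IsHalfLengthParallelogram K p s t → d ≤ parallelogramArea s t) :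
    d ≤ leastHalfLengthArea K :=
  le_csInf ⟨_, p, s, t, h, rfl⟩ (by rintro a ⟨p, s, t, h, rfl⟩; exact hd p s t h)

lemma exists_smul_mem_frontier {K : Set Plane} (hK : Convex ℝ K) (hb : Bornology.IsBounded K)
    {r : ℝ} (hr : 0 < r) (hball : Metric.closedBall 0 r ⊆ K) {s : Plane} (hs : s ≠ 0) :
    ∃ a : ℝ, 0 < a ∧ r ≤ a * ‖s‖ ∧ a • s ∈ frontier K := by
  have h0 : K ∈ 𝓝 (0 : Plane) := Filter.mem_of_superset (Metric.closedBall_mem_nhds 0 hr) hball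
  have hg : 0 < gauge K s := by
    rw [gauge_pos (absorbent_nhds_zero h0) (NormedSpace.isVonNBounded_of_isBounded ℝ hb)]
    exact hs
  refine ⟨(gauge K s)⁻¹, inv_pos.2 hg, ?_, ?_⟩
  · have h1 : gauge K s ≤ ‖s‖ / r := by
      rw [← gauge_closedBall hr.le]
      exact gauge_mono (absorbent_nhds_zero (Metric.closedBall_mem_nhds 0 hr)) hball s
    rw [inv_mul_eq_div, le_div_iff₀ hg]
    rw [le_div_iff₀ hr] at h1
    linarith
  · rw [← gauge_eq_one_iff_mem_frontier hK h0, gauge_smul_of_nonneg (inv_nonneg.2 hg.le),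
      smul_eq_mul, inv_mul_cancel₀ hg.ne']

/-- A lower bound on the least area of half-length parallelograms of a body with an inner ball. -/
lemma leastHalfLengthArea_pos {K : Set Plane} (hK : Convex ℝ K) (hc : IsCompact K)
    {r : ℝ} (hr : 0 < r) (hball : Metric.closedBall 0 r ⊆ K)
    {p₀ s₀ t₀ : Plane} (h₀ : IsHalfLengthParallelogram K p₀ s₀ t₀) :
    0 < leastHalfLengthArea K := by
  -- The bound r²/2 arises from two facts: an affine diameter is at least 2r long, so ‖s‖ ≥ r, and
  -- two chords equal to `s` exist in `K` whose heights differ by at least r‖s‖/2.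
  refine lt_of_lt_of_le (show (0 : ℝ) < r ^ 2 / 2 by positivity)
    (le_leastHalfLengthArea h₀ fun p s t h => ?_)
  obtain ⟨hli, hp, hps, hpst, hpt, x, y, hxy, hs⟩ := h
  rw [linearIndependent_pair_iff_area2] at hli
  have hs0 : s ≠ 0 := by rintro rfl; simp [area2] at hli
  have hy : y = x + (2 : ℝ) • s := by rw [hs]; module
  obtain ⟨a, ha, har, hafr⟩ := exists_smul_mem_frontier hK hc.isBounded hr hball hs0
  obtain ⟨b, hb, hbr, hbfr⟩ := exists_smul_mem_frontier hK hc.isBounded hr hball (neg_ne_zero.2 hs0)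
  have hsn : 0 < ‖s‖ := norm_pos_iff.2 hs0
  have hlen : r ≤ ‖s‖ := by
    have := hxy.2.2.2 _ hbfr _ hafr ⟨(a + b) / 2, by rw [hy]; module⟩
    rw [dist_comm, dist_eq_norm, dist_comm x, dist_eq_norm,
      show a • s - b • -s = (a + b) • s by module, show y - x = (2 : ℝ) • s by rw [hy]; module,
      norm_smul, norm_smul, Real.norm_of_nonneg (by positivity), Real.norm_of_nonneg (by norm_num)]
      at this
    rw [norm_neg] at hbr
    nlinarith
  have hint : (interior K).Nonempty :=
    ⟨0, mem_interior_iff_mem_nhds.2 (mem_of_superset (Metric.closedBall_mem_nhds 0 hr) hball)⟩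
  have sub := hc.isClosed.frontier_subset
  have hnorm : ‖s‖ ^ 2 = s 0 ^ 2 + s 1 ^ 2 := by
    rw [EuclideanSpace.norm_sq_eq]; simp
  have hN : ∀ ε : ℝ, |ε| = 1 → ∃ n ∈ K, area2 s n = ε * (r * ‖s‖) := by
    intro ε hε
    refine ⟨(ε * r / ‖s‖) • (!₂[-s 1, s 0] : Plane), hball ?_, ?_⟩
    · have hn : ‖(!₂[-s 1, s 0] : Plane)‖ = ‖s‖ := by
        rw [← sq_eq_sq₀ (norm_nonneg _) (norm_nonneg _), hnorm, EuclideanSpace.norm_sq_eq]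
        simp; ring
      rw [mem_closedBall_zero_iff, norm_smul, hn, Real.norm_eq_abs, abs_div, abs_mul, hε,
        abs_of_pos hr, abs_of_pos hsn]
      field_simp; exact le_rfl
    · rw [area2_smul]
      have : area2 s (!₂[-s 1, s 0] : Plane) = ‖s‖ ^ 2 := by
        rw [hnorm]; simp [area2]; ring
      rw [this]; field_simp
  have hxK := sub hxy.1
  have hyK : x + (2 : ℝ) • s ∈ K := hy ▸ sub hxy.2.1
  have hmid : x + s ∈ K := by
    have := hK hxK hyK (show (0 : ℝ) ≤ 1 / 2 by norm_num) (show (0 : ℝ) ≤ 1 / 2 by norm_num)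
      (by norm_num)
    convert this using 1; module
  -- Shrinking the affine diameter halfway towards a point `n` of `K` gives a chord equal to `s`.
  -- Below, `n` is the point of the ball extreme in height, on the side of the centre away from `x`.
  have hhalf : ∀ n ∈ K, (1 / 2 : ℝ) • x + (1 / 2 : ℝ) • n ∈ K ∧
      (1 / 2 : ℝ) • x + (1 / 2 : ℝ) • n + s ∈ K := by
    intro n hn
    refine ⟨hK hxK hn (by norm_num) (by norm_num) (by norm_num), ?_⟩
    have := hK hyK hn (show (0 : ℝ) ≤ 1 / 2 by norm_num) (show (0 : ℝ) ≤ 1 / 2 by norm_num)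
      (by norm_num)
    convert this using 1; module
  rw [parallelogramArea_eq]
  have hrs : r ^ 2 ≤ r * ‖s‖ := by nlinarith
  rcases le_total 0 (area2 s x) with h | h
  · obtain ⟨n, hn, han⟩ := hN (-1) (by simp)
    obtain ⟨h1, h2⟩ := hhalf n hn
    have := le_area_of_inscribed hK hc.isClosed hint hs0 hxK hyK h1 h2 hxK hmid
      hp hps hpst hpt hli
    rw [area2_add, area2_smul, area2_smul, han] at this
    linarith
  · obtain ⟨n, hn, han⟩ := hN 1 (by simp)
    obtain ⟨h1, h2⟩ := hhalf n hn
    have := le_area_of_inscribed hK hc.isClosed hint hs0 hxK hyK hxK hmid h1 h2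
      hp hps hpst hpt hli
    rw [area2_add, area2_smul, area2_smul, han] at this
    linarith

/-! ### The area of an oriented heptagon -/

/-- Twice the signed area of the triangle `a b c`. -/
def orient (a b c : ℂ) : ℝ := cross (b - a) (c - a)

/-- A heptagon all of whose triples of vertices are positively oriented. -/
def Oriented (z : Fin 7 → ℂ) : Prop := ∀ i j k : Fin 7, i < j → j < k → 0 < orient (z i) (z j) (z k)

/-- The area of an oriented heptagon by the shoelace formula. -/
noncomputable def shoelace (z : Fin 7 → ℂ) : ℝ := (∑ k, cross (z k) (z (k + 1))) / 2

lemma shoelace_eq_sum_orient (z : Fin 7 → ℂ) : shoelace z =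
    (orient (z 0) (z 1) (z 2) + orient (z 0) (z 2) (z 3) + orient (z 0) (z 3) (z 4)
      + orient (z 0) (z 4) (z 5) + orient (z 0) (z 5) (z 6)) / 2 := by
  simp [shoelace, Fin.sum_univ_succ, orient, cross, show (0:Fin 7) + 1 = 1 from rfl,
    show (1:Fin 7) + 1 = 2 from rfl, show (2:Fin 7) + 1 = 3 from rfl,
    show (3:Fin 7) + 1 = 4 from rfl, show (4:Fin 7) + 1 = 5 from rfl,
    show (5:Fin 7) + 1 = 6 from rfl, show (6:Fin 7) + 1 = 0 from rfl,
    show Fin.succ (1 : Fin 2) = 2 from rfl]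
  ring

/-- The linear map of the complex plane sending `1, I` to `u, w`. -/
noncomputable def spanMap (u w : ℂ) : ℂ →ₗ[ℝ] ℂ where
  toFun z := z.re * u + z.im * w
  map_add' a b := by simp; ring
  map_smul' r a := by simp; ring

lemma det_spanMap (u w : ℂ) : LinearMap.det (spanMap u w) = cross u w := by
  rw [← LinearMap.det_toMatrix Complex.basisOneI, Matrix.det_fin_two]
  simp [LinearMap.toMatrix_apply, spanMap, cross]
  ring

/-- The standard open triangle. -/
def stdTriangle : Set ℂ := {z | 0 < z.re ∧ 0 < z.im ∧ z.re + z.im < 1}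

/-- The standard closed triangle. -/
def stdTriangleClosed : Set ℂ := {z | 0 ≤ z.re ∧ 0 ≤ z.im ∧ z.re + z.im ≤ 1}

lemma isOpen_stdTriangle : IsOpen stdTriangle :=
  (isOpen_lt continuous_const Complex.continuous_re).inter
    ((isOpen_lt continuous_const Complex.continuous_im).inter
      (isOpen_lt (Complex.continuous_re.add Complex.continuous_im) continuous_const))

lemma volume_stdTriangle : volume stdTriangle = ENNReal.ofReal (1 / 2) := by
  have h : stdTriangle = Complex.measurableEquivRealProd ⁻¹'
      (regionBetween (fun _ => 0) (fun x => 1 - x) (Set.Ioo (0 : ℝ) 1)) := by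
    ext z
    simp only [stdTriangle, regionBetween, Set.mem_ofPred_eq, Set.mem_preimage,
      Complex.measurableEquivRealProd_apply, Set.mem_Ioo]
    constructor
    · rintro ⟨h1, h2, h3⟩; exact ⟨⟨h1, by linarith⟩, h2, by linarith⟩
    · rintro ⟨⟨h1, -⟩, h2, h3⟩; exact ⟨h1, h2, by linarith⟩
  rw [h, Complex.volume_preserving_equiv_real_prod.measure_preimage_equiv,
    Measure.volume_eq_prod, volume_regionBetween_eq_integral]
  · congr 1
    simp only [Pi.sub_apply, sub_zero]
    rw [← integral_Ioc_eq_integral_Ioo, ← intervalIntegral.integral_of_le zero_le_one]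
    rw [intervalIntegral.integral_sub (by simp) (by simp), integral_id]
    norm_num
  · exact (integrableOn_const (by simp)).mono_set Set.Subset.rfl
  · exact ((continuous_const.sub continuous_id).integrableOn_Icc).mono_set Set.Ioo_subset_Icc_self
  · exact measurableSet_Ioo
  · intro x hx; simpa using hx.2.le

lemma convex_stdTriangle : Convex ℝ stdTriangle := by
  rintro x ⟨hx1, hx2, hx3⟩ y ⟨hy1, hy2, hy3⟩ a b ha hb hab
  simp only [stdTriangle, Set.mem_ofPred_eq, Complex.add_re, Complex.real_smul, Complex.re_ofReal_mul,
    Complex.add_im, Complex.im_ofReal_mul]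
  rcases ha.eq_or_lt with rfl | ha
  · simp only [zero_add] at hab; subst hab; simpa using ⟨hy1, hy2, hy3⟩
  · refine ⟨by positivity, by positivity, ?_⟩
    have := mul_lt_mul_of_pos_left hx3 ha
    have := mul_le_mul_of_nonneg_left hy3.le hb
    linarith

/-- The closed triangle is contained in the closure of the open one, and the frontier of a convex
set is null. -/
lemma volume_stdTriangleClosed_le : volume stdTriangleClosed ≤ ENNReal.ofReal (1 / 2) := by
  have hsub : stdTriangleClosed ⊆ stdTriangle ∪ frontier stdTriangle := by
    rw [← closure_eq_self_union_frontier]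
    rintro z ⟨h1, h2, h3⟩
    have hm : ∀ n : ℕ, (1 - 1 / ((n : ℝ) + 1)) • z + (1 / ((n : ℝ) + 1)) • (⟨1 / 3, 1 / 3⟩ : ℂ) ∈
        stdTriangle := by
      intro n
      have hp : 0 < 1 / ((n : ℝ) + 1) := by positivity
      have hle : 1 / ((n : ℝ) + 1) ≤ 1 := by
        rw [div_le_one (by positivity)]; linarith [n.cast_nonneg (α := ℝ)]
      set δ := 1 / ((n : ℝ) + 1)
      simp only [stdTriangle, Set.mem_ofPred_eq, Complex.add_re, Complex.real_smul,
        Complex.re_ofReal_mul, Complex.add_im, Complex.im_ofReal_mul]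
      have e1 := mul_nonneg (sub_nonneg.2 hle) h1
      have e2 := mul_nonneg (sub_nonneg.2 hle) h2
      have e3 := mul_le_mul_of_nonneg_left h3 (sub_nonneg.2 hle)
      refine ⟨by linarith, by linarith, by linarith⟩
    refine mem_closure_of_tendsto (b := atTop) ?_ (Eventually.of_forall hm)
    have h := tendsto_one_div_add_atTop_nhds_zero_nat (𝕜 := ℝ)
    simpa using ((tendsto_const_nhds (x := (1 : ℝ))).sub h |>.smul_const z).add
      (h.smul_const (⟨1 / 3, 1 / 3⟩ : ℂ))
  calc volume stdTriangleClosed ≤ volume (stdTriangle ∪ frontier stdTriangle) := measure_mono hsub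
    _ ≤ volume stdTriangle + volume (frontier stdTriangle) := measure_union_le _ _
    _ = _ := by rw [convex_stdTriangle.addHaar_frontier volume, add_zero, volume_stdTriangle]

/-- The open triangle with vertices `a, b, c`. -/
noncomputable def openTriangle (a b c : ℂ) : Set ℂ :=
  (fun z => a + z) '' (spanMap (b - a) (c - a) '' stdTriangle)

/-- The closed triangle with vertices `a, b, c`. -/
noncomputable def closedTriangle (a b c : ℂ) : Set ℂ :=
  (fun z => a + z) '' (spanMap (b - a) (c - a) '' stdTriangleClosed)

lemma volume_openTriangle (a b c : ℂ) :
    volume (openTriangle a b c) = ENNReal.ofReal (|orient a b c| / 2) := by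
  rw [openTriangle, Set.image_add_left, measure_preimage_add, Measure.addHaar_image_linearMap,
    det_spanMap, volume_stdTriangle, ← ENNReal.ofReal_mul (abs_nonneg _), orient]
  congr 1; ring

lemma volume_closedTriangle_le (a b c : ℂ) :
    volume (closedTriangle a b c) ≤ ENNReal.ofReal (|orient a b c| / 2) := by
  rw [closedTriangle, Set.image_add_left, measure_preimage_add, Measure.addHaar_image_linearMap,
    det_spanMap]
  refine (mul_le_mul_right volume_stdTriangleClosed_le _).trans_eq ?_
  rw [← ENNReal.ofReal_mul (abs_nonneg _), orient]
  congr 1; ring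

lemma mem_openTriangle {a b c z : ℂ} : z ∈ openTriangle a b c ↔
    ∃ x y : ℝ, 0 < x ∧ 0 < y ∧ x + y < 1 ∧ z = a + (x * (b - a) + y * (c - a)) := by
  constructor
  · rintro ⟨_, ⟨w, ⟨h1, h2, h3⟩, rfl⟩, rfl⟩
    exact ⟨w.re, w.im, h1, h2, h3, rfl⟩
  · rintro ⟨x, y, h1, h2, h3, rfl⟩
    exact ⟨_, ⟨⟨x, y⟩, ⟨h1, h2, h3⟩, rfl⟩, rfl⟩

lemma mem_closedTriangle {a b c z : ℂ} : z ∈ closedTriangle a b c ↔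
    ∃ x y : ℝ, 0 ≤ x ∧ 0 ≤ y ∧ x + y ≤ 1 ∧ z = a + (x * (b - a) + y * (c - a)) := by
  constructor
  · rintro ⟨_, ⟨w, ⟨h1, h2, h3⟩, rfl⟩, rfl⟩
    exact ⟨w.re, w.im, h1, h2, h3, rfl⟩
  · rintro ⟨x, y, h1, h2, h3, rfl⟩
    exact ⟨_, ⟨⟨x, y⟩, ⟨h1, h2, h3⟩, rfl⟩, rfl⟩

lemma isOpen_openTriangle {a b c : ℂ} (h : 0 < orient a b c) : IsOpen (openTriangle a b c) := by
  have hdet : IsUnit (LinearMap.det (spanMap (b - a) (c - a))) := by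
    rw [det_spanMap]; exact h.ne'.isUnit
  have h2 : IsOpen (spanMap (b - a) (c - a) '' stdTriangle) := by
    have := (LinearEquiv.toContinuousLinearEquiv
      (LinearMap.equivOfDetNeZero _ hdet.ne_zero)).toHomeomorph.isOpenMap _ isOpen_stdTriangle
    exact this
  exact (Homeomorph.addLeft a).isOpenMap _ h2

lemma orient_add_smul (a b u v : ℂ) (x y : ℝ) :
    orient a b (a + (x * (u - a) + y * (v - a))) = x * orient a b u + y * orient a b v := by
  simp [orient, cross]; ring

lemma Oriented.orient_nonneg {z : Fin 7 → ℂ} (hz : Oriented z) {j k : Fin 7} (hj : 0 < j)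
    (hjk : j ≤ k) : 0 ≤ orient (z 0) (z j) (z k) := by
  rcases hjk.eq_or_lt with rfl | h
  · simp [orient, cross_same]
  · exact (hz 0 j k hj h).le

lemma orient_swap (a b c : ℂ) : orient a b c = - orient a c b := cross_swap _ _

/-- The fan triangulation of a heptagon from its first vertex. -/
noncomputable def fan (z : Fin 7 → ℂ) (k : Fin 5) : ℝ :=
  orient (z 0) (z (k.castSucc.succ)) (z k.succ.succ)

lemma sum_fan (z : Fin 7 → ℂ) : ∑ k, fan z k = 2 * shoelace z := by
  rw [shoelace_eq_sum_orient]
  simp only [Fin.sum_univ_five, fan]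
  have h : ∀ a b c d e f : ℝ, a + b + c + d + e = 2 * ((a + b + c + d + e) / 2) := by intros; ring
  exact (h _ _ _ _ _ 0)

lemma Oriented.fan_pos {z : Fin 7 → ℂ} (hz : Oriented z) (k : Fin 5) : 0 < fan z k :=
  hz _ _ _ (Fin.succ_pos _) (by rw [Fin.succ_lt_succ_iff]; exact Fin.castSucc_lt_succ)

lemma mem_convexHull_of_closedTriangle {z : Fin 7 → ℂ} {i j k : Fin 7} {w : ℂ}
    (h : w ∈ closedTriangle (z i) (z j) (z k)) : w ∈ convexHull ℝ (Set.range z) := by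
  obtain ⟨x, y, hx, hy, hxy, rfl⟩ := mem_closedTriangle.1 h
  have hc := convex_convexHull ℝ (Set.range z)
  have hm : ∀ i, z i ∈ convexHull ℝ (Set.range z) := fun i => subset_convexHull ℝ _ ⟨i, rfl⟩
  have := hc.sum_mem (t := Finset.univ) (w := ![1 - x - y, x, y]) (z := ![z i, z j, z k])
    (by intro i _; fin_cases i <;> simp <;> linarith)
    (by simp [Fin.sum_univ_three]; ring) (by intro i _; fin_cases i <;> simp [hm])
  convert this using 1
  simp [Fin.sum_univ_three]; ring

lemma openTriangle_subset (a b c : ℂ) : openTriangle a b c ⊆ closedTriangle a b c := by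
  intro w hw
  obtain ⟨x, y, hx, hy, hxy, rfl⟩ := mem_openTriangle.1 hw
  exact mem_closedTriangle.2 ⟨x, y, hx.le, hy.le, hxy.le, rfl⟩

/-- The open triangles of the fan from `z 0` are disjoint and lie in the hull. Open triangles give
the lower bound, closed ones the covering needed for the upper bound in `Oriented.volume_eq`. -/
lemma Oriented.le_volume {z : Fin 7 → ℂ} (hz : Oriented z) :
    ENNReal.ofReal (shoelace z) ≤ volume (convexHull ℝ (Set.range z)) := by
  let T : Fin 5 → Set ℂ := fun k => openTriangle (z 0) (z (k.castSucc.succ)) (z k.succ.succ)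
  have hd : Pairwise (Function.onFun Disjoint T) := by
    -- For k < j the ray from `z 0` to the first outer vertex of the j-th triangle separates: the
    -- j-th triangle lies strictly to its left, the k-th one strictly to its right.
    have key : ∀ k j : Fin 5, k < j → Disjoint (T k) (T j) := by
      intro k j hkj
      rw [Set.disjoint_left]
      intro w hw hw'
      obtain ⟨x, y, hx, hy, hxy, rfl⟩ := mem_openTriangle.1 hw
      obtain ⟨x', y', hx', hy', hxy', h⟩ := mem_openTriangle.1 hw'
      have h1 := orient_add_smul (z 0) (z j.castSucc.succ) (z k.castSucc.succ) (z k.succ.succ) x y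
      rw [h, orient_add_smul] at h1
      have e1 : orient (z 0) (z j.castSucc.succ) (z j.castSucc.succ) = 0 := by
        simp [orient, cross_same]
      have e2 := hz.fan_pos j
      have e3 : 0 < orient (z 0) (z k.castSucc.succ) (z j.castSucc.succ) :=
        hz _ _ _ (Fin.succ_pos _) (by simpa using hkj)
      have e4 : 0 ≤ orient (z 0) (z k.succ.succ) (z j.castSucc.succ) :=
        hz.orient_nonneg (Fin.succ_pos _) (by
          rw [Fin.succ_le_succ_iff]; exact Fin.succ_le_castSucc_iff.2 hkj)
      rw [orient_swap] at e3 e4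
      rw [e1] at h1
      unfold fan at e2
      nlinarith [mul_pos hy' e2, mul_pos hx e3, mul_nonneg hy.le e4]
    intro k j hkj
    rcases lt_or_gt_of_ne hkj with h | h
    · exact key k j h
    · exact (key j k h).symm
  have hm : ∀ k, MeasurableSet (T k) := fun k => (isOpen_openTriangle (hz.fan_pos k)).measurableSet
  calc ENNReal.ofReal (shoelace z) = ∑ k, ENNReal.ofReal (fan z k / 2) := by
        rw [← ENNReal.ofReal_sum_of_nonneg fun k _ => by have := hz.fan_pos k; positivity,
          ← Finset.sum_div, sum_fan]
        congr 1; ring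
    _ = ∑ k, volume (T k) := by
        refine Finset.sum_congr rfl fun k _ => ?_
        rw [volume_openTriangle]; rw [abs_of_pos (show 0 < orient _ _ _ from hz.fan_pos k)]; rfl
    _ = volume (⋃ k, T k) := by
        rw [measure_iUnion hd hm, tsum_fintype]
    _ ≤ _ := measure_mono (Set.iUnion_subset fun k =>
        (openTriangle_subset _ _ _).trans fun w => mem_convexHull_of_closedTriangle)

lemma orient_convex (a b : ℂ) : Convex ℝ {w : ℂ | 0 ≤ orient a b w} := by
  intro x hx y hy s t hs ht hst
  have : orient a b (s • x + t • y) = s * orient a b x + t * orient a b y := by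
    obtain rfl : t = 1 - s := by linarith
    simp [orient, cross]; ring
  simp only [Set.mem_ofPred_eq] at *
  rw [this]; positivity

lemma Oriented.edge_nonneg {z : Fin 7 → ℂ} (hz : Oriented z) (k j : Fin 7) :
    0 ≤ orient (z k) (z (k + 1)) (z j) := by
  have cyc : ∀ a b c : ℂ, orient a b c = orient b c a := by
    intros; simp [orient, cross]; ring
  have h0 : ∀ a b, orient a b a = 0 := by intros; simp [orient, cross]
  have h1 : ∀ a b, orient a b b = 0 := by intros; simp [orient, cross]; ring
  by_cases hk : k = 6
  · subst hk
    rw [show (6 : Fin 7) + 1 = 0 from rfl]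
    by_cases hj0 : j = 0
    · rw [hj0, h1]
    by_cases hj6 : j = 6
    · rw [hj6, h0]
    rw [cyc]
    exact (hz 0 j 6 (Fin.pos_of_ne_zero hj0) (by omega)).le
  · have hk1 : k < k + 1 := by omega
    rcases lt_trichotomy j k with h | h | h
    · rw [cyc, cyc]; exact (hz j k (k + 1) h hk1).le
    · rw [h, h0]
    · rcases eq_or_ne j (k + 1) with h' | h'
      · rw [h', h1]
      · exact (hz k (k + 1) j hk1 (by omega)).le

lemma Oriented.edge_nonneg_of_mem {z : Fin 7 → ℂ} (hz : Oriented z) (k : Fin 7) {w : ℂ}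
    (hw : w ∈ convexHull ℝ (Set.range z)) : 0 ≤ orient (z k) (z (k + 1)) w := by
  refine convexHull_min ?_ (orient_convex (z k) (z (k + 1))) hw
  rintro _ ⟨j, rfl⟩
  exact hz.edge_nonneg k j

lemma mem_closedTriangle_of_orient {a b c w : ℂ} (h : 0 < orient a b c) (h1 : 0 ≤ orient a b w)
    (h2 : orient a c w ≤ 0) (h3 : 0 ≤ orient b c w) : w ∈ closedTriangle a b c := by
  refine mem_closedTriangle.2 ⟨- orient a c w / orient a b c, orient a b w / orient a b c,
    div_nonneg (by linarith) h.le, div_nonneg h1 h.le, ?_, ?_⟩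
  · rw [← add_div, div_le_one h]
    have : orient b c w = orient a b c - orient a b w + orient a c w := by
      simp [orient, cross]; ring
    linarith
  · have key : orient a b c * (w - a) = (-orient a c w) * (b - a) + orient a b w * (c - a) := by
      apply Complex.ext <;> simp [orient, cross] <;> ring
    have h' : (orient a b c : ℂ) ≠ 0 := by exact_mod_cast h.ne'
    push_cast
    field_simp
    linear_combination key

/-- Rotate from the first edge at `z 0` to the last. The point lies in the triangle just before the
first diagonal that does not have it strictly on its left. -/
lemma Oriented.mem_fan {z : Fin 7 → ℂ} (hz : Oriented z) {w : ℂ}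
    (he : ∀ k, 0 ≤ orient (z k) (z (k + 1)) w) :
    ∃ k : Fin 5, w ∈ closedTriangle (z 0) (z (k.castSucc.succ)) (z k.succ.succ) := by
  have mk : ∀ k : Fin 5, 0 ≤ orient (z 0) (z k.castSucc.succ) w →
      orient (z 0) (z k.succ.succ) w ≤ 0 →
      w ∈ closedTriangle (z 0) (z (k.castSucc.succ)) (z k.succ.succ) := by
    intro k h1 h2
    refine mem_closedTriangle_of_orient (hz.fan_pos k) h1 h2 ?_
    have := he k.castSucc.succ
    rwa [show k.castSucc.succ + 1 = k.succ.succ by fin_cases k <;> rfl] at this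
  have h1 : 0 ≤ orient (z 0) (z 1) w := he 0
  have h6 : orient (z 0) (z 6) w ≤ 0 := by
    have := he 6
    rw [show (6 : Fin 7) + 1 = 0 from rfl] at this
    have e : orient (z 0) (z 6) w = - orient (z 6) (z 0) w := by simp [orient, cross]; ring
    linarith
  by_cases h2 : orient (z 0) (z 2) w ≤ 0
  · exact ⟨0, mk 0 h1 h2⟩
  by_cases h3 : orient (z 0) (z 3) w ≤ 0
  · exact ⟨1, mk 1 (not_le.1 h2).le h3⟩
  by_cases h4 : orient (z 0) (z 4) w ≤ 0
  · exact ⟨2, mk 2 (not_le.1 h3).le h4⟩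
  by_cases h5 : orient (z 0) (z 5) w ≤ 0
  · exact ⟨3, mk 3 (not_le.1 h4).le h5⟩
  exact ⟨4, mk 4 (not_le.1 h5).le h6⟩

lemma Oriented.volume_eq {z : Fin 7 → ℂ} (hz : Oriented z) :
    volume (convexHull ℝ (Set.range z)) = ENNReal.ofReal (shoelace z) := by
  refine le_antisymm ?_ hz.le_volume
  calc volume (convexHull ℝ (Set.range z))
      ≤ volume (⋃ k : Fin 5, closedTriangle (z 0) (z (k.castSucc.succ)) (z k.succ.succ)) :=
        measure_mono fun w hw => Set.mem_iUnion.2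
          (hz.mem_fan fun k => hz.edge_nonneg_of_mem k hw)
    _ ≤ ∑ k : Fin 5, volume (closedTriangle (z 0) (z (k.castSucc.succ)) (z k.succ.succ)) :=
        measure_iUnion_fintype_le _ _
    _ ≤ ∑ k : Fin 5, ENNReal.ofReal (fan z k / 2) := by
        refine Finset.sum_le_sum fun k _ => (volume_closedTriangle_le _ _ _).trans_eq ?_
        rw [abs_of_pos (show 0 < orient _ _ _ from hz.fan_pos k)]; rfl
    _ = ENNReal.ofReal (shoelace z) := by
        rw [← ENNReal.ofReal_sum_of_nonneg fun k _ => by have := hz.fan_pos k; positivity,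
          ← Finset.sum_div, sum_fan]
        congr 1; ring

lemma Oriented.shoelace_pos {z : Fin 7 → ℂ} (hz : Oriented z) : 0 < shoelace z := by
  have := Finset.sum_pos (fun k _ => hz.fan_pos k) Finset.univ_nonempty
  rw [sum_fan] at this; linarith

lemma range_toPlane_comp (z : Fin 7 → ℂ) :
    convexHull ℝ (Set.range fun k => toPlane (z k)) = toPlane '' convexHull ℝ (Set.range z) := by
  rw [show (Set.range fun k => toPlane (z k)) = toPlane '' Set.range z from Set.range_comp _ _]
  exact (toPlane.toLinearEquiv.toLinearMap.image_convexHull _).symm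

lemma Oriented.planeArea_eq {z : Fin 7 → ℂ} (hz : Oriented z) :
    planeArea (convexHull ℝ (Set.range fun k => toPlane (z k))) = shoelace z := by
  have hm : NullMeasurableSet (convexHull ℝ (Set.range z)) :=
    (convex_convexHull ℝ _).nullMeasurableSet volume
  rw [planeArea, measureReal_def, range_toPlane_comp, toPlane.image_eq_preimage_symm,
    toPlane.symm.measurePreserving.measure_preimage hm, hz.volume_eq,
    ENNReal.toReal_ofReal hz.shoelace_pos.le]

/-! ### Boundary points and the explicit parallelograms -/

/-- The body spanned by a family of seven points. -/
noncomputable def body (z : Fin 7 → ℂ) : Set Plane :=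
  convexHull ℝ (Set.range fun k => toPlane (z k))

lemma convex_body (z : Fin 7 → ℂ) : Convex ℝ (body z) := convex_convexHull ℝ _

lemma isCompact_body (z : Fin 7 → ℂ) : IsCompact (body z) :=
  (Set.finite_range _).isCompact_convexHull (𝕜 := ℝ)

lemma toPlane_mem_body {z : Fin 7 → ℂ} {w : ℂ} :
    toPlane w ∈ body z ↔ w ∈ convexHull ℝ (Set.range z) := by
  rw [body, range_toPlane_comp]
  exact toPlane.injective.mem_set_image

lemma edge_point_mem (z : Fin 7 → ℂ) (i j : Fin 7) {x : ℝ} (h0 : 0 ≤ x) (h1 : x ≤ 1) :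
    z i + x * (z j - z i) ∈ convexHull ℝ (Set.range z) := by
  have := (convex_convexHull ℝ (Set.range z)) (subset_convexHull ℝ _ ⟨i, rfl⟩)
    (subset_convexHull ℝ _ ⟨j, rfl⟩) (sub_nonneg.2 h1) h0 (by ring)
  convert this using 1
  simp; ring

lemma cross_nonneg_of_mem {z : Fin 7 → ℂ} {e w u : ℂ} (h : ∀ j, 0 ≤ cross e (z j - w))
    (hu : u ∈ convexHull ℝ (Set.range z)) : 0 ≤ cross e (u - w) := by
  have hc : Convex ℝ {u : ℂ | 0 ≤ cross e (u - w)} := by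
    have := orient_convex w (w + e)
    simpa [orient] using this
  exact convexHull_min (by rintro _ ⟨j, rfl⟩; exact h j) hc hu

/-- The line through `w` in direction `e` supports the body, so moving from `w` along `-(I * e)`
leaves the body at once. -/
lemma toPlane_mem_frontier {z : Fin 7 → ℂ} {e w : ℂ} (he : e ≠ 0)
    (hw : w ∈ convexHull ℝ (Set.range z)) (h : ∀ j, 0 ≤ cross e (z j - w)) :
    toPlane w ∈ frontier (body z) := by
  refine ⟨subset_closure (toPlane_mem_body.2 hw), fun hint => ?_⟩
  have hc : Continuous fun t : ℝ => toPlane (w - t * (Complex.I * e)) := by fun_prop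
  have h0 : ∀ᶠ t : ℝ in 𝓝 (0 : ℝ), toPlane (w - t * (Complex.I * e)) ∈ body z := by
    have : (fun t : ℝ => toPlane (w - t * (Complex.I * e))) ⁻¹' interior (body z) ∈ 𝓝 (0 : ℝ) :=
      hc.continuousAt.preimage_mem_nhds (isOpen_interior.mem_nhds (by simpa using hint))
    filter_upwards [this] with t ht using interior_subset ht
  have h1 : ∀ᶠ t : ℝ in 𝓝[>] (0 : ℝ), toPlane (w - t * (Complex.I * e)) ∈ body z :=
    h0.filter_mono nhdsWithin_le_nhds
  obtain ⟨t, ht, ht0⟩ := (h1.and self_mem_nhdsWithin).exists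
  have := cross_nonneg_of_mem h (toPlane_mem_body.1 ht)
  have hn : 0 < e.re * e.re + e.im * e.im := by
    rw [← Complex.normSq_apply]; exact Complex.normSq_pos.2 he
  have hE : cross e (w - t * (Complex.I * e) - w) = - (t * (e.re * e.re + e.im * e.im)) := by
    simp [cross]; ring
  rw [hE] at this
  have := mul_pos (show (0 : ℝ) < t from ht0) hn
  linarith

lemma Oriented.edge_pos {z : Fin 7 → ℂ} (hz : Oriented z) (k : Fin 7) :
    z (k + 1) - z k ≠ 0 := by
  intro h
  have key : ∀ a b c : Fin 7, a < b → b < c → z a ≠ z b ∧ z b ≠ z c ∧ z a ≠ z c := by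
    intro a b c hab hbc
    have := hz a b c hab hbc
    refine ⟨?_, ?_, ?_⟩ <;> intro h' <;> rw [h'] at this <;>
      simp [orient, cross] at this
    linarith
  rw [sub_eq_zero] at h
  by_cases h6 : k = 6
  · subst h6; exact (key 0 1 6 (by decide) (by decide)).2.2 h
  by_cases h5 : k = 5
  · subst h5; exact (key 0 5 6 (by decide) (by decide)).2.1 h.symm
  exact (key k (k + 1) 6 (by omega) (by omega)).1 h.symm

lemma Oriented.edge_point_mem_frontier {z : Fin 7 → ℂ} (hz : Oriented z) (k : Fin 7) {x : ℝ}
    (h0 : 0 ≤ x) (h1 : x ≤ 1) : toPlane (z k + x * (z (k + 1) - z k)) ∈ frontier (body z) := by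
  refine toPlane_mem_frontier (hz.edge_pos k) (edge_point_mem z k (k + 1) h0 h1) fun j => ?_
  have := hz.edge_nonneg k j
  rw [orient] at this
  rw [← sub_sub, cross_sub_right, cross_real_mul_right, cross_same]
  linarith

/-- The first vertex is at maximal distance from the opposite edge. -/
def FarVertex (z : Fin 7 → ℂ) : Prop := ∀ j, 0 ≤ cross (z 4 - z 3) (z 0 - z j)

/-- The point of the opposite edge with parameter `l`. -/
noncomputable def foot (z : Fin 7 → ℂ) (l : ℝ) : ℂ := z 3 + l * (z 4 - z 3)

/-- Half of the vector from a point of the opposite edge to the first vertex. -/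
noncomputable def halfDiam (z : Fin 7 → ℂ) (l : ℝ) : ℂ := ((1 / 2 : ℝ) : ℂ) * (z 0 - foot z l)

/-- The body lies in the strip between the line of the edge from `z 3` to `z 4` and its parallel
through `z 0`. The chord crosses the whole strip, so no parallel chord can be longer. -/
lemma Oriented.isAffineDiameter {z : Fin 7 → ℂ} (hz : Oriented z) (hf : FarVertex z) {l : ℝ}
    (h0 : 0 ≤ l) (h1 : l ≤ 1) :
    IsAffineDiameter (body z) (toPlane (foot z l)) (toPlane (z 0)) := by
  set e := z 4 - z 3 with he
  have he0 : e ≠ 0 := hz.edge_pos 3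
  have hfoot : ∀ u, cross e (u - foot z l) = cross e (u - z 3) := by
    intro u
    rw [foot, ← sub_sub, cross_sub_right, cross_real_mul_right, ← he, cross_same]; ring
  have hH : 0 < cross e (z 0 - foot z l) := by
    rw [hfoot]
    have := hz 0 3 4 (by decide) (by decide)
    have h' : orient (z 0) (z 3) (z 4) = cross e (z 0 - z 3) := by simp [orient, cross, e]; ring
    linarith
  have hlow : ∀ u ∈ convexHull ℝ (Set.range z), 0 ≤ cross e (u - foot z l) := fun u hu => by
    rw [hfoot]; exact hz.edge_nonneg_of_mem 3 hu
  have hup : ∀ u ∈ convexHull ℝ (Set.range z), 0 ≤ cross e (z 0 - u) := fun u hu => by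
    have := cross_nonneg_of_mem (z := z) (e := -e) (w := z 0) (u := u) (fun j => by
      have := hf j
      rw [cross_neg_left, ← neg_sub, cross_neg_right, neg_neg]; exact this) hu
    rw [cross_neg_left, ← neg_sub, cross_neg_right, neg_neg] at this; exact this
  have hsub := (isCompact_body z).isClosed.frontier_subset
  refine ⟨hz.edge_point_mem_frontier 3 h0 h1, ?_, ?_, ?_⟩
  · refine toPlane_mem_frontier (neg_ne_zero.2 he0) (subset_convexHull ℝ _ ⟨0, rfl⟩) fun j => ?_
    rw [cross_neg_left, ← neg_sub, cross_neg_right, neg_neg]; exact hf j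
  · intro h
    rw [toPlane.injective h, sub_self] at hH
    simp [cross] at hH
  · intro x' hx' y' hy' ⟨c, hc⟩
    obtain ⟨x, rfl⟩ := toPlane.surjective x'
    obtain ⟨y, rfl⟩ := toPlane.surjective y'
    have hx := toPlane_mem_body.1 (hsub hx')
    have hy := toPlane_mem_body.1 (hsub hy')
    have hc' : y - x = c * (z 0 - foot z l) := by
      apply toPlane.injective
      rw [map_sub, hc, ← map_sub, ← map_smul]; simp
    have hcr : cross e (y - x) = c * cross e (z 0 - foot z l) := by
      rw [hc', cross_real_mul_right]
    have e1 : cross e (y - x) = cross e (y - foot z l) - cross e (x - foot z l) := by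
      rw [← cross_sub_right]; congr 1; ring
    have e2 : ∀ u, cross e (z 0 - foot z l) = cross e (z 0 - u) + cross e (u - foot z l) := by
      intro u; rw [← cross_add_right]; congr 1; ring
    have hcabs : |c| ≤ 1 := by
      rw [abs_le]
      constructor
      · by_contra! hlt
        nlinarith [hlow y hy, hup x hx, e2 x]
      · by_contra! hlt
        nlinarith [hlow x hx, hup y hy, e2 y]
    rw [dist_comm, dist_eq_norm, hc, norm_smul, dist_comm, dist_eq_norm, Real.norm_eq_abs]
    nlinarith [norm_nonneg (toPlane (z 0) - toPlane (foot z l))]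

/-- The height, measured by `cross s`, of the chord `s` in the corner at `a` with
sides `e` and `g`. -/
noncomputable def cornerHeight (s a e g : ℂ) : ℝ := cross s a + cross s e * cross s g / cross e g

/-- The signed area of the half-length parallelogram with sides parallel to
`z 0 - foot z l`. -/
noncomputable def paraArea (z : Fin 7 → ℂ) (l : ℝ) : ℝ :=
  cornerHeight (halfDiam z l) (z 2) (z 1 - z 2) (z 3 - z 2)
    - cornerHeight (halfDiam z l) (z 5) (z 6 - z 5) (z 4 - z 5)

/-- The chord `s` fits into the corner with sides `e` and `g`. -/
def FitsCorner (s e g : ℂ) : Prop :=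
  (0 ≤ cross s g / cross e g ∧ cross s g / cross e g ≤ 1) ∧
    (0 ≤ cross s e / cross e g ∧ cross s e / cross e g ≤ 1)

/-- Cramer's rule: it locates the chord `s` between the two sides of a corner, from parameter `cross
s e / cross e g` on `g` to parameter `cross s g / cross e g` on `e`. -/
lemma corner_chord (s e g : ℂ) (h : cross e g ≠ 0) :
    ((cross s e / cross e g : ℝ) : ℂ) * g + s = ((cross s g / cross e g : ℝ) : ℂ) * e := by
  have key : (cross e g : ℂ) * s = cross s g * e - cross s e * g := by
    apply Complex.ext <;> simp [cross] <;> ring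
  have h' : (cross e g : ℂ) ≠ 0 := by exact_mod_cast h
  push_cast
  field_simp
  linear_combination key

lemma cross_corner_chord (s a e g : ℂ) :
    cross s (a + ((cross s e / cross e g : ℝ) : ℂ) * g) = cornerHeight s a e g := by
  rw [cross_add_right, cross_real_mul_right, cornerHeight]; ring

/-- One side is the chord `s` in the corner at `z 2`, the opposite side the chord `s` in the corner
at `z 5`. `FitsCorner` keeps the four ends on the edges, hence on the boundary. -/
lemma Oriented.isHalfLengthParallelogram {z : Fin 7 → ℂ} (hz : Oriented z) (hf : FarVertex z)
    {l : ℝ} (h0 : 0 ≤ l) (h1 : l ≤ 1)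
    (ht : FitsCorner (halfDiam z l) (z 1 - z 2) (z 3 - z 2))
    (hb : FitsCorner (halfDiam z l) (z 6 - z 5) (z 4 - z 5)) (hp : 0 < paraArea z l) :
    ∃ p s t, IsHalfLengthParallelogram (body z) p s t ∧ parallelogramArea s t = paraArea z l := by
  set s := halfDiam z l with hs
  set e := z 1 - z 2
  set g := z 3 - z 2
  set e' := z 6 - z 5
  set g' := z 4 - z 5
  have hD : cross e g ≠ 0 := by
    have := hz 1 2 3 (by decide) (by decide)
    have h' : orient (z 1) (z 2) (z 3) = - cross e g := by simp [orient, cross, e, g]; ring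
    linarith
  have hD' : cross e' g' ≠ 0 := by
    have := hz 4 5 6 (by decide) (by decide)
    have h' : orient (z 4) (z 5) (z 6) = cross e' g' := by simp [orient, cross, e', g']; ring
    linarith
  -- Corner parameters start at the corner, while edges are oriented from `z k` to `z (k + 1)`; half
  -- of the ends therefore need their parameter reversed.
  have rev : ∀ (a b : ℂ) (x : ℝ), a + x * (b - a) = b + ((1 - x : ℝ) : ℂ) * (a - b) := by
    intros; push_cast; ring
  have f1 : toPlane (z 2 + ((cross s e / cross e g : ℝ) : ℂ) * g) ∈ frontier (body z) :=
    hz.edge_point_mem_frontier 2 ht.2.1 ht.2.2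
  have f2 : toPlane (z 2 + ((cross s g / cross e g : ℝ) : ℂ) * e) ∈ frontier (body z) := by
    rw [rev]
    exact hz.edge_point_mem_frontier 1 (by linarith [ht.1.2]) (by linarith [ht.1.1])
  have f3 : toPlane (z 5 + ((cross s e' / cross e' g' : ℝ) : ℂ) * g') ∈ frontier (body z) := by
    rw [rev]
    exact hz.edge_point_mem_frontier 4 (by linarith [hb.2.2]) (by linarith [hb.2.1])
  have f4 : toPlane (z 5 + ((cross s g' / cross e' g' : ℝ) : ℂ) * e') ∈ frontier (body z) :=
    hz.edge_point_mem_frontier 5 hb.1.1 hb.1.2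
  rw [← corner_chord s e g hD, ← add_assoc] at f2
  rw [← corner_chord s e' g' hD', ← add_assoc] at f4
  set q := z 2 + ((cross s e / cross e g : ℝ) : ℂ) * g with hq
  set p := z 5 + ((cross s e' / cross e' g' : ℝ) : ℂ) * g' with hpdef
  have harea : cross s (q - p) = paraArea z l := by
    rw [cross_sub_right, hq, hpdef, cross_corner_chord, cross_corner_chord]; rfl
  refine ⟨toPlane p, toPlane s, toPlane (q - p), ⟨?_, f3, ?_, ?_, ?_, ?_⟩, ?_⟩
  · rw [linearIndependent_pair_iff_area2, area2_toPlane, harea]; exact hp.ne'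
  · rw [← map_add]; exact f4
  · rw [← map_add, ← map_add]
    convert f2 using 2; ring
  · rw [← map_add]
    convert f1 using 2; ring
  · refine ⟨_, _, hz.isAffineDiameter hf h0 h1, ?_⟩
    rw [← map_sub, ← map_smul, hs, halfDiam]; simp
  · rw [parallelogramArea_toPlane, harea, abs_of_pos hp]

/-! ### Numerical data of the corners of the regular heptagon -/

lemma Near.inv {x q ε p η : ℝ} (hx : Near x q ε) (hη : 0 ≤ η)
    (h : |1 - p * q| + |p| * ε ≤ η * (|q| - ε)) (hq : ε < |q|) : Near x⁻¹ p η := by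
  have hx' : |x - q| ≤ ε := abs_le.2 ⟨by linarith [hx.1], by linarith [hx.2]⟩
  have hxq : |q| - ε ≤ |x| := by
    have := abs_sub_abs_le_abs_sub q x
    rw [abs_sub_comm] at this; linarith
  have hpos : 0 < |x| := by linarith
  have hx0 : x ≠ 0 := abs_pos.1 hpos
  have e1 : |x⁻¹ - p| ≤ η := by
    have : x⁻¹ - p = (1 - p * x) / x := by field_simp
    rw [this, abs_div, div_le_iff₀ hpos]
    have h2 : |1 - p * x| ≤ |1 - p * q| + |p| * ε := by
      have : 1 - p * x = (1 - p * q) - p * (x - q) := by ring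
      rw [this]
      refine (abs_sub _ _).trans ?_
      rw [abs_mul]
      have := mul_le_mul_of_nonneg_left hx' (abs_nonneg p)
      linarith
    have := mul_le_mul_of_nonneg_left hxq hη
    linarith
  have := abs_le.1 e1
  exact ⟨by linarith [this.1], by linarith [this.2]⟩

/-- Half the length of the regular heptagon along a symmetry axis. -/
noncomputable def halfWidth : ℝ := (1 - C3) / 2
/-- The discriminant `cross e g` of the corner at the vertex `root 2`. -/
noncomputable def cornerDet : ℝ := (C1 - C2) * (S3 - S2) - (S1 - S2) * (C3 - C2)

lemma near_halfWidth : Near halfWidth 0.9504844 (2 / 10 ^ 6) := by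
  have h := near_C3
  unfold Near at *; unfold halfWidth; norm_num at *; constructor <;> linarith
lemma near_ex : Near (C1 - C2) 0.8460107 (2 / 10 ^ 6) := by
  have h := near_C1; have h' := near_C2
  unfold Near at *; norm_num at *; constructor <;> linarith
lemma near_ey : Near (S1 - S2) (-0.1930964) (2 / 10 ^ 6) := by
  have h := near_S1; have h' := near_S2
  unfold Near at *; norm_num at *; constructor <;> linarith
lemma near_gx : Near (C3 - C2) (-0.6784479) (4 / 10 ^ 6) := by
  have h := near_C3; have h' := near_C2
  unfold Near at *; norm_num at *; constructor <;> linarith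
lemma near_gy : Near (S3 - S2) (-0.5410442) (8 / 10 ^ 6) := by
  have h := near_S3; have h' := near_S2
  unfold Near at *; norm_num at *; constructor <;> linarith
lemma near_cornerDet : Near cornerDet (-0.588735) (2 / 10 ^ 5) := by
  have h1 : Near ((C1 - C2) * (S3 - S2)) (-0.457729) (1 / 10 ^ 5) :=
    near_ex.mul near_gy (by norm_num)
  have h2 : Near ((S1 - S2) * (C3 - C2)) 0.131006 (1 / 10 ^ 5) :=
    near_ey.mul near_gx (by norm_num)
  unfold Near at *; unfold cornerDet; norm_num at *; constructor <;> linarith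
lemma near_inv_cornerDet : Near cornerDet⁻¹ (-1.69856) (1 / 10 ^ 4) :=
  near_cornerDet.inv (by norm_num) (by norm_num) (by norm_num)
lemma near_X0 : Near (halfWidth * (S1 - S2)) (-0.183535) (1 / 10 ^ 5) :=
  near_halfWidth.mul near_ey (by norm_num)
lemma near_Y0 : Near (halfWidth * (S3 - S2)) (-0.514254) (2 / 10 ^ 5) :=
  near_halfWidth.mul near_gy (by norm_num)
lemma near_alpha : Near (halfWidth * (S3 - S2) * cornerDet⁻¹) 0.87349 (2 / 10 ^ 4) :=
  near_Y0.mul near_inv_cornerDet (by norm_num)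
lemma near_beta : Near (halfWidth * (S1 - S2) * cornerDet⁻¹) 0.311745 (1 / 10 ^ 4) :=
  near_X0.mul near_inv_cornerDet (by norm_num)
lemma near_alpha' : Near ((C3 - C2) * cornerDet⁻¹) 1.152382 (1 / 10 ^ 4) :=
  near_gx.mul near_inv_cornerDet (by norm_num)
lemma near_beta' : Near ((C1 - C2) * cornerDet⁻¹) (-1.436997) (1 / 10 ^ 4) :=
  near_ex.mul near_inv_cornerDet (by norm_num)
lemma cornerDet_neg : cornerDet < 0 := by
  have h := near_cornerDet; unfold Near at h; norm_num at h; linarith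

/-! ### The regular heptagon: a lower bound for the least area -/

lemma halfDiam_root (l : ℝ) : halfDiam root l = ⟨halfWidth, S3 * (l - 1 / 2)⟩ := by
  rw [halfDiam, foot, root_zero, root3, root4]
  apply Complex.ext
  · simp [halfWidth]; ring
  · simp; ring

lemma im_div_root (i j : Fin 7) : cross (root i) (root j) = (root (j - i)).im := by
  have h : root j = root i * root (j - i) := by rw [← root_add]; congr 1; omega
  rw [h]
  conv_lhs => rw [← mul_one (root i), mul_assoc, cross_mul_mul, normSq_root]
  simp [cross]

lemma orient_root_eq (i j k : Fin 7) : orient (root i) (root j) (root k) =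
    (root (j - i)).im + (root (k - j)).im - (root (k - i)).im := by
  have h : orient (root i) (root j) (root k) =
      cross (root i) (root j) + cross (root j) (root k) - cross (root i) (root k) := by
    simp [orient, cross]; ring
  rw [h, im_div_root, im_div_root, im_div_root]

lemma orient_root_pos {i j k : Fin 7} (hij : i < j) (hjk : j < k) :
    0 < orient (root i) (root j) (root k) := by
  have key : ∀ a b : Fin 7, 0 < a → 0 < b → a < a + b →
      0 < (root a).im + (root b).im - (root (a + b)).im := by
    have h1 := near_S1; have h2 := near_S2; have h3 := near_S3
    unfold Near at h1 h2 h3; norm_num at h1 h2 h3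
    intro a b ha hb hab
    fin_cases a <;> fin_cases b <;> simp [root1, root2, root3, root4, root5, root6] at ha hb hab ⊢ <;>
      linarith
  rw [orient_root_eq]
  have := key (j - i) (k - j) (by omega) (by omega) (by omega)
  rwa [show j - i + (k - j) = k - i by omega] at this

lemma oriented_root : Oriented root := fun _ _ _ => orient_root_pos

lemma farVertex_root : FarVertex root := by
  have h1 := near_C1; have h2 := near_C2; have h3 := near_C3; have h4 := near_S3
  unfold Near at h1 h2 h3 h4; norm_num at h1 h2 h3 h4
  intro j
  rw [root4, root3, root_zero]
  have e : cross (⟨C3, -S3⟩ - ⟨C3, S3⟩) (1 - root j) = 2 * S3 * (1 - (root j).re) := by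
    simp [cross]; ring
  rw [e]
  have : (root j).re ≤ 1 := (Complex.re_le_norm _).trans (norm_root j).le
  nlinarith

lemma cross_mk (a b c d : ℝ) : cross ⟨a, b⟩ ⟨c, d⟩ = a * d - b * c := rfl

lemma FitsCorner.conj {s e g : ℂ} (h : FitsCorner (starRingEnd ℂ s) e g) :
    FitsCorner s (starRingEnd ℂ e) (starRingEnd ℂ g) := by
  have key : ∀ u, cross s (starRingEnd ℂ u) / cross (starRingEnd ℂ e) (starRingEnd ℂ g)
      = cross (starRingEnd ℂ s) u / cross e g := by
    intro u
    rw [cross_conj e g, ← Complex.conj_conj s, cross_conj, Complex.conj_conj, neg_div_neg_eq]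
  unfold FitsCorner
  rw [key, key]; exact h

lemma cornerHeight_conj (s a e g : ℂ) :
    cornerHeight s (starRingEnd ℂ a) (starRingEnd ℂ e) (starRingEnd ℂ g) =
      - cornerHeight (starRingEnd ℂ s) a e g := by
  unfold cornerHeight
  have key : ∀ u, cross s (starRingEnd ℂ u) = - cross (starRingEnd ℂ s) u := by
    intro u
    rw [← cross_conj, Complex.conj_conj]
  rw [key, key, key, cross_conj e g, neg_mul_neg, div_neg]; ring

lemma exists_chord_of_fitsCorner {z : Fin 7 → ℂ} {a b c : Fin 7} {s : ℂ}
    (hne : cross (z a - z b) (z c - z b) ≠ 0) (h : FitsCorner s (z a - z b) (z c - z b)) :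
    ∃ q, q ∈ convexHull ℝ (Set.range z) ∧ q + s ∈ convexHull ℝ (Set.range z) ∧
      cross s q = cornerHeight s (z b) (z a - z b) (z c - z b) := by
  refine ⟨_, edge_point_mem z b c h.2.1 h.2.2, ?_, cross_corner_chord _ _ _ _⟩
  rw [add_assoc, corner_chord _ _ _ hne]
  exact edge_point_mem z b a h.1.1 h.1.2

lemma root5_conj : root 5 = starRingEnd ℂ (root 2) := by
  rw [← root_neg]; rfl
lemma root6_conj : root 6 = starRingEnd ℂ (root 1) := by
  rw [← root_neg]; rfl
lemma root4_conj : root 4 = starRingEnd ℂ (root 3) := by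
  rw [← root_neg]; rfl

lemma root12 : root 1 - root 2 = ⟨C1 - C2, S1 - S2⟩ := by rw [root1, root2]; rfl
lemma root32 : root 3 - root 2 = ⟨C3 - C2, S3 - S2⟩ := by rw [root3, root2]; rfl

lemma cross_corner_root : cross (root 1 - root 2) (root 3 - root 2) = cornerDet := by
  rw [root12, root32]; rfl

lemma cross_g_div (τ : ℝ) :
    cross ⟨halfWidth, τ⟩ (root 3 - root 2) / cross (root 1 - root 2) (root 3 - root 2) =
      halfWidth * (S3 - S2) * cornerDet⁻¹ - τ * ((C3 - C2) * cornerDet⁻¹) := by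
  rw [cross_corner_root, root32, cross_mk]; ring

lemma cross_e_div (τ : ℝ) :
    cross ⟨halfWidth, τ⟩ (root 1 - root 2) / cross (root 1 - root 2) (root 3 - root 2) =
      halfWidth * (S1 - S2) * cornerDet⁻¹ - τ * ((C1 - C2) * cornerDet⁻¹) := by
  rw [cross_corner_root, root12, cross_mk]; ring

/-- Of the four corner inequalities only the upper bound on the side towards `root 1` can fail in
this window, for τ below about -0.11; it is therefore kept as a hypothesis. -/
lemma fitsCorner_root {τ : ℝ} (h0 : -0.2 ≤ τ) (h1 : τ ≤ 0.22) (h2 : halfWidth * (S3 - S2) *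
    cornerDet⁻¹ - τ * ((C3 - C2) * cornerDet⁻¹) ≤ 1) :
    FitsCorner ⟨halfWidth, τ⟩ (root 1 - root 2) (root 3 - root 2) := by
  have a := near_alpha; have b := near_beta; have a' := near_alpha'; have b' := near_beta'
  unfold FitsCorner
  rw [cross_g_div, cross_e_div]
  unfold Near at *; norm_num at a b a' b' h0 h1
  refine ⟨⟨?_, h2⟩, ?_, ?_⟩ <;> nlinarith

lemma paraArea_root (l : ℝ) : paraArea root l =
    cornerHeight ⟨halfWidth, S3 * (l - 1 / 2)⟩ (root 2) (root 1 - root 2) (root 3 - root 2) +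
    cornerHeight ⟨halfWidth, -(S3 * (l - 1 / 2))⟩ (root 2) (root 1 - root 2) (root 3 - root 2) := by
  rw [paraArea, halfDiam_root, root5_conj, root6_conj, root4_conj, ← map_sub, ← map_sub,
    cornerHeight_conj]
  rw [sub_neg_eq_add]; rfl

lemma cornerHeight_root (τ : ℝ) :
    cornerHeight ⟨halfWidth, τ⟩ (root 2) (root 1 - root 2) (root 3 - root 2) =
      halfWidth * S2 - τ * C2 + (halfWidth * (S1 - S2) - τ * (C1 - C2)) *
        (halfWidth * (S3 - S2) * cornerDet⁻¹ - τ * ((C3 - C2) * cornerDet⁻¹)) := by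
  unfold cornerHeight
  rw [mul_div_assoc, cross_g_div, root12, root2, cross_mk, cross_mk]

lemma paraArea_root_half : paraArea root (1 / 2) = 2 * (halfWidth * S2 +
    halfWidth * (S1 - S2) * (halfWidth * (S3 - S2) * cornerDet⁻¹)) := by
  rw [paraArea_root, cornerHeight_root, cornerHeight_root]; ring

/-- The sum is even in τ, so the linear terms cancel, and the coefficient of τ² is positive: the
symmetric position has the least area among those using the same two corners. -/
lemma paraArea_root_half_le (τ : ℝ) : paraArea root (1 / 2) ≤
    cornerHeight ⟨halfWidth, τ⟩ (root 2) (root 1 - root 2) (root 3 - root 2) +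
    cornerHeight ⟨halfWidth, -τ⟩ (root 2) (root 1 - root 2) (root 3 - root 2) := by
  rw [paraArea_root_half, cornerHeight_root, cornerHeight_root]
  have a' := near_alpha'; have b := near_ex
  unfold Near at *; norm_num at a' b
  have : 0 ≤ τ ^ 2 * ((C1 - C2) * ((C3 - C2) * cornerDet⁻¹)) :=
    mul_nonneg (sq_nonneg _) (mul_nonneg (by linarith) (by linarith))
  nlinarith

lemma paraArea_root_half_pos : 0 < paraArea root (1 / 2) := by
  rw [paraArea_root_half]
  have h : Near (halfWidth * S2) 0.926654 (1 / 10 ^ 5) := near_halfWidth.mul near_S2 (by norm_num)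
  have h2 := near_X0.mul near_alpha (p := -0.160316) (η := 1 / 10 ^ 3) (by norm_num)
  unfold Near at *; norm_num at h h2; linarith

/-- `cross (root 5 - root 4) (root 0 - root 6)`. -/
noncomputable def farDet : ℝ := -((C3 - C2) * S1) - (S3 - S2) * (1 - C1)

lemma near_farDet : Near farDet 0.734141 (3 / 10 ^ 5) := by
  have h1 : Near ((C3 - C2) * S1) (-0.530432) (1 / 10 ^ 5) := near_gx.mul near_S1 (by norm_num)
  have h0 : Near (1 - C1) 0.3765102 (1 / 10 ^ 6) := by
    have h := near_C1; unfold Near at *; norm_num at *; constructor <;> linarith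
  have h2 : Near ((S3 - S2) * (1 - C1)) (-0.203709) (1 / 10 ^ 5) := near_gy.mul h0 (by norm_num)
  unfold Near at *; unfold farDet; norm_num at *; constructor <;> linarith

lemma near_inv_farDet : Near farDet⁻¹ 1.362137 (1 / 10 ^ 4) :=
  near_farDet.inv (by norm_num) (by norm_num) (by norm_num)

/-- Value at the symmetric position of the parameter on the edge from `root 4` to `root 5`. -/
noncomputable def gammaConst : ℝ :=
  ((C1 - C3 - halfWidth) * S1 + (S1 - S3) * (1 - C1)) * farDet⁻¹
/-- Slope of the parameter on the edge from `root 4` to `root 5`. -/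
noncomputable def gammaSlope : ℝ := (1 - C1) * farDet⁻¹

lemma near_gammaSlope : Near gammaSlope 0.512858 (1 / 10 ^ 4) := by
  have h0 : Near (1 - C1) 0.3765102 (1 / 10 ^ 6) := by
    have h := near_C1; unfold Near at *; norm_num at *; constructor <;> linarith
  exact h0.mul near_inv_farDet (by norm_num)

lemma near_gammaConst : Near gammaConst 0.789708 (2 / 10 ^ 4) := by
  have h0 : Near (1 - C1) 0.3765102 (1 / 10 ^ 6) := by
    have h := near_C1; unfold Near at *; norm_num at *; constructor <;> linarith
  have h1 : Near (C1 - C3 - halfWidth) 0.5739743 (5 / 10 ^ 6) := by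
    have h := near_C1; have h' := near_C3; have h'' := near_halfWidth
    unfold Near at *; norm_num at *; constructor <;> linarith
  have h2 : Near (S1 - S3) 0.3479478 (7 / 10 ^ 6) := by
    have h := near_S1; have h' := near_S3
    unfold Near at *; norm_num at *; constructor <;> linarith
  have h3 := h1.mul near_S1 (p := 0.448751) (η := 1 / 10 ^ 5) (by norm_num)
  have h4 := h2.mul h0 (p := 0.131006) (η := 1 / 10 ^ 5) (by norm_num)
  have h5 : Near ((C1 - C3 - halfWidth) * S1 + (S1 - S3) * (1 - C1)) 0.579757 (2 / 10 ^ 5) := by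
    unfold Near at *; norm_num at *; constructor <;> linarith
  exact h5.mul near_inv_farDet (by norm_num)

/-- In the regular heptagon two chords of half the length of the diameter from `root 0` to a
point of the opposite edge, at a distance at least that of the symmetric position. -/
lemma exists_root_chords_of_nonneg {τ : ℝ} (h0 : 0 ≤ τ) (h1 : 2 * τ ≤ S3) :
    ∃ q₁ q₂ : ℂ, q₁ ∈ convexHull ℝ (Set.range root) ∧
      q₁ + ⟨halfWidth, τ⟩ ∈ convexHull ℝ (Set.range root) ∧
      q₂ ∈ convexHull ℝ (Set.range root) ∧
      q₂ + ⟨halfWidth, τ⟩ ∈ convexHull ℝ (Set.range root) ∧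
      paraArea root (1 / 2) ≤ cross ⟨halfWidth, τ⟩ q₂ - cross ⟨halfWidth, τ⟩ q₁ := by
  have hne : cross (root 1 - root 2) (root 3 - root 2) ≠ 0 := by
    rw [cross_corner_root]; exact cornerDet_neg.ne
  have nS3 := near_S3; have a := near_alpha; have a' := near_alpha'
  have nX := near_X0; have nY := near_Y0; have nD := near_cornerDet
  have ngx := near_gx; have nex := near_ex; have ngy := near_gy
  have hτ : τ ≤ 0.217 := by unfold Near at nS3; norm_num at nS3 ⊢; linarith
  obtain ⟨q₂, hq₂, hq₂s, hh₂⟩ := exists_chord_of_fitsCorner hne (fitsCorner_root (τ := τ)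
    (by norm_num; linarith) (by norm_num at hτ ⊢; linarith) (by
      unfold Near at *; norm_num at a a'; nlinarith))
  -- Whether the lower chord also fits in its corner at `root 5`, the mirror image of the corner at
  -- `root 2` with slope -τ.
  by_cases hc : halfWidth * (S3 - S2) * cornerDet⁻¹ - (-τ) * ((C3 - C2) * cornerDet⁻¹) ≤ 1
  · have hτ' : τ ≤ 0.2 := by
      unfold Near at *; norm_num at a a' ⊢; nlinarith
    have hfit := (fitsCorner_root (τ := -τ) (by norm_num at hτ' ⊢; linarith)
      (by norm_num; linarith) hc)
    have hfit' : FitsCorner ⟨halfWidth, τ⟩ (root 6 - root 5) (root 4 - root 5) := by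
      rw [root6_conj, root5_conj, root4_conj, ← map_sub, ← map_sub]
      exact FitsCorner.conj hfit
    have hne' : cross (root 6 - root 5) (root 4 - root 5) ≠ 0 := by
      rw [root6_conj, root5_conj, root4_conj, ← map_sub, ← map_sub, cross_conj]
      exact neg_ne_zero.2 hne
    obtain ⟨q₁, hq₁, hq₁s, hh₁⟩ := exists_chord_of_fitsCorner hne' hfit'
    refine ⟨q₁, q₂, hq₁, hq₁s, hq₂, hq₂s, ?_⟩
    rw [hh₁, hh₂, root6_conj, root5_conj, root4_conj, ← map_sub, ← map_sub, cornerHeight_conj,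
      sub_neg_eq_add]
    exact paraArea_root_half_le τ
  -- The lower chord would now pass beyond `root 6`. It is replaced by a chord from the edge `root
  -- 4`, `root 5` (parameter γ) to the edge `root 6`, `root 0` (parameter δ); the failed inequality
  -- says precisely that δ is positive.
  · push Not at hc
    have nF := near_farDet
    have hF : 0 < farDet := by unfold Near at nF; norm_num at nF; linarith
    have hδ0 : 0 ≤ -(halfWidth * (S3 - S2)) - τ * (C3 - C2) + cornerDet := by
      have hD := cornerDet_neg
      have := mul_lt_mul_of_neg_left hc hD
      have e : cornerDet * (halfWidth * (S3 - S2) * cornerDet⁻¹ - -τ * ((C3 - C2) * cornerDet⁻¹))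
          = halfWidth * (S3 - S2) + τ * (C3 - C2) := by field_simp [hD.ne]; ring
      linarith
    set γ := gammaConst + gammaSlope * τ with hγ
    set δ := (-(halfWidth * (S3 - S2)) - τ * (C3 - C2) + cornerDet) * farDet⁻¹ with hδ
    have nG := near_gammaConst; have nG' := near_gammaSlope
    have hγ0 : 0 ≤ γ := by
      unfold Near at nG nG'; norm_num at nG nG'; rw [hγ]; nlinarith
    have hγ1 : γ ≤ 1 := by
      unfold Near at nG nG'; norm_num at nG nG' hτ; rw [hγ]; nlinarith
    have hδ1 : δ ≤ 1 := by
      rw [hδ, ← div_eq_mul_inv, div_le_one hF]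
      unfold Near at *; norm_num at nF nY nD ngx hτ; nlinarith
    have hδ0' : 0 ≤ δ := mul_nonneg hδ0 (inv_nonneg.2 hF.le)
    have hqs : root 4 + γ * (root 5 - root 4) + ⟨halfWidth, τ⟩ =
        root 6 + δ * (root 0 - root 6) := by
      rw [root4, root5, root6, root_zero]
      have hF' := hF.ne'
      apply Complex.ext
      · simp only [Complex.add_re, Complex.re_ofReal_mul, Complex.sub_re, Complex.one_re, hγ, hδ,
          gammaConst, gammaSlope]
        field_simp
        unfold farDet cornerDet
        ring
      · simp only [Complex.add_im, Complex.im_ofReal_mul, Complex.sub_im, Complex.one_im, hγ, hδ,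
          gammaConst, gammaSlope]
        field_simp
        unfold farDet cornerDet
        ring
    refine ⟨root 4 + γ * (root 5 - root 4), q₂, edge_point_mem root 4 5 hγ0 hγ1, ?_, hq₂, hq₂s, ?_⟩
    · rw [hqs]; exact edge_point_mem root 6 0 hδ0' hδ1
    · have e1 : cross ⟨halfWidth, τ⟩ (root 4 + γ * (root 5 - root 4)) =
          -(halfWidth * S3) - τ * C3 + γ * (halfWidth * (S3 - S2) + τ * (C3 - C2)) := by
        rw [cross_add_right, cross_real_mul_right, root4, root5]
        simp only [cross, Complex.sub_re, Complex.sub_im]; ring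
      rw [hh₂, e1, cornerHeight_root, paraArea_root_half, hγ]
      have p1 := near_X0.mul near_alpha (p := -0.160316) (η := 1 / 10 ^ 4) (by norm_num)
      have p2 := near_halfWidth.mul near_S2 (p := 0.926654) (η := 1 / 10 ^ 4) (by norm_num)
      have p3 := near_halfWidth.mul near_S3 (p := 0.4124) (η := 1 / 10 ^ 4) (by norm_num)
      have p4 := nG.mul near_Y0 (p := -0.406111) (η := 2 / 10 ^ 4) (by norm_num)
      have p5 := near_X0.mul near_alpha' (p := -0.211503) (η := 1 / 10 ^ 4) (by norm_num)
      have p6 := near_ex.mul near_alpha (p := 0.738982) (η := 2 / 10 ^ 4) (by norm_num)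
      have p7 := nG.mul near_gx (p := -0.535776) (η := 2 / 10 ^ 4) (by norm_num)
      have p8 := nG'.mul near_Y0 (p := -0.263739) (η := 1 / 10 ^ 4) (by norm_num)
      have p9 := near_ex.mul near_alpha' (p := 0.974928) (η := 1 / 10 ^ 4) (by norm_num)
      have p10 := nG'.mul near_gx (p := -0.347947) (η := 1 / 10 ^ 4) (by norm_num)
      have nC2 := near_C2; have nC3 := near_C3
      set w := halfWidth
      set X := w * (S1 - S2)
      set Y := w * (S3 - S2)
      set A := Y * cornerDet⁻¹
      set A' := (C3 - C2) * cornerDet⁻¹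
      -- The excess over the symmetric area is a quadratic polynomial in τ; `k0`, `k1`, `k2` bound
      -- its coefficients from below. The resulting polynomial has negative discriminant and its
      -- minimum near τ = 0.155.
      have k0 : 0.051 ≤ -(X * A) - w * S2 + w * S3 - gammaConst * Y := by
        unfold Near at p1 p2 p3 p4; norm_num at p1 p2 p3 p4 ⊢; linarith
      have k1 : -0.409 ≤ -C2 + C3 - X * A' - (C1 - C2) * A - gammaConst * (C3 - C2)
          - gammaSlope * Y := by
        unfold Near at p5 p6 p7 p8 nC2 nC3; norm_num at p5 p6 p7 p8 nC2 nC3 ⊢; linarith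
      have k2 : 1.32 ≤ (C1 - C2) * A' - gammaSlope * (C3 - C2) := by
        unfold Near at p9 p10; norm_num at p9 p10 ⊢; linarith
      have m1 := mul_le_mul_of_nonneg_right k1 h0
      have m2 := mul_le_mul_of_nonneg_right k2 (sq_nonneg τ)
      have : (0 : ℝ) ≤ 0.051 + -0.409 * τ + 1.32 * τ ^ 2 := by
        nlinarith [sq_nonneg (τ - 0.155)]
      linarith

lemma regularHeptagon_eq_body : regularHeptagon = body root := regularHeptagon_eq

lemma abs_cross_le (a b : ℂ) : |cross a b| ≤ ‖a‖ * ‖b‖ := by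
  have : cross a b = (starRingEnd ℂ a * b).im := by simp [cross]; ring
  rw [this]
  refine (Complex.abs_im_le_norm _).trans ?_
  rw [norm_mul, RCLike.norm_conj]

/-- A crude radius suffices: for ‖w‖ ≤ 1/4 the orientation of `w` with respect to each edge is at
least sin(2π/7) - 2/4 > 0. -/
lemma closedBall_subset_body_root : Metric.closedBall 0 (1 / 4) ⊆ body root := by
  intro x hx
  obtain ⟨w, rfl⟩ := toPlane.surjective x
  rw [mem_closedBall_zero_iff, toPlane.norm_map] at hx
  rw [toPlane_mem_body]
  obtain ⟨k, hk⟩ := oriented_root.mem_fan (w := w) fun k => by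
    have e : orient (root k) (root (k + 1)) w =
        cross (root k) (root (k + 1)) + cross (root (k + 1) - root k) w := by
      simp [orient, cross]; ring
    rw [e, im_div_root, add_sub_cancel_left, root1]
    have h1 := abs_cross_le (root (k + 1) - root k) w
    have h2 : ‖root (k + 1) - root k‖ ≤ 2 := by
      refine (norm_sub_le _ _).trans ?_
      rw [norm_root, norm_root]; norm_num
    have h3 := neg_abs_le (cross (root (k + 1) - root k) w)
    have h4 := near_S1
    unfold Near at h4; norm_num at h4
    have h5 := mul_le_mul h2 hx (norm_nonneg _) zero_le_two
    linarith
  exact mem_convexHull_of_closedTriangle hk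

lemma interior_nonempty_of_closedBall_subset {K : Set Plane} {r : ℝ} (hr : 0 < r)
    (h : Metric.closedBall 0 r ⊆ K) : (interior K).Nonempty :=
  ⟨0, mem_interior_iff_mem_nhds.2 (mem_of_superset (Metric.closedBall_mem_nhds 0 hr) h)⟩

lemma root_mul_mem {w : ℂ} (i : Fin 7) (hw : w ∈ convexHull ℝ (Set.range root)) :
    root i * w ∈ convexHull ℝ (Set.range root) := by
  have h := (LinearMap.mulLeft ℝ (root i)).image_convexHull (Set.range root)
  have h' : root i * w ∈ (LinearMap.mulLeft ℝ (root i)) '' convexHull ℝ (Set.range root) :=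
    ⟨w, hw, rfl⟩
  rw [h] at h'
  refine convexHull_mono ?_ h'
  rintro _ ⟨_, ⟨k, rfl⟩, rfl⟩
  exact ⟨i + k, root_add i k⟩

lemma conj_mem {w : ℂ} (hw : w ∈ convexHull ℝ (Set.range root)) :
    starRingEnd ℂ w ∈ convexHull ℝ (Set.range root) := by
  have h := (Complex.conjAe.toLinearMap).image_convexHull (Set.range root)
  have h' : starRingEnd ℂ w ∈ Complex.conjAe.toLinearMap '' convexHull ℝ (Set.range root) :=
    ⟨w, hw, rfl⟩
  rw [h] at h'
  refine convexHull_mono ?_ h'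
  rintro _ ⟨_, ⟨k, rfl⟩, rfl⟩
  exact ⟨-k, root_neg k⟩

/-- Reflection in the real axis changes the sign of τ and exchanges the upper and the lower chord.
-/
lemma exists_root_chords {τ : ℝ} (h1 : 2 * |τ| ≤ S3) :
    ∃ q₁ q₂ : ℂ, q₁ ∈ convexHull ℝ (Set.range root) ∧
      q₁ + ⟨halfWidth, τ⟩ ∈ convexHull ℝ (Set.range root) ∧
      q₂ ∈ convexHull ℝ (Set.range root) ∧
      q₂ + ⟨halfWidth, τ⟩ ∈ convexHull ℝ (Set.range root) ∧
      paraArea root (1 / 2) ≤ cross ⟨halfWidth, τ⟩ q₂ - cross ⟨halfWidth, τ⟩ q₁ := by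
  rcases le_total 0 τ with h | h
  · rw [abs_of_nonneg h] at h1
    exact exists_root_chords_of_nonneg h h1
  · rw [abs_of_nonpos h] at h1
    obtain ⟨q₁, q₂, a, b, c, d, e⟩ := exists_root_chords_of_nonneg (neg_nonneg.2 h) h1
    have hs : (⟨halfWidth, τ⟩ : ℂ) = starRingEnd ℂ ⟨halfWidth, -τ⟩ := by
      apply Complex.ext <;> simp
    refine ⟨_, _, conj_mem c, ?_, conj_mem a, ?_, ?_⟩
    · rw [hs, ← map_add]; exact conj_mem d
    · rw [hs, ← map_add]; exact conj_mem b
    · rw [hs, cross_conj, cross_conj]; linarith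

lemma neg_root_four_pow (j : ℕ) : ∃ i : Fin 7, (-root 4) ^ j = root i ∨ (-root 4) ^ j = -root i := by
  induction j with
  | zero => exact ⟨0, Or.inl (by simp [root_zero])⟩
  | succ j ih =>
    obtain ⟨i, h | h⟩ := ih
    · exact ⟨i + 4, Or.inr (by rw [pow_succ, h, root_add]; ring)⟩
    · exact ⟨i + 4, Or.inl (by rw [pow_succ, h, root_add]; ring)⟩

lemma exists_mul_of_cross_eq_zero {s u : ℂ} (hu : u ≠ 0) (h : cross s u = 0) :
    ∃ c : ℝ, s = c * u := by
  refine ⟨(s / u).re, ?_⟩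
  have him : (s / u).im = 0 := by
    rw [Complex.div_im, ← sub_div]
    have : s.im * u.re - s.re * u.im = - cross s u := by simp [cross]
    rw [this, h]; simp
  have : ((s / u).re : ℂ) = s / u := by
    apply Complex.ext <;> simp [him]
  rw [this]; field_simp

/-- Consecutive vectors `E j` and `E (j + 1)` are, up to a common sign, the two extreme diameters
from one vertex to the ends of its opposite edge. Since `E 7 = -E 0`, the sign of `cross s (E j)`
cannot stay the same, so `s` is parallel to a convex combination of two consecutive ones. -/
lemma exists_direction (s : ℂ) : ∃ (i : Fin 7) (l c : ℝ), 0 ≤ l ∧ l ≤ 1 ∧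
    s = c * (root i * (1 - foot root l)) := by
  set E : ℕ → ℂ := fun j => (-root 4) ^ j * (1 - root 3) with hE
  have hE7 : E 7 = - E 0 := by
    have : root 4 ^ 7 = 1 := by
      rw [root, pow_right_comm, root_one_pow, one_pow]
    simp [hE, Odd.neg_pow (by decide : Odd 7), this]
  have hex : ∃ j, cross s (E j) * cross s (E (j + 1)) ≤ 0 := by
    by_contra! hcon
    have hall : ∀ j, 0 < cross s (E 0) * cross s (E j) := by
      intro j
      induction j with
      | zero =>
        have := hcon 0
        rcases eq_or_ne (cross s (E 0)) 0 with h | h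
        · rw [h] at this; simp at this
        · exact mul_self_pos.2 h
      | succ j ih =>
        have := mul_pos ih (hcon j)
        have e : cross s (E 0) * cross s (E j) * (cross s (E j) * cross s (E (j + 1))) =
          cross s (E j) ^ 2 * (cross s (E 0) * cross s (E (j + 1))) := by ring
        rw [e] at this
        exact (pos_iff_pos_of_mul_pos this).1 (lt_of_le_of_ne (sq_nonneg _)
          (fun h => by rw [← h, zero_mul] at this; exact lt_irrefl _ this))
    have := hall 7
    rw [hE7, cross_neg_right] at this
    nlinarith [mul_self_nonneg (cross s (E 0))]
  obtain ⟨j, hj⟩ := hex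
  have hl : ∃ l : ℝ, 0 ≤ l ∧ l ≤ 1 ∧ (1 - l) * cross s (E j) + l * cross s (E (j + 1)) = 0 := by
    set a := cross s (E j)
    set b := cross s (E (j + 1))
    by_cases hab : a - b = 0
    · have : a = 0 := by
        have hb : b = a := by linarith
        rw [hb] at hj
        exact mul_self_eq_zero.1 (le_antisymm hj (mul_self_nonneg a))
      exact ⟨0, le_rfl, zero_le_one, by simp [this]⟩
    · refine ⟨a / (a - b), ?_, ?_, by field_simp; ring⟩
      · rw [div_nonneg_iff]
        rcases lt_or_gt_of_ne hab with h | h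
        · right; exact ⟨by nlinarith, h.le⟩
        · left; exact ⟨by nlinarith, h.le⟩
      · rw [div_le_one_iff]
        rcases lt_or_gt_of_ne hab with h | h
        · right; right; exact ⟨h, by nlinarith⟩
        · left; exact ⟨h, by nlinarith⟩
  obtain ⟨l, h0, h1, hl⟩ := hl
  have hcomb : ((1 - l : ℝ) : ℂ) * E j + (l : ℂ) * E (j + 1) =
      (-root 4) ^ j * (1 - foot root l) := by
    have h43 : root 4 * root 3 = 1 := by rw [← root_add]; exact root_zero
    simp only [hE, foot, pow_succ]
    push_cast
    linear_combination ((-root 4) ^ j * l) * h43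
  have hne : (1 : ℂ) - foot root l ≠ 0 := by
    intro h
    have h2 := halfDiam_root l
    rw [halfDiam, root_zero, h, mul_zero] at h2
    have h3 := congrArg Complex.re h2
    have h4 := near_halfWidth
    unfold Near at h4; norm_num at h4 h3
    linarith
  rw [← cross_real_mul_right, ← cross_real_mul_right, ← cross_add_right, hcomb] at hl
  obtain ⟨c, hc⟩ := exists_mul_of_cross_eq_zero
    (mul_ne_zero (pow_ne_zero _ (neg_ne_zero.2 (root_ne_zero 4))) hne) hl
  obtain ⟨i, h | h⟩ := neg_root_four_pow j
  · exact ⟨i, l, c, h0, h1, by rw [hc, h]⟩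
  · exact ⟨i, l, -c, h0, h1, by rw [hc, h]; push_cast; ring⟩

lemma Oriented.const_mul {z : Fin 7 → ℂ} (hz : Oriented z) {u : ℂ} (hu : u ≠ 0) :
    Oriented fun k => u * z k := by
  intro i j k hij hjk
  rw [orient, ← mul_sub, ← mul_sub, cross_mul_mul]
  exact mul_pos (Complex.normSq_pos.2 hu) (hz i j k hij hjk)

lemma FarVertex.const_mul {z : Fin 7 → ℂ} (hz : FarVertex z) (u : ℂ) :
    FarVertex fun k => u * z k := by
  intro j
  simp only
  rw [← mul_sub, ← mul_sub, cross_mul_mul]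
  exact mul_nonneg (Complex.normSq_nonneg _) (hz j)

lemma body_shift (z : Fin 7 → ℂ) (i : Fin 7) : body (fun k => z (i + k)) = body z := by
  unfold body
  congr 1
  ext x
  constructor
  · rintro ⟨k, rfl⟩; exact ⟨i + k, rfl⟩
  · rintro ⟨k, rfl⟩; exact ⟨k - i, by simp⟩

lemma isAffineDiameter_root (i : Fin 7) {l : ℝ} (h0 : 0 ≤ l) (h1 : l ≤ 1) :
    IsAffineDiameter (body root) (toPlane (root i * foot root l)) (toPlane (root i)) := by
  have h := (oriented_root.const_mul (root_ne_zero i)).isAffineDiameter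
    (farVertex_root.const_mul (root i)) h0 h1
  have hb : body (fun k => root i * root k) = body root := by
    rw [← body_shift root i]; congr 1; funext k; exact (root_add i k).symm
  rw [hb] at h
  convert h using 2
  · simp only [foot]; ring
  · rw [root_zero, mul_one]

lemma paraArea_root_le_of_isHalfLengthParallelogram {p s t : Plane}
    (h : IsHalfLengthParallelogram (body root) p s t) :
    paraArea root (1 / 2) ≤ parallelogramArea s t := by
  obtain ⟨hli, hp, hps, hpst, hpt, x, y, hxy, hs⟩ := h
  rw [linearIndependent_pair_iff_area2] at hli
  obtain ⟨i, l, c, h0, h1, hc⟩ := exists_direction (toPlane.symm (y - x))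
  have hy : y - x = c • (toPlane (root i) - toPlane (root i * foot root l)) := by
    rw [← map_sub, ← map_smul, ← toPlane.symm_apply_eq, hc, Complex.real_smul]; ring
  set S : ℂ := root i * ⟨halfWidth, S3 * (l - 1 / 2)⟩ with hS
  have h2S : toPlane (root i) - toPlane (root i * foot root l) = (2 : ℝ) • toPlane S := by
    rw [← map_sub, ← map_smul, hS, ← halfDiam_root, halfDiam, root_zero]
    congr 1; simp; ring
  -- The affine diameter vector of a given direction is unique up to sign, so `s` may be compared
  -- with half of the standard diameter from vertex `i`.
  have hcases : s = toPlane S ∨ s = - toPlane S := by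
    rcases (isAffineDiameter_root i h0 h1).eq_or_eq_neg hxy hy with h | h
    · left; rw [hs, h, h2S]; module
    · right; rw [hs, h, h2S]; module
  have hτ : 2 * |S3 * (l - 1 / 2)| ≤ S3 := by
    have nS := near_S3
    unfold Near at nS; norm_num at nS
    rw [abs_mul, abs_of_pos (by linarith : 0 < S3)]
    have : |l - 1 / 2| ≤ 1 / 2 := abs_le.2 ⟨by linarith, by linarith⟩
    nlinarith
  obtain ⟨q₁, q₂, a1, a2, b1, b2, hle⟩ := exists_root_chords hτ
  have hS0 : toPlane S ≠ 0 := by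
    intro h; rcases hcases with h' | h' <;> rw [h', h] at hli <;> simp [area2] at hli
  have hmul : ∀ q : ℂ, cross S (root i * q) = cross ⟨halfWidth, S3 * (l - 1 / 2)⟩ q := by
    intro q; rw [hS, cross_mul_mul, normSq_root, one_mul]
  have mem : ∀ w, w ∈ convexHull ℝ (Set.range root) → toPlane (root i * w) ∈ body root :=
    fun w hw => toPlane_mem_body.2 (root_mul_mem i hw)
  have mem' : ∀ w, w + ⟨halfWidth, S3 * (l - 1 / 2)⟩ ∈ convexHull ℝ (Set.range root) →
      toPlane (root i * w) + toPlane S ∈ body root := by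
    intro w hw
    rw [← map_add, hS, ← mul_add]; exact mem _ hw
  have hx : toPlane (root i * foot root l) ∈ body root := mem _ (edge_point_mem root 3 4 h0 h1)
  have hx2 : toPlane (root i * foot root l) + (2 : ℝ) • toPlane S ∈ body root := by
    rw [← h2S, add_sub_cancel]
    exact toPlane_mem_body.2 (subset_convexHull ℝ _ ⟨i, rfl⟩)
  have key : ∀ p t : Plane, p ∈ frontier (body root) → p + toPlane S ∈ frontier (body root) →
      p + toPlane S + t ∈ frontier (body root) → p + t ∈ frontier (body root) →
      area2 (toPlane S) t ≠ 0 → paraArea root (1 / 2) ≤ |area2 (toPlane S) t| := by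
    intro p t h1 h2 h3 h4 h5
    have := le_area_of_inscribed (convex_body root) (isCompact_body root).isClosed
      (interior_nonempty_of_closedBall_subset (by norm_num) closedBall_subset_body_root) hS0
      hx hx2 (mem q₁ a1) (mem' q₁ a2) (mem q₂ b1) (mem' q₂ b2) h1 h2 h3 h4 h5
    rw [area2_toPlane, area2_toPlane, hmul, hmul] at this
    linarith
  rw [parallelogramArea_eq]
  rcases hcases with rfl | rfl
  · exact key p t hp hps hpst hpt hli
  -- The same parallelogram, read from its vertex `p + s`, has side `S` instead of `-S`.
  · rw [area2_neg_left, abs_neg]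
    rw [area2_neg_left, neg_ne_zero] at hli
    refine key (p + -toPlane S) t hps ?_ ?_ hpst hli
    · simpa using hp
    · simpa using hpt

lemma exists_isHalfLengthParallelogram_root :
    ∃ p s t, IsHalfLengthParallelogram (body root) p s t := by
  have hfit : ∀ τ : ℝ, τ = 0 → FitsCorner ⟨halfWidth, τ⟩ (root 1 - root 2) (root 3 - root 2) := by
    rintro τ rfl
    refine fitsCorner_root (by norm_num) (by norm_num) ?_
    have := near_alpha; unfold Near at this; norm_num at this; linarith
  have hs := halfDiam_root (1 / 2)
  rw [sub_self, mul_zero] at hs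
  obtain ⟨p, s, t, h, -⟩ := oriented_root.isHalfLengthParallelogram farVertex_root (l := 1 / 2)
    (by norm_num) (by norm_num) (by rw [hs]; exact hfit 0 rfl) (by
      rw [hs, root6_conj, root5_conj, root4_conj, ← map_sub, ← map_sub]
      exact FitsCorner.conj (hfit _ (by simp))) paraArea_root_half_pos
  exact ⟨p, s, t, h⟩

lemma paraArea_root_le_leastHalfLengthArea :
    paraArea root (1 / 2) ≤ leastHalfLengthArea (body root) := by
  obtain ⟨p, s, t, h⟩ := exists_isHalfLengthParallelogram_root
  exact le_leastHalfLengthArea h fun p s t h => paraArea_root_le_of_isHalfLengthParallelogram h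

/-! ### Fourier modes and sums over the seven rotations -/

/-- Coefficients of the Fourier modes `2, 3, 4, 5` of a perturbation of the regular heptagon. -/
abbrev Modes : Type := Fin 4 → ℂ

/-- The complex linear form with coefficients `a`. -/
noncomputable def lin (a c : Modes) : ℂ := ∑ m, a m * c m

/-- The values at the vertex `k` of the Fourier modes. -/
noncomputable def modeAt (k : Fin 7) : Modes := fun m => root k ^ ((m : ℕ) + 2)

/-- The perturbed regular heptagon. -/
noncomputable def pert (c : Modes) (k : Fin 7) : ℂ := root k + lin (modeAt k) c

/-- The action of a rotation on the modes. -/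
noncomputable def rotM (i : Fin 7) (c : Modes) : Modes := fun m => root i ^ ((m : ℕ) + 1) * c m

/-- Complex conjugation of the modes. -/
noncomputable def conjM (c : Modes) : Modes := fun m => starRingEnd ℂ (c m)

lemma lin_add (a b c : Modes) : lin (a + b) c = lin a c + lin b c := by
  simp [lin, add_mul, Finset.sum_add_distrib]
lemma lin_sub (a b c : Modes) : lin (a - b) c = lin a c - lin b c := by
  simp [lin, sub_mul, Finset.sum_sub_distrib]
lemma lin_smul (r : ℝ) (a c : Modes) : lin (r • a) c = r * lin a c := by
  simp [lin, Finset.mul_sum, mul_assoc]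
lemma lin_const_mul (r : ℂ) (a c : Modes) : lin (fun m => r * a m) c = r * lin a c := by
  simp [lin, Finset.mul_sum, mul_assoc]

/-- Relabelling the vertices amounts to rotating the plane and acting on the modes by `rotM`. All
seven parallelograms are thereby reduced to the one at vertex 0. -/
lemma pert_add (c : Modes) (i k : Fin 7) : pert c (i + k) = root i * pert (rotM i c) k := by
  simp only [pert, lin, modeAt, rotM, root_add, mul_add, Finset.mul_sum, mul_pow]
  congr 1
  refine Finset.sum_congr rfl fun m _ => ?_
  ring

lemma pert_neg (c : Modes) (k : Fin 7) : pert (conjM c) (-k) = starRingEnd ℂ (pert c k) := by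
  simp [pert, lin, modeAt, conjM, root_neg, map_sum]

lemma norm_rotM (i : Fin 7) (c : Modes) : ‖rotM i c‖ = ‖c‖ := by
  simp only [Pi.norm_def]
  congr 2
  funext m
  simp [rotM, nnnorm_mul, nnnorm_pow, show ‖root i‖₊ = 1 from NNReal.eq (norm_root i)]

lemma norm_conjM (c : Modes) : ‖conjM c‖ = ‖c‖ := by
  simp only [Pi.norm_def]
  congr 2
  funext m
  simp [conjM]

lemma sum_root_pow {n : ℕ} (hn : ¬ 7 ∣ n) : ∑ i, root i ^ n = 0 := by
  have hprim : IsPrimitiveRoot (Complex.exp (2 * Real.pi * Complex.I / 7)) 7 := by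
    have := Complex.isPrimitiveRoot_exp 7 (by norm_num)
    simpa using this
  have hne : Complex.exp (2 * Real.pi * Complex.I / 7) ^ n ≠ 1 := fun h =>
    hn (hprim.dvd_of_pow_eq_one n h)
  have h := mul_neg_geom_sum (Complex.exp (2 * Real.pi * Complex.I / 7) ^ n) 7
  rw [pow_right_comm, root_one_pow, one_pow, sub_self] at h
  have h2 := (mul_eq_zero.1 h).resolve_left (sub_ne_zero.2 hne.symm)
  rw [← h2]
  unfold root
  rw [Fin.sum_univ_eq_sum_range (fun k => (Complex.exp (2 * Real.pi * Complex.I / 7) ^ k) ^ n) 7]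
  exact Finset.sum_congr rfl fun k _ => pow_right_comm _ _ _

lemma sum_root_pow_of_dvd {n : ℕ} (hn : 7 ∣ n) : ∑ i, root i ^ n = 7 := by
  obtain ⟨k, rfl⟩ := hn
  have : ∀ i : Fin 7, root i ^ (7 * k) = 1 := by
    intro i
    rw [root, pow_mul, pow_right_comm _ _ 7, root_one_pow, one_pow, one_pow]
  simp [this]

lemma conj_root_pow (i : Fin 7) (n : ℕ) : starRingEnd ℂ (root i) ^ n = root i ^ (6 * n) := by
  have h7 : root i ^ 7 = 1 := by
    rw [root, pow_right_comm, root_one_pow, one_pow]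
  have h2 : root i * starRingEnd ℂ (root i) = 1 := by rw [Complex.mul_conj, normSq_root]; simp
  have : starRingEnd ℂ (root i) = root i ^ 6 :=
    mul_left_cancel₀ (root_ne_zero i) (by rw [h2, ← h7]; ring)
  rw [this, ← pow_mul]

lemma lin_rotM (a c : Modes) (i : Fin 7) :
    lin a (rotM i c) = ∑ m, a m * c m * root i ^ ((m : ℕ) + 1) := by
  unfold lin rotM
  exact Finset.sum_congr rfl fun m _ => by ring

lemma sum_lin_rotM (a c : Modes) : ∑ i, lin a (rotM i c) = 0 := by
  simp only [lin_rotM]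
  rw [Finset.sum_comm]
  refine Finset.sum_eq_zero fun m _ => ?_
  rw [← Finset.mul_sum, sum_root_pow (by omega), mul_zero]

/-- The product of modes `m` and `n` picks up the character with exponent `m + n + 2`. For indices
up to 3 this is a multiple of 7 only for the pair 2, 3. -/
lemma sum_lin_mul_lin (a b c : Modes) : ∑ i, lin a (rotM i c) * lin b (rotM i c) =
    7 * ((a 2 * b 3 + a 3 * b 2) * (c 2 * c 3)) := by
  have h : ∀ i, lin a (rotM i c) * lin b (rotM i c) =
      ∑ m : Fin 4, ∑ n : Fin 4, a m * c m * (b n * c n) * root i ^ ((m : ℕ) + n + 2) := by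
    intro i
    rw [lin_rotM, lin_rotM, Finset.sum_mul_sum]
    refine Finset.sum_congr rfl fun m _ => Finset.sum_congr rfl fun n _ => ?_
    ring
  simp only [h]
  rw [Finset.sum_comm]
  have h2 : ∀ m : Fin 4, ∑ i, ∑ n : Fin 4, a m * c m * (b n * c n) * root i ^ ((m : ℕ) + n + 2) =
      ∑ n : Fin 4, a m * c m * (b n * c n) * ∑ i, root i ^ ((m : ℕ) + n + 2) := by
    intro m
    rw [Finset.sum_comm]
    exact Finset.sum_congr rfl fun n _ => by rw [Finset.mul_sum]
  simp only [h2]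
  have hz : ∀ m n : Fin 4, ∑ i, root i ^ ((m : ℕ) + n + 2) =
      if (m : ℕ) + n = 5 then 7 else 0 := by
    intro m n
    split_ifs with h
    · exact sum_root_pow_of_dvd (by omega)
    · exact sum_root_pow (by omega)
  simp only [hz]
  simp [Fin.sum_univ_four]
  ring

/-- With a conjugate the exponent becomes `m - n` modulo 7, so only the diagonal survives. -/
lemma sum_lin_mul_conj_lin (a b c : Modes) :
    ∑ i, lin a (rotM i c) * starRingEnd ℂ (lin b (rotM i c)) =
    7 * ∑ m, a m * starRingEnd ℂ (b m) * Complex.normSq (c m) := by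
  have h : ∀ i, lin a (rotM i c) * starRingEnd ℂ (lin b (rotM i c)) =
      ∑ m : Fin 4, ∑ n : Fin 4, a m * c m * (starRingEnd ℂ (b n) * starRingEnd ℂ (c n)) *
        root i ^ ((m : ℕ) + 1 + 6 * (n + 1)) := by
    intro i
    rw [lin_rotM, lin_rotM, map_sum, Finset.sum_mul_sum]
    refine Finset.sum_congr rfl fun m _ => Finset.sum_congr rfl fun n _ => ?_
    rw [map_mul, map_mul, map_pow, conj_root_pow, pow_add (root i)]
    ring
  simp only [h]
  rw [Finset.sum_comm, Finset.mul_sum]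
  refine Finset.sum_congr rfl fun m _ => ?_
  rw [Finset.sum_comm]
  have hz : ∀ n : Fin 4, ∑ i, root i ^ ((m : ℕ) + 1 + 6 * (n + 1)) =
      if n = m then 7 else 0 := by
    intro n
    split_ifs with h
    · exact sum_root_pow_of_dvd (by omega)
    · exact sum_root_pow (by omega)
  simp only [← Finset.mul_sum, hz]
  simp only [mul_ite, mul_zero, Finset.sum_ite_eq', Finset.mem_univ, if_true]
  rw [Complex.normSq_eq_conj_mul_self]
  ring

lemma sum_re_lin_rotM (a c : Modes) : ∑ i, (lin a (rotM i c)).re = 0 := by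
  rw [← Complex.re_sum, sum_lin_rotM, Complex.zero_re]

lemma re_mul_re (z w : ℂ) : z.re * w.re = ((z * w).re + (z * starRingEnd ℂ w).re) / 2 := by
  simp

lemma sum_re_lin_mul_re_lin (a b c : Modes) :
    ∑ i, (lin a (rotM i c)).re * (lin b (rotM i c)).re =
    7 / 2 * (∑ m, (a m * starRingEnd ℂ (b m)).re * Complex.normSq (c m) +
      ((a 2 * b 3 + a 3 * b 2) * (c 2 * c 3)).re) := by
  simp only [re_mul_re]
  rw [← Finset.sum_div, Finset.sum_add_distrib, ← Complex.re_sum, ← Complex.re_sum,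
    sum_lin_mul_lin, sum_lin_mul_conj_lin]
  have : ((7 : ℂ) * ∑ m, a m * starRingEnd ℂ (b m) * Complex.normSq (c m)).re =
      7 * ∑ m, (a m * starRingEnd ℂ (b m)).re * Complex.normSq (c m) := by
    rw [show (7 : ℂ) = ((7 : ℝ) : ℂ) by norm_num, Complex.re_ofReal_mul, Complex.re_sum]
    simp
  rw [this, show (7 : ℂ) = ((7 : ℝ) : ℂ) by norm_num, Complex.re_ofReal_mul]
  ring

lemma cross_eq_im (z w : ℂ) : cross z w = (w * starRingEnd ℂ z).im := by
  simp [cross]; ring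

lemma sum_cross_lin (a b c : Modes) : ∑ i, cross (lin a (rotM i c)) (lin b (rotM i c)) =
    7 * ∑ m, cross (a m) (b m) * Complex.normSq (c m) := by
  simp only [cross_eq_im]
  rw [← Complex.im_sum, sum_lin_mul_conj_lin, show (7 : ℂ) = ((7 : ℝ) : ℂ) by norm_num,
    Complex.im_ofReal_mul, Complex.im_sum]
  simp

lemma isBigO_lin (a : Modes) : lin a =O[𝓝 0] fun c : Modes => ‖c‖ := by
  refine IsBigO.of_bound (∑ m, ‖a m‖) (Eventually.of_forall fun c => ?_)
  rw [lin, norm_norm, Finset.sum_mul]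
  refine (norm_sum_le _ _).trans (Finset.sum_le_sum fun m _ => ?_)
  rw [norm_mul]
  exact mul_le_mul_of_nonneg_left (norm_le_pi_norm c m) (norm_nonneg _)

/-- The coefficients of the real linear form `c ↦ cross k (lin u c)`. -/
noncomputable def crossForm (k : ℂ) (u : Modes) : Modes :=
  fun m => -Complex.I * starRingEnd ℂ k * u m

lemma cross_lin (k : ℂ) (u c : Modes) : cross k (lin u c) = (lin (crossForm k u) c).re := by
  unfold crossForm
  rw [lin_const_mul]
  simp [cross]

lemma sum_cross_const_lin (k : ℂ) (u c : Modes) : ∑ i, cross k (lin u (rotM i c)) = 0 := by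
  simp only [cross_lin]
  exact sum_re_lin_rotM _ _

lemma root_pow (k : Fin 7) (n : ℕ) : root k ^ n = root (n • k) := by
  induction n with
  | zero => simp [root_zero]
  | succ n ih => rw [pow_succ, ih, ← root_add, succ_nsmul]

/-- The area is an exact quadratic polynomial. Its linear part vanishes by summation over the
vertices, and mode n contributes sin(2πn/7) times its squared modulus. -/
lemma shoelace_pert (c : Modes) : shoelace (pert c) = shoelace root +
    7 / 2 * (S2 * Complex.normSq (c 0) + S3 * Complex.normSq (c 1) - S3 * Complex.normSq (c 2)
      - S2 * Complex.normSq (c 3)) := by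
  have h : ∀ k, cross (pert c k) (pert c (k + 1)) = cross (root k) (root (k + 1)) +
      (cross 1 (lin (modeAt 1) (rotM k c)) - cross (root 1) (lin (modeAt 0) (rotM k c))) +
        cross (lin (modeAt 0) (rotM k c)) (lin (modeAt 1) (rotM k c)) := by
    intro k
    have h0 := pert_add c k 0
    rw [add_zero] at h0
    rw [h0, pert_add, cross_mul_mul, normSq_root, im_div_root, add_sub_cancel_left]
    simp only [pert, cross_add_left, cross_add_right, root_zero]
    rw [cross_swap (lin (modeAt 0) _) (root 1)]
    have : cross 1 (root 1) = (root 1).im := by simp [cross]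
    rw [this]; ring
  unfold shoelace
  simp only [h]
  rw [Finset.sum_add_distrib, Finset.sum_add_distrib, Finset.sum_sub_distrib,
    sum_cross_const_lin, sum_cross_const_lin, sum_cross_lin]
  have e : ∀ m : Fin 4, cross (modeAt 0 m) (modeAt 1 m) = (root (((m : ℕ) + 2) • (1 : Fin 7))).im := by
    intro m
    simp only [modeAt, root_pow]
    rw [im_div_root]
    congr 2
    simp
  simp only [e, Fin.sum_univ_four]
  rw [show (((0 : Fin 4) : ℕ) + 2) • (1 : Fin 7) = 2 from rfl,
    show (((1 : Fin 4) : ℕ) + 2) • (1 : Fin 7) = 3 from rfl,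
    show (((2 : Fin 4) : ℕ) + 2) • (1 : Fin 7) = 4 from rfl,
    show (((3 : Fin 4) : ℕ) + 2) • (1 : Fin 7) = 5 from rfl, root2, root3, root4, root5]
  ring

/-! ### Second order expansion of the parallelogram area -/

/-- The first order change of the optimal direction of the symmetric parallelogram. -/
noncomputable def tiltForm : Modes :=
  ![(3 / 2 : ℝ) * Complex.I, (3 : ℝ) * Complex.I, (5 : ℝ) * Complex.I, (-1 : ℝ) * Complex.I]

/-- The linear shift of the parameter of the direction. -/
noncomputable def tilt (c : Modes) : ℝ := (lin tiltForm c).re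

/-- `alpha` and `beta` are the corner parameters of the upper chord in the symmetric position of the
regular heptagon; they stay frozen under perturbation. -/
noncomputable def alpha : ℝ := halfWidth * (S3 - S2) * cornerDet⁻¹
noncomputable def beta : ℝ := halfWidth * (S1 - S2) * cornerDet⁻¹
noncomputable def e₀ : ℂ := root 1 - root 2
noncomputable def g₀ : ℂ := root 3 - root 2
noncomputable def h₀ : ℂ := root 4 - root 3
noncomputable def kappa : ℂ := root 2 + alpha * e₀ + beta * g₀
-- Each `Form` is the first variation in the modes of the corresponding quantity: the corner sides
-- e, g, the opposite edge h, half the untilted diameter s, the point kappa, and the corner equation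
-- s - αe + βg.
noncomputable def eForm : Modes := modeAt 1 - modeAt 2
noncomputable def gForm : Modes := modeAt 3 - modeAt 2
noncomputable def hForm : Modes := modeAt 4 - modeAt 3
noncomputable def sForm : Modes := (1 / 2 : ℝ) • (modeAt 0 - (1 / 2 : ℝ) • (modeAt 3 + modeAt 4))
noncomputable def kForm : Modes := modeAt 2 + alpha • eForm + beta • gForm
noncomputable def yForm : Modes := sForm - alpha • eForm + beta • gForm

/-- First order change of half the diameter. -/
noncomputable def diam₁ (c : Modes) : ℂ := lin sForm c - ((tilt c / 2 : ℝ) : ℂ) * h₀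
/-- Second order change of half the diameter. -/
noncomputable def diam₂ (c : Modes) : ℂ := -(((tilt c / 2 : ℝ) : ℂ) * lin hForm c)
/-- First order defect of the corner equation. -/
noncomputable def defect (c : Modes) : ℂ := lin yForm c - ((tilt c / 2 : ℝ) : ℂ) * h₀

/-- Height of the upper chord of the parallelogram. -/
noncomputable def topHeight (c : Modes) : ℝ :=
  cornerHeight (halfDiam (pert c) (1 / 2 + tilt c)) (pert c 2) (pert c 1 - pert c 2)
    (pert c 3 - pert c 2)

/-- First order part of `topHeight`. -/
noncomputable def topHeight₁ (c : Modes) : ℝ :=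
  cross halfWidth (lin kForm c) + cross (diam₁ c) kappa
    - alpha * beta * (cross e₀ (lin gForm c) + cross (lin eForm c) g₀)

/-- Second order part of `topHeight`. -/
noncomputable def topHeight₂ (c : Modes) : ℝ :=
  cross (diam₁ c) (lin kForm c) + cross (diam₂ c) kappa
    - alpha * beta * cross (lin eForm c) (lin gForm c)
    + cross (defect c) e₀ * cross (defect c) g₀ * cornerDet⁻¹

/-- Remainder of the second order expansion of `topHeight`. -/
noncomputable def topHeightRem (c : Modes) : ℝ :=
  cross (diam₂ c) (lin kForm c) +
    (cross (defect c + diam₂ c) (e₀ + lin eForm c) * cross (defect c + diam₂ c) (g₀ + lin gForm c) *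
      (cross (e₀ + lin eForm c) (g₀ + lin gForm c))⁻¹
      - cross (defect c) e₀ * cross (defect c) g₀ * cornerDet⁻¹)

lemma pert_sub (c : Modes) (i j : Fin 7) :
    pert c i - pert c j = (root i - root j) + lin (modeAt i - modeAt j) c := by
  rw [lin_sub]; simp only [pert]; ring

lemma halfDiam_pert (c : Modes) :
    halfDiam (pert c) (1 / 2 + tilt c) = halfWidth + diam₁ c + diam₂ c := by
  have h := halfDiam_root (1 / 2)
  have e : halfDiam (pert c) (1 / 2 + tilt c) = halfDiam root (1 / 2) + diam₁ c + diam₂ c := by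
    simp only [halfDiam, foot, pert, diam₁, diam₂, sForm, hForm, lin_smul, lin_sub, lin_add, h₀]
    push_cast; ring
  rw [e, h]
  congr 2
  apply Complex.ext <;> simp

/-- An exact identity with frozen parameters `x`, `y`. Its only fraction contains the vector s - xe
+ yg twice. By `corner_equation` this vector vanishes for the regular heptagon with x = α, y = β, so
the fraction is of second order and the perturbed denominator matters only at third order. -/
lemma cornerHeight_expand (s a e g : ℂ) (x y : ℝ) (h : cross e g ≠ 0) :
    cornerHeight s a e g = cross s (a + x * e + y * g) - x * y * cross e g +
      cross (s - x * e + y * g) e * cross (s - x * e + y * g) g * (cross e g)⁻¹ := by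
  have h1 : cross (s - x * e + y * g) e = cross s e - y * cross e g := by
    simp [cross]; ring
  have h2 : cross (s - x * e + y * g) g = cross s g - x * cross e g := by
    simp [cross]; ring
  rw [h1, h2, cornerHeight, cross_add_right, cross_add_right, cross_real_mul_right,
    cross_real_mul_right]
  field_simp
  ring

lemma corner_equation : (halfWidth : ℂ) - alpha * e₀ + beta * g₀ = 0 := by
  have hne : cross (root 1 - root 2) (root 3 - root 2) ≠ 0 := by
    rw [cross_corner_root]; exact cornerDet_neg.ne
  have h := corner_chord ⟨halfWidth, 0⟩ _ _ hne
  rw [cross_e_div, cross_g_div, zero_mul, sub_zero, zero_mul, sub_zero] at h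
  have hw : (⟨halfWidth, 0⟩ : ℂ) = (halfWidth : ℂ) := rfl
  rw [hw] at h
  unfold alpha beta e₀ g₀
  linear_combination h

lemma cornerHeight_root_zero : cornerHeight ⟨halfWidth, 0⟩ (root 2) (root 1 - root 2)
    (root 3 - root 2) = cross halfWidth kappa - alpha * beta * cornerDet := by
  have hne : cross (root 1 - root 2) (root 3 - root 2) ≠ 0 := by
    rw [cross_corner_root]; exact cornerDet_neg.ne
  have hw : (⟨halfWidth, 0⟩ : ℂ) = (halfWidth : ℂ) := rfl
  rw [hw, cornerHeight_expand _ _ _ _ alpha beta hne, cross_corner_root]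
  have := corner_equation
  unfold e₀ g₀ at this
  rw [this]
  simp [cross, kappa, e₀, g₀]

lemma topHeight_eq {c : Modes} (h : cross (e₀ + lin eForm c) (g₀ + lin gForm c) ≠ 0) :
    topHeight c = cross halfWidth kappa - alpha * beta * cornerDet + topHeight₁ c + topHeight₂ c
      + topHeightRem c := by
  have he : pert c 1 - pert c 2 = e₀ + lin eForm c := pert_sub c 1 2
  have hg : pert c 3 - pert c 2 = g₀ + lin gForm c := pert_sub c 3 2
  rw [topHeight, halfDiam_pert, he, hg, cornerHeight_expand _ _ _ _ alpha beta h]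
  have e1 : (halfWidth : ℂ) + diam₁ c + diam₂ c - alpha * (e₀ + lin eForm c)
      + beta * (g₀ + lin gForm c) = defect c + diam₂ c := by
    simp only [diam₁, defect, yForm, lin_add, lin_sub, lin_smul]
    linear_combination corner_equation
  have e2 : pert c 2 + alpha * (e₀ + lin eForm c) + beta * (g₀ + lin gForm c) =
      kappa + lin kForm c := by
    simp only [pert, kappa, kForm, lin_add, lin_smul]; ring
  have e3 : cornerDet = cross e₀ g₀ := cross_corner_root.symm
  rw [e1, e2, topHeight₁, topHeight₂, topHeightRem]
  generalize cross (defect c + diam₂ c) (e₀ + lin eForm c) * cross (defect c + diam₂ c)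
    (g₀ + lin gForm c) * (cross (e₀ + lin eForm c) (g₀ + lin gForm c))⁻¹ = A
  generalize cross (defect c) e₀ * cross (defect c) g₀ * cornerDet⁻¹ = B
  rw [e3]
  simp only [cross_add_left, cross_add_right]
  ring

lemma isBigO_cross {f g : Modes → ℂ} {u v : Modes → ℝ} (hf : f =O[𝓝 0] u) (hg : g =O[𝓝 0] v) :
    (fun c => cross (f c) (g c)) =O[𝓝 0] fun c => u c * v c := by
  refine IsBigO.trans (IsBigO.of_bound 1 (Eventually.of_forall fun c => ?_)) (hf.mul hg)
  rw [one_mul, Real.norm_eq_abs, norm_mul]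
  exact abs_cross_le _ _

lemma isBigO_norm_of_pow {n m : ℕ} (h : m ≤ n) :
    (fun c : Modes => ‖c‖ ^ n) =O[𝓝 0] fun c => ‖c‖ ^ m := by
  refine IsBigO.of_bound 1 ?_
  filter_upwards [Metric.ball_mem_nhds (0 : Modes) one_pos] with c hc
  rw [mem_ball_zero_iff] at hc
  rw [one_mul, norm_pow, norm_pow, norm_norm]
  exact pow_le_pow_of_le_one (norm_nonneg _) hc.le h

lemma isBigO_lin' (a : Modes) : lin a =O[𝓝 0] fun c : Modes => ‖c‖ ^ 1 := by
  simpa using isBigO_lin a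

lemma isBigO_tilt : (fun c => ((tilt c / 2 : ℝ) : ℂ)) =O[𝓝 0] fun c : Modes => ‖c‖ ^ 1 := by
  refine IsBigO.trans (IsBigO.of_bound 1 (Eventually.of_forall fun c => ?_)) (isBigO_lin' tiltForm)
  rw [one_mul, Complex.norm_real, Real.norm_eq_abs, tilt, abs_div, abs_two]
  have := Complex.abs_re_le_norm (lin tiltForm c)
  linarith [abs_nonneg (lin tiltForm c).re]

lemma isBigO_diam₂ : diam₂ =O[𝓝 0] fun c : Modes => ‖c‖ ^ 2 := by
  unfold diam₂
  refine ((isBigO_tilt.mul (isBigO_lin' hForm)).neg_left).congr_right fun c => ?_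
  ring

lemma isBigO_defect : defect =O[𝓝 0] fun c : Modes => ‖c‖ ^ 1 := by
  unfold defect
  refine (isBigO_lin' yForm).sub ?_
  simpa using isBigO_tilt.mul (isBigO_const_const h₀ (one_ne_zero (α := ℝ)) (𝓝 (0 : Modes)))

lemma continuous_lin (a : Modes) : Continuous (lin a) := by
  unfold lin; fun_prop

lemma lin_zero (a : Modes) : lin a 0 = 0 := by simp [lin]

lemma pert_zero : pert 0 = root := by
  funext k; simp [pert, lin_zero]

lemma isBigO_topHeightRem : topHeightRem =O[𝓝 0] fun c : Modes => ‖c‖ ^ 3 := by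
  have hconst : ∀ z : ℂ, (fun _ : Modes => z) =O[𝓝 0] fun c : Modes => ‖c‖ ^ 0 := fun z => by
    simpa using isBigO_const_const z (one_ne_zero (α := ℝ)) (𝓝 (0 : Modes))
  have hE : (fun c => e₀ + lin eForm c) =O[𝓝 0] fun c : Modes => ‖c‖ ^ 0 :=
    (hconst e₀).add ((isBigO_lin' eForm).trans (isBigO_norm_of_pow (by norm_num)))
  have hG : (fun c => g₀ + lin gForm c) =O[𝓝 0] fun c : Modes => ‖c‖ ^ 0 :=
    (hconst g₀).add ((isBigO_lin' gForm).trans (isBigO_norm_of_pow (by norm_num)))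
  have hy2 : (fun c => defect c + diam₂ c) =O[𝓝 0] fun c : Modes => ‖c‖ ^ 1 :=
    isBigO_defect.add (isBigO_diam₂.trans (isBigO_norm_of_pow (by norm_num)))
  have e3 : cornerDet = cross e₀ g₀ := cross_corner_root.symm
  set D : Modes → ℝ := fun c => cross (e₀ + lin eForm c) (g₀ + lin gForm c) with hD
  have hDc : Continuous D := by
    have h1 := continuous_lin eForm; have h2 := continuous_lin gForm
    fun_prop
  have hD0 : D 0 = cornerDet := by simp [hD, lin_zero, e3]
  have hDne : ∀ᶠ c in 𝓝 (0 : Modes), D c ≠ 0 :=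
    hDc.continuousAt.eventually_ne (by rw [hD0]; exact cornerDet_neg.ne)
  have hDinv : (fun c => (D c)⁻¹) =O[𝓝 0] fun c : Modes => ‖c‖ ^ 0 := by
    have : Tendsto (fun c => (D c)⁻¹) (𝓝 0) (𝓝 (D 0)⁻¹) :=
      (hDc.tendsto 0).inv₀ (by rw [hD0]; exact cornerDet_neg.ne)
    simpa using this.isBigO_one ℝ
  have hDdiff : (fun c => cornerDet - D c) =O[𝓝 0] fun c : Modes => ‖c‖ ^ 1 := by
    have h1 := isBigO_cross (hconst e₀) (isBigO_lin' gForm)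
    have h2 := isBigO_cross (isBigO_lin' eForm) hG
    refine ((h1.add (h2.congr_right (g₂ := fun c => ‖c‖ ^ 0 * ‖c‖ ^ 1) fun c => by ring)).neg_left).congr
      (fun c => ?_) (fun c => by ring)
    rw [e3]; simp only [hD, cross_add_left, cross_add_right]; ring
  have hDinvdiff : (fun c => (D c)⁻¹ - cornerDet⁻¹) =O[𝓝 0] fun c : Modes => ‖c‖ ^ 1 := by
    have h1 := (hDdiff.mul hDinv).mul (isBigO_const_const cornerDet⁻¹ (one_ne_zero (α := ℝ)) (𝓝 (0 : Modes)))
    refine (h1.congr_right (g₂ := fun c => ‖c‖ ^ 1) fun c => by ring).congr' ?_ EventuallyEq.rfl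
    filter_upwards [hDne] with c hc
    have := cornerDet_neg.ne
    field_simp
  have hp0 := isBigO_cross isBigO_defect (hconst e₀)
  have hq0 := isBigO_cross isBigO_defect (hconst g₀)
  have hq := isBigO_cross hy2 hG
  have hdp : (fun c => cross (defect c + diam₂ c) (e₀ + lin eForm c) - cross (defect c) e₀)
      =O[𝓝 0] fun c : Modes => ‖c‖ ^ 2 := by
    refine ((isBigO_cross isBigO_defect (isBigO_lin' eForm)).congr_right
      (g₂ := fun c => ‖c‖ ^ 2) (fun c => by ring)).add ((isBigO_cross isBigO_diam₂ hE).congr_right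
      (g₂ := fun c => ‖c‖ ^ 2) (fun c => by ring)) |>.congr_left fun c => ?_
    simp only [cross_add_left, cross_add_right]; ring
  have hdq : (fun c => cross (defect c + diam₂ c) (g₀ + lin gForm c) - cross (defect c) g₀)
      =O[𝓝 0] fun c : Modes => ‖c‖ ^ 2 := by
    refine ((isBigO_cross isBigO_defect (isBigO_lin' gForm)).congr_right
      (g₂ := fun c => ‖c‖ ^ 2) (fun c => by ring)).add ((isBigO_cross isBigO_diam₂ hG).congr_right
      (g₂ := fun c => ‖c‖ ^ 2) (fun c => by ring)) |>.congr_left fun c => ?_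
    simp only [cross_add_left, cross_add_right]; ring
  have t1 := (isBigO_cross isBigO_diam₂ (isBigO_lin' kForm)).congr_right
    (g₂ := fun c => ‖c‖ ^ 3) (fun c => by ring)
  -- The difference of two products pq/D is telescoped, replacing p, q and 1/D one at a time; each
  -- of the three terms is of third order.
  have t2 := ((hdp.mul hq).mul hDinv).congr_right (g₂ := fun c => ‖c‖ ^ 3) (fun c => by ring)
  have t3 := ((hp0.mul hdq).mul hDinv).congr_right (g₂ := fun c => ‖c‖ ^ 3) (fun c => by ring)
  have t4 := ((hp0.mul hq0).mul hDinvdiff).congr_right (g₂ := fun c => ‖c‖ ^ 3) (fun c => by ring)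
  refine (t1.add ((t2.add t3).add t4)).congr_left fun c => ?_
  unfold topHeightRem
  ring

/-- The coefficients of the tilt are purely imaginary for this reason: reflection must send the
parameter 1/2 + t to 1/2 - t. -/
lemma tilt_conjM (c : Modes) : tilt (conjM c) = - tilt c := by
  simp [tilt, lin, tiltForm, conjM, Fin.sum_univ_four]; ring

/-- The lower corner at vertex 5 is the mirror image of the upper corner at vertex 2 of the
reflected heptagon, so one expansion serves for both. -/
lemma paraArea_pert (c : Modes) :
    paraArea (pert c) (1 / 2 + tilt c) = topHeight c + topHeight (conjM c) := by
  have hc : ∀ k, pert (conjM c) k = starRingEnd ℂ (pert c (-k)) := fun k => by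
    rw [← pert_neg, neg_neg]
  have hs : halfDiam (pert (conjM c)) (1 / 2 + tilt (conjM c)) =
      starRingEnd ℂ (halfDiam (pert c) (1 / 2 + tilt c)) := by
    simp only [halfDiam, foot, hc, tilt_conjM]
    rw [show (-0 : Fin 7) = 0 from rfl, show (-3 : Fin 7) = 4 from rfl,
      show (-4 : Fin 7) = 3 from rfl]
    simp only [map_mul, map_sub, map_add, Complex.conj_ofReal]
    push_cast; ring
  have h2 : topHeight (conjM c) = - cornerHeight (halfDiam (pert c) (1 / 2 + tilt c))
      (pert c 5) (pert c 6 - pert c 5) (pert c 4 - pert c 5) := by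
    unfold topHeight
    rw [hs]
    simp only [hc, ← map_sub]
    rw [cornerHeight_conj, Complex.conj_conj]
    rfl
  rw [h2]; unfold topHeight paraArea; ring

/-! ### The weighted average of the seven excesses -/

/-- Coefficients of the linear weights of the seven parallelograms. -/
noncomputable def weightForm : Modes := ![((-56 : ℝ) : ℂ), ((-34 : ℝ) : ℂ), ((-5 : ℝ) : ℂ), ((30 : ℝ) : ℂ)]

/-- The linear weight. -/
noncomputable def weight (c : Modes) : ℝ := (lin weightForm c).re

/-- The coefficients of `topHeight₁`. -/
noncomputable def topForm : Modes := crossForm halfWidth kForm - crossForm kappa sForm +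
  (cross kappa h₀ / 2) • tiltForm - (alpha * beta) • (crossForm e₀ gForm - crossForm g₀ eForm)

/-- The coefficients of the form `cross (defect c) e₀`. -/
noncomputable def defectForm (k : ℂ) : Modes := (cross k h₀ / 2) • tiltForm - crossForm k yForm

lemma topHeight₁_eq (c : Modes) : topHeight₁ c = (lin topForm c).re := by
  unfold topHeight₁ topForm diam₁ tilt
  rw [lin_sub, lin_add, lin_sub, lin_smul, lin_smul, lin_sub, cross_sub_left, cross_real_mul_left,
    cross_lin, cross_lin, cross_swap (lin sForm c) kappa, cross_lin, cross_swap (lin eForm c) g₀,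
    cross_lin, cross_swap h₀ kappa]
  simp only [Complex.sub_re, Complex.add_re, Complex.re_ofReal_mul]
  ring

lemma cross_defect (c : Modes) (k : ℂ) : cross (defect c) k = (lin (defectForm k) c).re := by
  unfold defect defectForm tilt
  rw [cross_sub_left, cross_real_mul_left, lin_sub, lin_smul, cross_swap (lin yForm c) k, cross_lin,
    cross_swap h₀ k]
  simp only [Complex.sub_re, Complex.re_ofReal_mul]
  ring

lemma topHeight₂_eq (c : Modes) : topHeight₂ c =
    cross (lin sForm c) (lin kForm c) - alpha * beta * cross (lin eForm c) (lin gForm c)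
    - (lin tiltForm c).re * (lin (crossForm h₀ kForm) c).re / 2
    + (lin tiltForm c).re * (lin (crossForm kappa hForm) c).re / 2
    + (lin (defectForm e₀) c).re * (lin (defectForm g₀) c).re * cornerDet⁻¹ := by
  unfold topHeight₂
  rw [cross_defect, cross_defect, diam₁, diam₂, cross_sub_left, cross_neg_left,
    cross_real_mul_left, cross_real_mul_left, cross_swap (lin hForm c) kappa, cross_lin h₀,
    cross_lin kappa]
  unfold tilt
  ring

/-- The second order part of the weighted height. -/
noncomputable def weightedTop (c : Modes) : ℝ := topHeight₂ c + weight c * topHeight₁ c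

/-- Diagonal coefficients of the averaged second order part. -/
noncomputable def diagCoeff (m : Fin 4) : ℝ :=
  cross (sForm m) (kForm m) - alpha * beta * cross (eForm m) (gForm m)
    - (tiltForm m * starRingEnd ℂ (crossForm h₀ kForm m)).re / 4
    + (tiltForm m * starRingEnd ℂ (crossForm kappa hForm m)).re / 4
    + (defectForm e₀ m * starRingEnd ℂ (defectForm g₀ m)).re / 2 * cornerDet⁻¹
    + (weightForm m * starRingEnd ℂ (topForm m)).re / 2

/-- The off-diagonal coefficient of the averaged second order part. -/
noncomputable def offCoeff : ℂ :=
    - (tiltForm 2 * crossForm h₀ kForm 3 + tiltForm 3 * crossForm h₀ kForm 2) / 4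
    + (tiltForm 2 * crossForm kappa hForm 3 + tiltForm 3 * crossForm kappa hForm 2) / 4
    + (defectForm e₀ 2 * defectForm g₀ 3 + defectForm e₀ 3 * defectForm g₀ 2) / 2
      * (cornerDet⁻¹ : ℝ)
    + (weightForm 2 * topForm 3 + weightForm 3 * topForm 2) / 2

/-- By the orthogonality relations the averaged quadratic form is diagonal in the modes, except for
a coupling of the entries `c 2` and `c 3`. -/
lemma sum_weightedTop (c : Modes) : ∑ i, weightedTop (rotM i c) =
    7 * (∑ m, diagCoeff m * Complex.normSq (c m) + (offCoeff * (c 2 * c 3)).re) := by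
  unfold weightedTop weight
  simp only [topHeight₂_eq, topHeight₁_eq]
  simp only [Finset.sum_add_distrib, Finset.sum_sub_distrib, ← Finset.sum_div, ← Finset.sum_mul,
    ← Finset.mul_sum, sum_cross_lin, sum_re_lin_mul_re_lin]
  have hoff : (offCoeff * (c 2 * c 3)).re =
      - ((tiltForm 2 * crossForm h₀ kForm 3 + tiltForm 3 * crossForm h₀ kForm 2) *
        (c 2 * c 3)).re / 4
      + ((tiltForm 2 * crossForm kappa hForm 3 + tiltForm 3 * crossForm kappa hForm 2) *
        (c 2 * c 3)).re / 4
      + ((defectForm e₀ 2 * defectForm g₀ 3 + defectForm e₀ 3 * defectForm g₀ 2) *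
        (c 2 * c 3)).re / 2 * cornerDet⁻¹
      + ((weightForm 2 * topForm 3 + weightForm 3 * topForm 2) * (c 2 * c 3)).re / 2 := by
    unfold offCoeff
    generalize c 2 * c 3 = z
    generalize tiltForm 2 * crossForm h₀ kForm 3 + tiltForm 3 * crossForm h₀ kForm 2 = x1
    generalize tiltForm 2 * crossForm kappa hForm 3 + tiltForm 3 * crossForm kappa hForm 2 = x2
    generalize defectForm e₀ 2 * defectForm g₀ 3 + defectForm e₀ 3 * defectForm g₀ 2 = x3
    generalize weightForm 2 * topForm 3 + weightForm 3 * topForm 2 = x4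
    have e : (-x1 / 4 + x2 / 4 + x3 / 2 * ((cornerDet⁻¹ : ℝ) : ℂ) + x4 / 2) * z =
        (((-1 / 4 : ℝ) : ℂ) * (x1 * z) + ((1 / 4 : ℝ) : ℂ) * (x2 * z)
          + ((cornerDet⁻¹ / 2 : ℝ) : ℂ) * (x3 * z) + ((1 / 2 : ℝ) : ℂ) * (x4 * z)) := by
      push_cast; ring
    rw [e]
    simp only [Complex.add_re, Complex.re_ofReal_mul]
    ring
  rw [hoff]
  simp only [diagCoeff, add_mul, sub_mul, Finset.sum_add_distrib, Finset.sum_sub_distrib,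
    Fin.sum_univ_four]
  ring

lemma conjM_rotM (i : Fin 7) (c : Modes) : conjM (rotM i c) = rotM (-i) (conjM c) := by
  funext m
  simp [conjM, rotM, root_neg]

lemma sum_conjM_rotM (F : Modes → ℝ) (c : Modes) :
    ∑ i, F (conjM (rotM i c)) = ∑ i, F (rotM i (conjM c)) := by
  simp only [conjM_rotM]
  exact Equiv.sum_comp (Equiv.neg (Fin 7)) fun i => F (rotM i (conjM c))

lemma weight_conjM (c : Modes) : weight (conjM c) = weight c := by
  simp [weight, lin, weightForm, conjM, Fin.sum_univ_four]

/-- The excess of the `0`-th parallelogram of the perturbed heptagon. -/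
noncomputable def gap (c : Modes) : ℝ := paraArea root (1 / 2) * shoelace (pert c) -
  shoelace root * paraArea (pert c) (1 / 2 + tilt c)

/-- First order part of the excess. -/
noncomputable def gap₁ (c : Modes) : ℝ := -(shoelace root * (topHeight₁ c + topHeight₁ (conjM c)))

/-- The second order part of the weighted excess. -/
noncomputable def gap₂ (c : Modes) : ℝ := paraArea root (1 / 2) *
    (7 / 2 * (S2 * Complex.normSq (c 0) + S3 * Complex.normSq (c 1) - S3 * Complex.normSq (c 2)
      - S2 * Complex.normSq (c 3))) - shoelace root * (topHeight₂ c + topHeight₂ (conjM c))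

/-- The remainder of the second order expansion of the excess. -/
noncomputable def gapRem (c : Modes) : ℝ :=
  -(shoelace root * (topHeightRem c + topHeightRem (conjM c)))

lemma continuous_conjM : Continuous conjM := by
  unfold conjM; fun_prop

lemma conjM_zero : conjM 0 = 0 := by funext m; simp [conjM]

lemma tendsto_conjM : Tendsto conjM (𝓝 0) (𝓝 0) := by
  simpa [conjM_zero] using continuous_conjM.tendsto 0

lemma gap_eq : ∀ᶠ c in 𝓝 (0 : Modes), gap c = gap₁ c + gap₂ c + gapRem c := by
  have hDc : Continuous fun c => cross (e₀ + lin eForm c) (g₀ + lin gForm c) := by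
    have h1 := continuous_lin eForm; have h2 := continuous_lin gForm
    fun_prop
  have hne : ∀ᶠ c in 𝓝 (0 : Modes), cross (e₀ + lin eForm c) (g₀ + lin gForm c) ≠ 0 := by
    refine hDc.continuousAt.eventually_ne ?_
    rw [lin_zero, lin_zero, add_zero, add_zero]
    exact cross_corner_root.trans_ne cornerDet_neg.ne
  filter_upwards [hne, tendsto_conjM.eventually hne] with c h1 h2
  have hd : paraArea root (1 / 2) = 2 * (cross halfWidth kappa - alpha * beta * cornerDet) := by
    rw [paraArea_root, sub_self, mul_zero, neg_zero, cornerHeight_root_zero]; ring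
  rw [gap, paraArea_pert, topHeight_eq h1, topHeight_eq h2, shoelace_pert, gap₁, gap₂, gapRem, hd]
  ring

lemma isBigO_gapRem : gapRem =O[𝓝 0] fun c : Modes => ‖c‖ ^ 3 := by
  have h2 : (fun c => topHeightRem (conjM c)) =O[𝓝 0] fun c : Modes => ‖c‖ ^ 3 := by
    have := isBigO_topHeightRem.comp_tendsto tendsto_conjM
    simpa [Function.comp_def, norm_conjM] using this
  exact ((isBigO_topHeightRem.add h2).const_mul_left (-shoelace root)).congr_left fun c => by
    unfold gapRem; ring

lemma shoelace_root : shoelace root = 7 / 2 * S1 := by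
  unfold shoelace
  simp only [im_div_root, add_sub_cancel_left, root1]
  simp; ring

lemma sum_gap₁ (c : Modes) : ∑ i, gap₁ (rotM i c) = 0 := by
  have h : ∀ c, ∑ i, topHeight₁ (rotM i c) = 0 := fun c => by
    simp only [topHeight₁_eq, sum_re_lin_rotM]
  unfold gap₁
  rw [Finset.sum_neg_distrib, ← Finset.mul_sum, Finset.sum_add_distrib,
    sum_conjM_rotM topHeight₁, h, h]
  simp

lemma normSq_rotM (i : Fin 7) (c : Modes) (m : Fin 4) :
    Complex.normSq (rotM i c m) = Complex.normSq (c m) := by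
  simp [rotM, normSq_root]

/-- The contributions of `c` and of its reflection are added. The weight is invariant under
reflection, its coefficients being real. -/
lemma sum_gap₂ (c : Modes) : ∑ i, (gap₂ (rotM i c) + weight (rotM i c) * gap₁ (rotM i c)) =
    49 / 2 * (paraArea root (1 / 2) * (S2 * Complex.normSq (c 0) + S3 * Complex.normSq (c 1)
      - S3 * Complex.normSq (c 2) - S2 * Complex.normSq (c 3))
      - 2 * S1 * (∑ m, diagCoeff m * Complex.normSq (c m) + offCoeff.re * (c 2 * c 3).re)) := by
  have h : ∀ d : Modes, gap₂ d + weight d * gap₁ d = paraArea root (1 / 2) *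
    (7 / 2 * (S2 * Complex.normSq (d 0) + S3 * Complex.normSq (d 1) - S3 * Complex.normSq (d 2)
      - S2 * Complex.normSq (d 3))) - shoelace root * (weightedTop d + weightedTop (conjM d)) := by
    intro d
    unfold gap₁ gap₂ weightedTop
    rw [weight_conjM]; ring
  simp only [h, normSq_rotM]
  rw [Finset.sum_sub_distrib, Finset.sum_const, ← Finset.mul_sum, Finset.sum_add_distrib,
    sum_conjM_rotM weightedTop, sum_weightedTop, sum_weightedTop, shoelace_root]
  have e1 : ∀ m, Complex.normSq (conjM c m) = Complex.normSq (c m) := fun m =>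
    Complex.normSq_conj _
  -- Adding the reflected term cancels the imaginary part of `offCoeff`, so only its real part needs
  -- an estimate.
  have e2 : (offCoeff * (c 2 * c 3)).re + (offCoeff * (conjM c 2 * conjM c 3)).re =
      2 * (offCoeff.re * (c 2 * c 3).re) := by
    simp only [conjM, ← map_mul]
    simp [-Complex.mul_re, -map_mul, Complex.mul_re offCoeff]
    ring
  simp only [e1, Finset.card_univ, Fintype.card_fin, nsmul_eq_mul]
  push_cast
  linear_combination (-(49 / 2) * S1) * e2

/-! ### Numerical verification of positive definiteness -/

lemma Near.neg {x q ε : ℝ} (h : Near x q ε) : Near (-x) (-q) ε :=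
  ⟨by linarith [h.2], by linarith [h.1]⟩

lemma Near.add {x y q r ε δ p η : ℝ} (hx : Near x q ε) (hy : Near y r δ)
    (h : |q + r - p| + ε + δ ≤ η) : Near (x + y) p η := by
  have := abs_le.1 (le_refl |q + r - p|)
  exact ⟨by linarith [hx.1, hy.1, this.1], by linarith [hx.2, hy.2, this.2]⟩

lemma Near.sub {x y q r ε δ p η : ℝ} (hx : Near x q ε) (hy : Near y r δ)
    (h : |q - r - p| + ε + δ ≤ η) : Near (x - y) p η := by
  rw [sub_eq_add_neg]
  exact hx.add hy.neg (by rwa [← sub_eq_add_neg])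

lemma Near.one_sub_half {x q ε p η : ℝ} (hx : Near x q ε) (h : |(1 - q) / 2 - p| + ε / 2 ≤ η) :
    Near ((1 - x) / 2) p η := by
  have := abs_le.1 (le_refl |(1 - q) / 2 - p|)
  exact ⟨by linarith [hx.2, this.1], by linarith [hx.1, this.2]⟩

lemma near_const (x : ℝ) {ε : ℝ} (h : 0 ≤ ε) : Near x x ε := ⟨by linarith, by linarith⟩

lemma near_alpha_eq : Near alpha 0.87349 0.0002 := by
  have := near_alpha; unfold alpha; norm_num at this ⊢; exact this

lemma near_beta_eq : Near beta 0.311745 0.0001 := by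
  have := near_beta; unfold beta; norm_num at this ⊢; exact this

lemma near_alpha_mul_beta : Near (alpha * beta) 0.27231 0.0002 :=
  near_alpha_eq.mul near_beta_eq (by norm_num)

lemma e₀_eq : e₀ = ⟨C1 - C2, S1 - S2⟩ := root12
lemma g₀_eq : g₀ = ⟨C3 - C2, S3 - S2⟩ := root32
lemma h₀_eq : h₀ = ⟨0, -2 * S3⟩ := by
  rw [h₀, root3, root4]; apply Complex.ext <;> simp; ring

lemma kappa_im : kappa.im = S2 + alpha * (S1 - S2) + beta * (S3 - S2) := by
  simp [kappa, e₀_eq, g₀_eq, root2]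

lemma near_kappa_im : Near kappa.im 0.637594 0.0003 := by
  rw [kappa_im]
  have n1 := near_alpha_eq.mul near_ey (p := -0.168668) (η := 0.00006) (by norm_num)
  have n2 := near_beta_eq.mul near_gy (p := -0.168668) (η := 0.00006) (by norm_num)
  exact (near_S2.add n1 (p := 0.80626) (η := 0.0001) (by norm_num)).add n2 (by norm_num)

lemma modeAt_zero (m : Fin 4) : modeAt 0 m = 1 := by simp [modeAt, root_zero]

lemma modeAt_four (m : Fin 4) : modeAt 4 m = starRingEnd ℂ (modeAt 3 m) := by
  simp only [modeAt, root4_conj, map_pow]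

lemma modeAt_eq (k : Fin 7) (m : Fin 4) : modeAt k m = root (((m : ℕ) + 2) • k) := root_pow _ _

lemma tiltForm_0 : tiltForm 0 = ⟨0, -(-(3 / 2))⟩ := by
  apply Complex.ext <;> simp [tiltForm]
lemma tiltForm_1 : tiltForm 1 = ⟨0, -(-3)⟩ := by
  apply Complex.ext <;> simp [tiltForm]
lemma tiltForm_2 : tiltForm 2 = ⟨0, -(-5)⟩ := by
  apply Complex.ext <;> simp [tiltForm]
lemma tiltForm_3 : tiltForm 3 = ⟨0, -1⟩ := by
  apply Complex.ext <;> simp [tiltForm]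

section

variable {p1 q1 p2 q2 p3 q3 t : ℝ}

lemma sForm_eq (m : Fin 4) (h3 : root (((m : ℕ) + 2) • 3) = ⟨p3, q3⟩) :
    sForm m = ⟨(1 - p3) / 2, 0⟩ := by
  apply Complex.ext <;> simp [sForm, modeAt_zero, modeAt_four, modeAt_eq 3, h3]
  ring

lemma hForm_eq (m : Fin 4) (h3 : root (((m : ℕ) + 2) • 3) = ⟨p3, q3⟩) :
    hForm m = ⟨0, -2 * q3⟩ := by
  apply Complex.ext <;> simp [hForm, modeAt_four, modeAt_eq 3, h3]
  ring

/-- By reflection symmetry `sForm` is real while `hForm` and `tiltForm` are imaginary, so the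
quadratic coefficients depend only on the real or imaginary parts listed here. -/
lemma forms_at (m : Fin 4) (h1 : root (((m : ℕ) + 2) • 1) = ⟨p1, q1⟩)
    (h2 : root (((m : ℕ) + 2) • 2) = ⟨p2, q2⟩) (h3 : root (((m : ℕ) + 2) • 3) = ⟨p3, q3⟩)
    (ht : tiltForm m = ⟨0, -t⟩) :
    (sForm m).re = (1 - p3) / 2 ∧
    (kForm m).im = q2 + alpha * (q1 - q2) + beta * (q3 - q2) ∧
    cross (eForm m) (gForm m) = (p1 - p2) * (q3 - q2) - (q1 - q2) * (p3 - p2) ∧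
    (defectForm e₀ m).re = (S1 - S2) * ((1 - p3) / 2 - alpha * (p1 - p2) + beta * (p3 - p2)) -
      (C1 - C2) * (beta * (q3 - q2) - alpha * (q1 - q2)) ∧
    (defectForm e₀ m).im = (C1 - C2) * ((1 - p3) / 2 - alpha * (p1 - p2) + beta * (p3 - p2)
      + S3 * t) + (S1 - S2) * (beta * (q3 - q2) - alpha * (q1 - q2)) ∧
    (defectForm g₀ m).re = (S3 - S2) * ((1 - p3) / 2 - alpha * (p1 - p2) + beta * (p3 - p2)) -
      (C3 - C2) * (beta * (q3 - q2) - alpha * (q1 - q2)) ∧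
    (defectForm g₀ m).im = (C3 - C2) * ((1 - p3) / 2 - alpha * (p1 - p2) + beta * (p3 - p2)
      + S3 * t) + (S3 - S2) * (beta * (q3 - q2) - alpha * (q1 - q2)) ∧
    (topForm m).re = halfWidth * (q2 + alpha * (q1 - q2) + beta * (q3 - q2)) +
      kappa.im * ((1 - p3) / 2) - alpha * beta * ((C1 - C2) * (q3 - q2) - (S1 - S2) * (p3 - p2) -
        ((C3 - C2) * (q1 - q2) - (S3 - S2) * (p1 - p2))) := by
  have hs := sForm_eq m h3
  have he : eForm m = ⟨p1 - p2, q1 - q2⟩ := by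
    rw [eForm, Pi.sub_apply, modeAt_eq, modeAt_eq, h1, h2]; rfl
  have hg : gForm m = ⟨p3 - p2, q3 - q2⟩ := by
    rw [gForm, Pi.sub_apply, modeAt_eq, modeAt_eq, h3, h2]; rfl
  have hk : kForm m = ⟨p2 + alpha * (p1 - p2) + beta * (p3 - p2),
      q2 + alpha * (q1 - q2) + beta * (q3 - q2)⟩ := by
    apply Complex.ext <;> simp [kForm, modeAt_eq, h2, he, hg]
  have hy : yForm m = ⟨(1 - p3) / 2 - alpha * (p1 - p2) + beta * (p3 - p2),
      beta * (q3 - q2) - alpha * (q1 - q2)⟩ := by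
    apply Complex.ext <;> simp [yForm, hs, he, hg]
    ring
  refine ⟨by rw [hs], by rw [hk], by rw [he, hg]; rfl, ?_, ?_, ?_, ?_, ?_⟩
  · simp [defectForm, crossForm, hy, ht, e₀_eq]
  · simp [defectForm, crossForm, hy, ht, e₀_eq, h₀_eq, cross]; ring
  · simp [defectForm, crossForm, hy, ht, g₀_eq]
  · simp [defectForm, crossForm, hy, ht, g₀_eq, h₀_eq, cross]; ring
  · simp [topForm, crossForm, hs, hk, he, hg, ht, e₀_eq, g₀_eq]; ring

lemma diagCoeff_eq (m : Fin 4) (h3 : root (((m : ℕ) + 2) • 3) = ⟨p3, q3⟩)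
    (ht : tiltForm m = ⟨0, -t⟩) :
    diagCoeff m = (sForm m).re * (kForm m).im - alpha * beta * cross (eForm m) (gForm m)
      + S3 * (kForm m).im * (t / 2) - q3 * kappa.im * (t / 2)
      + ((defectForm e₀ m).re * (defectForm g₀ m).re +
        (defectForm e₀ m).im * (defectForm g₀ m).im) * cornerDet⁻¹ / 2
      + (weightForm m * starRingEnd ℂ (topForm m)).re / 2 := by
  have hs : (sForm m).im = 0 := by rw [sForm_eq m h3]
  simp only [diagCoeff, crossForm, hForm_eq m h3, ht, h₀_eq]
  simp [cross, hs]
  ring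

end

lemma offCoeff_re_eq : offCoeff.re = -(-5 * (S3 * (kForm 3).im) + 1 * (S3 * (kForm 2).im)) / 2
    + (-5 * (S1 * kappa.im) + 1 * (-S2 * kappa.im)) / 2
    + ((defectForm e₀ 2).re * (defectForm g₀ 3).re - (defectForm e₀ 2).im * (defectForm g₀ 3).im
      + (defectForm e₀ 3).re * (defectForm g₀ 2).re
      - (defectForm e₀ 3).im * (defectForm g₀ 2).im) * cornerDet⁻¹ / 2
    + (-5 * (topForm 3).re + 30 * (topForm 2).re) / 2 := by
  have e2 : hForm 2 = ⟨0, -2 * -S2⟩ := hForm_eq 2 root5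
  have e3 : hForm 3 = ⟨0, -2 * S1⟩ := hForm_eq 3 root1
  simp only [offCoeff, crossForm, e2, e3, tiltForm_2, tiltForm_3, h₀_eq,
    show weightForm 2 = ((-5 : ℝ) : ℂ) from rfl, show weightForm 3 = ((30 : ℝ) : ℂ) from rfl]
  simp [Complex.div_ofNat_re]
  ring

/-- Straight-line interval arithmetic: each line is one operation in the formulas of `forms_at`,
with a rounded value and an error bound. The next three lemmas do the same for the other modes. -/
lemma near_forms_0 : Near (sForm 0).re 0.188255 0.000002 ∧
    Near (kForm 0).im 0.68823 0.0005 ∧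
    Near (cross (eForm 0) (gForm 0)) (-2.38374) 0.00006 ∧
    Near (defectForm e₀ 0).re 1.11916 0.0007 ∧
    Near (defectForm e₀ 0).im (-0.23207) 0.0009 ∧
    Near (defectForm g₀ 0).re (-0.94683) 0.0008 ∧
    Near (defectForm g₀ 0).im 1.11796 0.0009 ∧
    Near (topForm 0).re 0.61386 0.0009 := by
  have n1 := near_S3.neg
  have n2 := near_S1.neg
  have n3 := near_C2.sub near_C3 (p := 0.67845) (η := 0.000006) (by norm_num)
  have n4 := near_S2.sub n1 (p := 1.40881) (η := 0.000009) (by norm_num)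
  have n5 := near_C1.sub near_C3 (p := 1.52446) (η := 0.000005) (by norm_num)
  have n6 := n2.sub n1 (p := -0.34795) (η := 0.00001) (by norm_num)
  have n7 := near_C1.one_sub_half (p := 0.188255) (η := 0.000002) (by norm_num)
  have n8 := near_alpha_eq.mul n4 (p := 1.23058) (η := 0.0003) (by norm_num)
  have n9 := n1.add n8 (p := 0.7967) (η := 0.0004) (by norm_num)
  have n10 := near_beta_eq.mul n6 (p := -0.10847) (η := 0.00005) (by norm_num)
  have n11 := n9.add n10 (p := 0.68823) (η := 0.0005) (by norm_num)
  have n12 := near_alpha_eq.mul n3 (p := 0.59262) (η := 0.0002) (by norm_num)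
  have n13 := n7.sub n12 (p := -0.40436) (η := 0.0003) (by norm_num)
  have n14 := near_beta_eq.mul n5 (p := 0.47524) (η := 0.0002) (by norm_num)
  have n15 := n13.add n14 (p := 0.07088) (η := 0.0006) (by norm_num)
  have n18 := n10.sub n8 (p := -1.33905) (η := 0.0004) (by norm_num)
  have n19 := near_S3.mul (near_const (-(3 / 2) : ℝ) (ε := 0.0000001) (by norm_num)) (p := -0.65083) (η := 0.00002) (by norm_num)
  have n20 := n15.add n19 (p := -0.57995) (η := 0.0007) (by norm_num)
  have n21 := near_ey.mul n15 (p := -0.01369) (η := 0.0002) (by norm_num)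
  have n22 := near_ex.mul n18 (p := -1.13285) (η := 0.0004) (by norm_num)
  have n23 := n21.sub n22 (p := 1.11916) (η := 0.0007) (by norm_num)
  have n24 := near_ex.mul n20 (p := -0.49064) (η := 0.0007) (by norm_num)
  have n25 := near_ey.mul n18 (p := 0.25857) (η := 0.00009) (by norm_num)
  have n26 := n24.add n25 (p := -0.23207) (η := 0.0009) (by norm_num)
  have n27 := near_gy.mul n15 (p := -0.03835) (η := 0.0004) (by norm_num)
  have n28 := near_gx.mul n18 (p := 0.90848) (η := 0.0003) (by norm_num)
  have n29 := n27.sub n28 (p := -0.94683) (η := 0.0008) (by norm_num)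
  have n30 := near_gx.mul n20 (p := 0.39347) (η := 0.0005) (by norm_num)
  have n31 := near_gy.mul n18 (p := 0.72449) (η := 0.0003) (by norm_num)
  have n32 := n30.add n31 (p := 1.11796) (η := 0.0009) (by norm_num)
  have n33 := n3.mul n6 (p := -0.23607) (η := 0.00002) (by norm_num)
  have n34 := n4.mul n5 (p := 2.14767) (η := 0.00003) (by norm_num)
  have n35 := n33.sub n34 (p := -2.38374) (η := 0.00006) (by norm_num)
  have n36 := near_halfWidth.mul n11 (p := 0.65415) (η := 0.0005) (by norm_num)
  have n37 := near_kappa_im.mul n7 (p := 0.12003) (η := 0.00006) (by norm_num)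
  have n38 := n36.add n37 (p := 0.77418) (η := 0.0006) (by norm_num)
  have n39 := near_ex.mul n6 (p := -0.29437) (η := 0.00002) (by norm_num)
  have n40 := near_ey.mul n5 (p := -0.29437) (η := 0.000007) (by norm_num)
  have n41 := n39.sub n40 (p := 0.0) (η := 0.00003) (by norm_num)
  have n42 := near_gx.mul n4 (p := -0.9558) (η := 0.00002) (by norm_num)
  have n43 := near_gy.mul n3 (p := -0.36707) (η := 0.00002) (by norm_num)
  have n44 := n42.sub n43 (p := -0.58873) (η := 0.00005) (by norm_num)
  have n45 := n41.sub n44 (p := 0.58873) (η := 0.00009) (by norm_num)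
  have n46 := near_alpha_mul_beta.mul n45 (p := 0.16032) (η := 0.0002) (by norm_num)
  have n47 := n38.sub n46 (p := 0.61386) (η := 0.0009) (by norm_num)
  obtain ⟨h1, h2, h3, h4, h5, h6, h7, h8⟩ := forms_at 0 root2 root4 root6 tiltForm_0
  rw [h1, h2, h3, h4, h5, h6, h7, h8]
  exact ⟨n7, n11, n35, n23, n26, n29, n32, n47⟩

lemma near_forms_1 : Near (sForm 1).re 0.61126 0.000002 ∧
    Near (kForm 1).im 0.82775 0.0007 ∧
    Near (cross (eForm 1) (gForm 1)) (-1.6496) 0.00006 ∧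
    Near (defectForm e₀ 1).re 0.11084 0.0009 ∧
    Near (defectForm e₀ 1).im 0.41864 0.001 ∧
    Near (defectForm g₀ 1).re (-1.25738) 0.002 ∧
    Near (defectForm g₀ 1).im 0.02215 0.002 ∧
    Near (topForm 1).re 0.36706 0.002 := by
  have n1 := near_S1.neg
  have n2 := near_C3.sub near_C1 (p := -1.52446) (η := 0.000005) (by norm_num)
  have n3 := near_S3.sub n1 (p := 1.21572) (η := 0.00002) (by norm_num)
  have n4 := near_C2.sub near_C1 (p := -0.84601) (η := 0.000003) (by norm_num)
  have n5 := near_S2.sub n1 (p := 1.75676) (η := 0.000003) (by norm_num)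
  have n6 := near_C2.one_sub_half (p := 0.61126) (η := 0.000002) (by norm_num)
  have n7 := near_alpha_eq.mul n3 (p := 1.06192) (η := 0.0003) (by norm_num)
  have n8 := n1.add n7 (p := 0.28009) (η := 0.0004) (by norm_num)
  have n9 := near_beta_eq.mul n5 (p := 0.54766) (η := 0.0002) (by norm_num)
  have n10 := n8.add n9 (p := 0.82775) (η := 0.0007) (by norm_num)
  have n11 := near_alpha_eq.mul n2 (p := -1.3316) (η := 0.0004) (by norm_num)
  have n12 := n6.sub n11 (p := 1.94286) (η := 0.0005) (by norm_num)
  have n13 := near_beta_eq.mul n4 (p := -0.26374) (η := 0.00009) (by norm_num)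
  have n14 := n12.add n13 (p := 1.67912) (η := 0.0007) (by norm_num)
  have n17 := n9.sub n7 (p := -0.51426) (η := 0.0006) (by norm_num)
  have n18 := near_S3.mul (near_const (-3 : ℝ) (ε := 0.0000001) (by norm_num)) (p := -1.30165) (η := 0.00002) (by norm_num)
  have n19 := n14.add n18 (p := 0.37747) (η := 0.0008) (by norm_num)
  have n20 := near_ey.mul n14 (p := -0.32423) (η := 0.0002) (by norm_num)
  have n21 := near_ex.mul n17 (p := -0.43507) (η := 0.0006) (by norm_num)
  have n22 := n20.sub n21 (p := 0.11084) (η := 0.0009) (by norm_num)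
  have n23 := near_ex.mul n19 (p := 0.31934) (η := 0.0007) (by norm_num)
  have n24 := near_ey.mul n17 (p := 0.0993) (η := 0.0002) (by norm_num)
  have n25 := n23.add n24 (p := 0.41864) (η := 0.001) (by norm_num)
  have n26 := near_gy.mul n14 (p := -0.90848) (η := 0.0005) (by norm_num)
  have n27 := near_gx.mul n17 (p := 0.3489) (η := 0.0005) (by norm_num)
  have n28 := n26.sub n27 (p := -1.25738) (η := 0.002) (by norm_num)
  have n29 := near_gx.mul n19 (p := -0.25609) (η := 0.0006) (by norm_num)
  have n30 := near_gy.mul n17 (p := 0.27824) (η := 0.0004) (by norm_num)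
  have n31 := n29.add n30 (p := 0.02215) (η := 0.002) (by norm_num)
  have n32 := n2.mul n5 (p := -2.67811) (η := 0.00002) (by norm_num)
  have n33 := n3.mul n4 (p := -1.02851) (η := 0.00003) (by norm_num)
  have n34 := n32.sub n33 (p := -1.6496) (η := 0.00006) (by norm_num)
  have n35 := near_halfWidth.mul n10 (p := 0.78676) (η := 0.0007) (by norm_num)
  have n36 := near_kappa_im.mul n6 (p := 0.38974) (η := 0.0002) (by norm_num)
  have n37 := n35.add n36 (p := 1.1765) (η := 0.001) (by norm_num)
  have n38 := near_ex.mul n5 (p := 1.48624) (η := 0.000009) (by norm_num)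
  have n39 := near_ey.mul n4 (p := 0.16336) (η := 0.000004) (by norm_num)
  have n40 := n38.sub n39 (p := 1.32288) (η := 0.00002) (by norm_num)
  have n41 := near_gx.mul n3 (p := -0.8248) (η := 0.00003) (by norm_num)
  have n42 := near_gy.mul n2 (p := 0.8248) (η := 0.00002) (by norm_num)
  have n43 := n41.sub n42 (p := -1.6496) (η := 0.00006) (by norm_num)
  have n44 := n40.sub n43 (p := 2.97248) (η := 0.00009) (by norm_num)
  have n45 := near_alpha_mul_beta.mul n44 (p := 0.80944) (η := 0.0007) (by norm_num)
  have n46 := n37.sub n45 (p := 0.36706) (η := 0.002) (by norm_num)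
  obtain ⟨h1, h2, h3, h4, h5, h6, h7, h8⟩ := forms_at 1 root3 root6 root2 tiltForm_1
  rw [h1, h2, h3, h4, h5, h6, h7, h8]
  exact ⟨n6, n10, n34, n22, n25, n28, n31, n46⟩

lemma near_forms_2 : Near (sForm 2).re 0.61126 0.000002 ∧
    Near (kForm 2).im (-0.82775) 0.0007 ∧
    Near (cross (eForm 2) (gForm 2)) 1.6496 0.00006 ∧
    Near (defectForm e₀ 2).re (-0.7593) 0.0009 ∧
    Near (defectForm e₀ 2).im (-0.5141) 0.001 ∧
    Near (defectForm g₀ 2).re (-0.55958) 0.002 ∧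
    Near (defectForm g₀ 2).im 0.0544 0.002 ∧
    Near (topForm 2).re 0.05218 0.002 := by
  have n1 := near_S3.neg
  have n2 := near_S2.neg
  have n3 := near_C3.sub near_C1 (p := -1.52446) (η := 0.000005) (by norm_num)
  have n4 := n1.sub near_S1 (p := -1.21572) (η := 0.00002) (by norm_num)
  have n5 := near_C2.sub near_C1 (p := -0.84601) (η := 0.000003) (by norm_num)
  have n6 := n2.sub near_S1 (p := -1.75676) (η := 0.000003) (by norm_num)
  have n7 := near_C2.one_sub_half (p := 0.61126) (η := 0.000002) (by norm_num)
  have n8 := near_alpha_eq.mul n4 (p := -1.06192) (η := 0.0003) (by norm_num)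
  have n9 := near_S1.add n8 (p := -0.28009) (η := 0.0004) (by norm_num)
  have n10 := near_beta_eq.mul n6 (p := -0.54766) (η := 0.0002) (by norm_num)
  have n11 := n9.add n10 (p := -0.82775) (η := 0.0007) (by norm_num)
  have n12 := near_alpha_eq.mul n3 (p := -1.3316) (η := 0.0004) (by norm_num)
  have n13 := n7.sub n12 (p := 1.94286) (η := 0.0005) (by norm_num)
  have n14 := near_beta_eq.mul n5 (p := -0.26374) (η := 0.00009) (by norm_num)
  have n15 := n13.add n14 (p := 1.67912) (η := 0.0007) (by norm_num)
  have n18 := n10.sub n8 (p := 0.51426) (η := 0.0006) (by norm_num)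
  have n19 := near_S3.mul (near_const (-5 : ℝ) (ε := 0.0000001) (by norm_num)) (p := -2.16942) (η := 0.00004) (by norm_num)
  have n20 := n15.add n19 (p := -0.4903) (η := 0.0008) (by norm_num)
  have n21 := near_ey.mul n15 (p := -0.32423) (η := 0.0002) (by norm_num)
  have n22 := near_ex.mul n18 (p := 0.43507) (η := 0.0006) (by norm_num)
  have n23 := n21.sub n22 (p := -0.7593) (η := 0.0009) (by norm_num)
  have n24 := near_ex.mul n20 (p := -0.4148) (η := 0.0007) (by norm_num)
  have n25 := near_ey.mul n18 (p := -0.0993) (η := 0.0002) (by norm_num)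
  have n26 := n24.add n25 (p := -0.5141) (η := 0.001) (by norm_num)
  have n27 := near_gy.mul n15 (p := -0.90848) (η := 0.0005) (by norm_num)
  have n28 := near_gx.mul n18 (p := -0.3489) (η := 0.0005) (by norm_num)
  have n29 := n27.sub n28 (p := -0.55958) (η := 0.002) (by norm_num)
  have n30 := near_gx.mul n20 (p := 0.33264) (η := 0.0006) (by norm_num)
  have n31 := near_gy.mul n18 (p := -0.27824) (η := 0.0004) (by norm_num)
  have n32 := n30.add n31 (p := 0.0544) (η := 0.002) (by norm_num)
  have n33 := n3.mul n6 (p := 2.67811) (η := 0.00002) (by norm_num)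
  have n34 := n4.mul n5 (p := 1.02851) (η := 0.00003) (by norm_num)
  have n35 := n33.sub n34 (p := 1.6496) (η := 0.00006) (by norm_num)
  have n36 := near_halfWidth.mul n11 (p := -0.78676) (η := 0.0007) (by norm_num)
  have n37 := near_kappa_im.mul n7 (p := 0.38974) (η := 0.0002) (by norm_num)
  have n38 := n36.add n37 (p := -0.39702) (η := 0.001) (by norm_num)
  have n39 := near_ex.mul n6 (p := -1.48624) (η := 0.000009) (by norm_num)
  have n40 := near_ey.mul n5 (p := 0.16336) (η := 0.000004) (by norm_num)
  have n41 := n39.sub n40 (p := -1.6496) (η := 0.00002) (by norm_num)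
  have n42 := near_gx.mul n4 (p := 0.8248) (η := 0.00003) (by norm_num)
  have n43 := near_gy.mul n3 (p := 0.8248) (η := 0.00002) (by norm_num)
  have n44 := n42.sub n43 (p := 0.0) (η := 0.00006) (by norm_num)
  have n45 := n41.sub n44 (p := -1.6496) (η := 0.00009) (by norm_num)
  have n46 := near_alpha_mul_beta.mul n45 (p := -0.4492) (η := 0.0004) (by norm_num)
  have n47 := n38.sub n46 (p := 0.05218) (η := 0.002) (by norm_num)
  obtain ⟨h1, h2, h3, h4, h5, h6, h7, h8⟩ := forms_at 2 root4 root1 root5 tiltForm_2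
  rw [h1, h2, h3, h4, h5, h6, h7, h8]
  exact ⟨n7, n11, n35, n23, n26, n29, n32, n47⟩

lemma near_forms_3 : Near (sForm 3).re 0.188255 0.000002 ∧
    Near (kForm 3).im (-0.68823) 0.0005 ∧
    Near (cross (eForm 3) (gForm 3)) 2.38374 0.00006 ∧
    Near (defectForm e₀ 3).re (-1.14654) 0.0007 ∧
    Near (defectForm e₀ 3).im 0.16846 0.0009 ∧
    Near (defectForm g₀ 3).re 0.87013 0.0008 ∧
    Near (defectForm g₀ 3).im (-1.06694) 0.0009 ∧
    Near (topForm 3).re (-0.33421) 0.0009 := by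
  have n1 := near_S2.neg
  have n2 := near_C2.sub near_C3 (p := 0.67845) (η := 0.000006) (by norm_num)
  have n3 := n1.sub near_S3 (p := -1.40881) (η := 0.000009) (by norm_num)
  have n4 := near_C1.sub near_C3 (p := 1.52446) (η := 0.000005) (by norm_num)
  have n5 := near_S1.sub near_S3 (p := 0.34795) (η := 0.00001) (by norm_num)
  have n6 := near_C1.one_sub_half (p := 0.188255) (η := 0.000002) (by norm_num)
  have n7 := near_alpha_eq.mul n3 (p := -1.23058) (η := 0.0003) (by norm_num)
  have n8 := near_S3.add n7 (p := -0.7967) (η := 0.0004) (by norm_num)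
  have n9 := near_beta_eq.mul n5 (p := 0.10847) (η := 0.00005) (by norm_num)
  have n10 := n8.add n9 (p := -0.68823) (η := 0.0005) (by norm_num)
  have n11 := near_alpha_eq.mul n2 (p := 0.59262) (η := 0.0002) (by norm_num)
  have n12 := n6.sub n11 (p := -0.40436) (η := 0.0003) (by norm_num)
  have n13 := near_beta_eq.mul n4 (p := 0.47524) (η := 0.0002) (by norm_num)
  have n14 := n12.add n13 (p := 0.07088) (η := 0.0006) (by norm_num)
  have n17 := n9.sub n7 (p := 1.33905) (η := 0.0004) (by norm_num)
  have n18 := near_S3.mul (near_const (1 : ℝ) (ε := 0.0000001) (by norm_num)) (p := 0.43388) (η := 0.00002) (by norm_num)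
  have n19 := n14.add n18 (p := 0.50476) (η := 0.0007) (by norm_num)
  have n20 := near_ey.mul n14 (p := -0.01369) (η := 0.0002) (by norm_num)
  have n21 := near_ex.mul n17 (p := 1.13285) (η := 0.0004) (by norm_num)
  have n22 := n20.sub n21 (p := -1.14654) (η := 0.0007) (by norm_num)
  have n23 := near_ex.mul n19 (p := 0.42703) (η := 0.0007) (by norm_num)
  have n24 := near_ey.mul n17 (p := -0.25857) (η := 0.00009) (by norm_num)
  have n25 := n23.add n24 (p := 0.16846) (η := 0.0009) (by norm_num)
  have n26 := near_gy.mul n14 (p := -0.03835) (η := 0.0004) (by norm_num)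
  have n27 := near_gx.mul n17 (p := -0.90848) (η := 0.0003) (by norm_num)
  have n28 := n26.sub n27 (p := 0.87013) (η := 0.0008) (by norm_num)
  have n29 := near_gx.mul n19 (p := -0.34245) (η := 0.0005) (by norm_num)
  have n30 := near_gy.mul n17 (p := -0.72449) (η := 0.0003) (by norm_num)
  have n31 := n29.add n30 (p := -1.06694) (η := 0.0009) (by norm_num)
  have n32 := n2.mul n5 (p := 0.23607) (η := 0.00002) (by norm_num)
  have n33 := n3.mul n4 (p := -2.14767) (η := 0.00003) (by norm_num)
  have n34 := n32.sub n33 (p := 2.38374) (η := 0.00006) (by norm_num)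
  have n35 := near_halfWidth.mul n10 (p := -0.65415) (η := 0.0005) (by norm_num)
  have n36 := near_kappa_im.mul n6 (p := 0.12003) (η := 0.00006) (by norm_num)
  have n37 := n35.add n36 (p := -0.53412) (η := 0.0006) (by norm_num)
  have n38 := near_ex.mul n5 (p := 0.29437) (η := 0.00002) (by norm_num)
  have n39 := near_ey.mul n4 (p := -0.29437) (η := 0.000007) (by norm_num)
  have n40 := n38.sub n39 (p := 0.58874) (η := 0.00003) (by norm_num)
  have n41 := near_gx.mul n3 (p := 0.9558) (η := 0.00002) (by norm_num)
  have n42 := near_gy.mul n2 (p := -0.36707) (η := 0.00002) (by norm_num)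
  have n43 := n41.sub n42 (p := 1.32287) (η := 0.00005) (by norm_num)
  have n44 := n40.sub n43 (p := -0.73413) (η := 0.00009) (by norm_num)
  have n45 := near_alpha_mul_beta.mul n44 (p := -0.19991) (η := 0.0002) (by norm_num)
  have n46 := n37.sub n45 (p := -0.33421) (η := 0.0009) (by norm_num)
  obtain ⟨h1, h2, h3, h4, h5, h6, h7, h8⟩ := forms_at 3 root5 root3 root1 tiltForm_3
  rw [h1, h2, h3, h4, h5, h6, h7, h8]
  exact ⟨n6, n10, n34, n22, n25, n28, n31, n46⟩

/-- The weight is decisive: its term, about -17, outweighs the other terms, which add up to about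
1.3 and would make the coefficient of this mode in the averaged excess negative. -/
lemma diagCoeff_0_le : diagCoeff 0 ≤ -1 := by
  obtain ⟨h1, h2, h3, h4, h5, h6, h7, h8⟩ := near_forms_0
  have n1 := h1.mul h2 (p := 0.12956) (η := 0.0002) (by norm_num)
  have n2 := near_alpha_mul_beta.mul h3 (p := -0.64912) (η := 0.0006) (by norm_num)
  have n3 := near_S3.mul h2 (p := 0.29861) (η := 0.0003) (by norm_num)
  have n4 := near_S1.neg.mul near_kappa_im (p := -0.49849) (η := 0.0003) (by norm_num)
  have n5 := h4.mul h6 (p := -1.05965) (η := 0.002) (by norm_num)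
  have n6 := h5.mul h7 (p := -0.25944) (η := 0.002) (by norm_num)
  have n7 := n5.add n6 (p := -1.31909) (η := 0.005) (by norm_num)
  have n8 := n7.mul near_inv_cornerDet (p := 2.24055) (η := 0.009) (by norm_num)
  rw [diagCoeff_eq 0 root6 tiltForm_0, show weightForm 0 = ((-56 : ℝ) : ℂ) from rfl]
  unfold Near at h8 n1 n2 n3 n4 n8
  norm_num at h8 n1 n2 n3 n4 n8 ⊢
  linarith

lemma diagCoeff_1_le : diagCoeff 1 ≤ -1 := by
  obtain ⟨h1, h2, h3, h4, h5, h6, h7, h8⟩ := near_forms_1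
  have n1 := h1.mul h2 (p := 0.50597) (η := 0.0005) (by norm_num)
  have n2 := near_alpha_mul_beta.mul h3 (p := -0.4492) (η := 0.0004) (by norm_num)
  have n3 := near_S3.mul h2 (p := 0.35915) (η := 0.0004) (by norm_num)
  have n4 := near_S2.mul near_kappa_im (p := 0.62161) (η := 0.0004) (by norm_num)
  have n5 := h4.mul h6 (p := -0.13937) (η := 0.002) (by norm_num)
  have n6 := h5.mul h7 (p := 0.00927) (η := 0.0009) (by norm_num)
  have n7 := n5.add n6 (p := -0.1301) (η := 0.003) (by norm_num)
  have n8 := n7.mul near_inv_cornerDet (p := 0.22098) (η := 0.006) (by norm_num)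
  rw [diagCoeff_eq 1 root2 tiltForm_1, show weightForm 1 = ((-34 : ℝ) : ℂ) from rfl]
  unfold Near at h8 n1 n2 n3 n4 n8
  norm_num at h8 n1 n2 n3 n4 n8 ⊢
  linarith

lemma diagCoeff_2_le : diagCoeff 2 ≤ -(19 / 10) := by
  obtain ⟨h1, h2, h3, h4, h5, h6, h7, h8⟩ := near_forms_2
  have n1 := h1.mul h2 (p := -0.50597) (η := 0.0005) (by norm_num)
  have n2 := near_alpha_mul_beta.mul h3 (p := 0.4492) (η := 0.0004) (by norm_num)
  have n3 := near_S3.mul h2 (p := -0.35915) (η := 0.0004) (by norm_num)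
  have n4 := near_S2.neg.mul near_kappa_im (p := -0.62161) (η := 0.0004) (by norm_num)
  have n5 := h4.mul h6 (p := 0.42489) (η := 0.003) (by norm_num)
  have n6 := h5.mul h7 (p := -0.02797) (η := 0.002) (by norm_num)
  have n7 := n5.add n6 (p := 0.39692) (η := 0.006) (by norm_num)
  have n8 := n7.mul near_inv_cornerDet (p := -0.67419) (η := 0.02) (by norm_num)
  rw [diagCoeff_eq 2 root5 tiltForm_2, show weightForm 2 = ((-5 : ℝ) : ℂ) from rfl]
  unfold Near at h8 n1 n2 n3 n4 n8
  norm_num at h8 n1 n2 n3 n4 n8 ⊢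
  linarith

lemma diagCoeff_3_le : diagCoeff 3 ≤ -5 := by
  obtain ⟨h1, h2, h3, h4, h5, h6, h7, h8⟩ := near_forms_3
  have n1 := h1.mul h2 (p := -0.12956) (η := 0.0002) (by norm_num)
  have n2 := near_alpha_mul_beta.mul h3 (p := 0.64912) (η := 0.0006) (by norm_num)
  have n3 := near_S3.mul h2 (p := -0.29861) (η := 0.0003) (by norm_num)
  have n4 := near_S1.mul near_kappa_im (p := 0.49849) (η := 0.0003) (by norm_num)
  have n5 := h4.mul h6 (p := -0.99764) (η := 0.002) (by norm_num)
  have n6 := h5.mul h7 (p := -0.17974) (η := 0.002) (by norm_num)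
  have n7 := n5.add n6 (p := -1.17738) (η := 0.005) (by norm_num)
  have n8 := n7.mul near_inv_cornerDet (p := 1.99985) (η := 0.009) (by norm_num)
  rw [diagCoeff_eq 3 root1 tiltForm_3, show weightForm 3 = ((30 : ℝ) : ℂ) from rfl]
  unfold Near at h8 n1 n2 n3 n4 n8
  norm_num at h8 n1 n2 n3 n4 n8 ⊢
  linarith

/-- The coupling is small enough to be absorbed by the diagonal: by the arithmetic-geometric mean
inequality it costs at most 1/4 in each of the two coefficients. -/
lemma abs_offCoeff_re_le : |offCoeff.re| ≤ 1 / 2 := by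
  obtain ⟨h1, h2, h3, h4, h5, h6, h7, h8⟩ := near_forms_2
  obtain ⟨k1, k2, k3, k4, k5, k6, k7, k8⟩ := near_forms_3
  have n1 := near_S3.mul h2 (p := -0.35915) (η := 0.0004) (by norm_num)
  have n2 := near_S3.mul k2 (p := -0.29861) (η := 0.0003) (by norm_num)
  have n3 := near_S2.neg.mul near_kappa_im (p := -0.62161) (η := 0.0004) (by norm_num)
  have n4 := near_S1.mul near_kappa_im (p := 0.49849) (η := 0.0003) (by norm_num)
  have n5 := h4.mul k6 (p := -0.66069) (η := 0.002) (by norm_num)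
  have n6 := h5.mul k7 (p := 0.54851) (η := 0.002) (by norm_num)
  have n7 := n5.sub n6 (p := -1.2092) (η := 0.005) (by norm_num)
  have n8 := k4.mul h6 (p := 0.64158) (η := 0.003) (by norm_num)
  have n9 := n7.add n8 (p := -0.56762) (η := 0.009) (by norm_num)
  have n10 := k5.mul h7 (p := 0.00916) (η := 0.0004) (by norm_num)
  have n11 := n9.sub n10 (p := -0.57678) (η := 0.01) (by norm_num)
  have n12 := n11.mul near_inv_cornerDet (p := 0.9797) (η := 0.02) (by norm_num)
  rw [offCoeff_re_eq, abs_le]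
  unfold Near at h8 k8 n1 n2 n3 n4 n12
  norm_num at h8 k8 n1 n2 n3 n4 n12 ⊢
  constructor <;> linarith

lemma near_paraArea_root_half : Near (paraArea root (1 / 2)) 1.5327 0.01 := by
  rw [paraArea_root_half]
  have h : Near (halfWidth * S2) 0.926654 (1 / 10 ^ 5) := near_halfWidth.mul near_S2 (by norm_num)
  have h2 := near_X0.mul near_alpha (p := -0.160316) (η := 1 / 10 ^ 3) (by norm_num)
  unfold Near at *
  norm_num at h h2 ⊢
  constructor <;> linarith

lemma norm_sq_le_sum_normSq (c : Modes) : ‖c‖ ^ 2 ≤ ∑ m, Complex.normSq (c m) := by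
  have h : ‖c‖ ≤ √(∑ m, Complex.normSq (c m)) := by
    refine (pi_norm_le_iff_of_nonneg (Real.sqrt_nonneg _)).2 fun m => Real.le_sqrt_of_sq_le ?_
    rw [← Complex.normSq_eq_norm_sq]
    exact Finset.single_le_sum (f := fun m => Complex.normSq (c m))
      (fun i _ => Complex.normSq_nonneg _) (Finset.mem_univ m)
  calc ‖c‖ ^ 2 ≤ √(∑ m, Complex.normSq (c m)) ^ 2 := by gcongr
    _ = _ := Real.sq_sqrt (Finset.sum_nonneg fun _ _ => Complex.normSq_nonneg _)

lemma abs_re_mul_le (z w : ℂ) : |(z * w).re| ≤ (Complex.normSq z + Complex.normSq w) / 2 := by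
  refine (Complex.abs_re_le_norm _).trans ?_
  rw [norm_mul, Complex.normSq_eq_norm_sq, Complex.normSq_eq_norm_sq]
  nlinarith [sq_nonneg (‖z‖ - ‖w‖)]

lemma norm_sq_le_sum_gap₂ (c : Modes) :
    ‖c‖ ^ 2 ≤ ∑ i, (gap₂ (rotM i c) + weight (rotM i c) * gap₁ (rotM i c)) := by
  refine (norm_sq_le_sum_normSq c).trans ?_
  rw [sum_gap₂]
  have hd := near_paraArea_root_half
  have h1 := near_S1; have h2 := near_S2; have h3 := near_S3
  have n0 := Complex.normSq_nonneg (c 0)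
  have n1 := Complex.normSq_nonneg (c 1)
  have n2 := Complex.normSq_nonneg (c 2)
  have n3 := Complex.normSq_nonneg (c 3)
  have hoff : offCoeff.re * (c 2 * c 3).re ≤
      (Complex.normSq (c 2) + Complex.normSq (c 3)) / 4 := by
    refine (le_abs_self _).trans ?_
    rw [abs_mul]
    have := mul_le_mul abs_offCoeff_re_le (abs_re_mul_le (c 2) (c 3)) (abs_nonneg _) (by norm_num)
    linarith
  set d := paraArea root (1 / 2)
  unfold Near at hd h1 h2 h3
  norm_num at hd h1 h2 h3
  have a1 : 0 ≤ d * S2 := mul_nonneg (by linarith) (by linarith)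
  have a2 : 0 ≤ d * S3 := mul_nonneg (by linarith) (by linarith)
  have b2 : d * S3 ≤ 0.7 := by nlinarith
  have b3 : d * S2 ≤ 1.6 := by nlinarith
  -- The coefficients 33/20 and 19/4 are 19/10 and 5, each reduced by the 1/4 spent on the coupling.
  have k : ∑ m, diagCoeff m * Complex.normSq (c m) + offCoeff.re * (c 2 * c 3).re ≤
      -Complex.normSq (c 0) - Complex.normSq (c 1) - (33 / 20) * Complex.normSq (c 2)
        - (19 / 4) * Complex.normSq (c 3) := by
    rw [Fin.sum_univ_four]
    have := mul_le_mul_of_nonneg_right diagCoeff_0_le n0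
    have := mul_le_mul_of_nonneg_right diagCoeff_1_le n1
    have := mul_le_mul_of_nonneg_right diagCoeff_2_le n2
    have := mul_le_mul_of_nonneg_right diagCoeff_3_le n3
    linarith
  have k2 := mul_le_mul_of_nonneg_left k (by linarith : 0 ≤ 2 * S1)
  have c0 := mul_nonneg a1 n0
  have c1 := mul_nonneg a2 n1
  have c2 := mul_le_mul_of_nonneg_right b2 n2
  have c3 := mul_le_mul_of_nonneg_right b3 n3
  have hS : (1.5 : ℝ) ≤ 2 * S1 := by linarith
  have s0 := mul_le_mul_of_nonneg_right hS n0
  have s1 := mul_le_mul_of_nonneg_right hS n1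
  have s2 := mul_le_mul_of_nonneg_right hS n2
  have s3 := mul_le_mul_of_nonneg_right hS n3
  rw [Fin.sum_univ_four]
  norm_num at *
  linarith

/-! ### Some parallelogram has positive excess -/

lemma isBigO_normSq (m : Fin 4) :
    (fun c : Modes => Complex.normSq (c m)) =O[𝓝 0] fun c : Modes => ‖c‖ ^ 2 := by
  refine IsBigO.of_bound 1 (Eventually.of_forall fun c => ?_)
  rw [Complex.normSq_eq_norm_sq, norm_pow, norm_pow, norm_norm, norm_norm, one_mul]
  gcongr
  exact norm_le_pi_norm c m

lemma isBigO_topHeight₂ : topHeight₂ =O[𝓝 0] fun c : Modes => ‖c‖ ^ 2 := by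
  have hconst : ∀ z : ℂ, (fun _ : Modes => z) =O[𝓝 0] fun c : Modes => ‖c‖ ^ 0 := fun z => by
    simpa using isBigO_const_const z (one_ne_zero (α := ℝ)) (𝓝 (0 : Modes))
  have hd : diam₁ =O[𝓝 0] fun c : Modes => ‖c‖ ^ 1 := by
    unfold diam₁
    refine (isBigO_lin' sForm).sub ?_
    simpa using isBigO_tilt.mul (isBigO_const_const h₀ (one_ne_zero (α := ℝ)) (𝓝 (0 : Modes)))
  have t1 := (isBigO_cross hd (isBigO_lin' kForm)).congr_right
    (g₂ := fun c => ‖c‖ ^ 2) (fun c => by ring)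
  have t2 := (isBigO_cross isBigO_diam₂ (hconst kappa)).congr_right
    (g₂ := fun c => ‖c‖ ^ 2) (fun c => by ring)
  have t3 := ((isBigO_cross (isBigO_lin' eForm) (isBigO_lin' gForm)).congr_right
    (g₂ := fun c => ‖c‖ ^ 2) (fun c => by ring)).const_mul_left (alpha * beta)
  have t4 := (((isBigO_cross isBigO_defect (hconst e₀)).mul
    (isBigO_cross isBigO_defect (hconst g₀))).congr_right
    (g₂ := fun c => ‖c‖ ^ 2) (fun c => by ring)).const_mul_left cornerDet⁻¹
  refine (((t1.add t2).sub t3).add t4).congr_left fun c => ?_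
  unfold topHeight₂; ring

lemma isBigO_gap₂ : gap₂ =O[𝓝 0] fun c : Modes => ‖c‖ ^ 2 := by
  have h2 : (fun c => topHeight₂ (conjM c)) =O[𝓝 0] fun c : Modes => ‖c‖ ^ 2 := by
    have := isBigO_topHeight₂.comp_tendsto tendsto_conjM
    simpa [Function.comp_def, norm_conjM] using this
  unfold gap₂
  exact ((((((isBigO_normSq 0).const_mul_left S2).add ((isBigO_normSq 1).const_mul_left S3)).sub
    ((isBigO_normSq 2).const_mul_left S3)).sub ((isBigO_normSq 3).const_mul_left S2)).const_mul_left
    _ |>.const_mul_left _).sub ((isBigO_topHeight₂.add h2).const_mul_left _)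

lemma isBigO_weight : weight =O[𝓝 0] fun c : Modes => ‖c‖ ^ 1 := by
  refine IsBigO.trans (IsBigO.of_bound 1 (Eventually.of_forall fun c => ?_)) (isBigO_lin' weightForm)
  rw [one_mul]; exact Complex.abs_re_le_norm _

lemma weight_zero : weight 0 = 0 := by simp [weight, lin_zero]

lemma continuous_weight : Continuous weight := Complex.continuous_re.comp (continuous_lin _)

/-- Every small nonzero perturbation has a parallelogram with positive excess. -/
lemma exists_gap_pos : ∀ᶠ c in 𝓝 (0 : Modes), c ≠ 0 → ∃ i, 0 < gap (rotM i c) := by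
  -- What remains of (1 + weight)·gap after removing `gap₁` and the quadratic part `gap₂ + weight *
  -- gap₁`.
  set R : Modes → ℝ := fun c => weight c * (gap₂ c + gapRem c) + gapRem c with hR
  have hRO : R =O[𝓝 0] fun c : Modes => ‖c‖ ^ 3 := by
    have h1 := isBigO_gap₂.add (isBigO_gapRem.trans (isBigO_norm_of_pow (by norm_num : 2 ≤ 3)))
    exact ((isBigO_weight.mul h1).congr_right (g₂ := fun c => ‖c‖ ^ 3) fun c => by ring).add
      isBigO_gapRem
  obtain ⟨K, hK⟩ := hRO.bound
  have hw : ∀ᶠ c in 𝓝 (0 : Modes), -1 < weight c :=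
    continuous_weight.continuousAt.eventually (lt_mem_nhds (by rw [weight_zero]; norm_num))
  have hn : ∀ᶠ c in 𝓝 (0 : Modes), 7 * K * ‖c‖ < 1 := by
    have : Continuous fun c : Modes => 7 * K * ‖c‖ := by fun_prop
    exact this.continuousAt.eventually (gt_mem_nhds (by simp))
  obtain ⟨r, hr, h⟩ := Metric.eventually_nhds_iff.1 (gap_eq.and (hK.and (hw.and hn)))
  refine Metric.eventually_nhds_iff.2 ⟨r, hr, fun c hc hne => ?_⟩
  by_contra! hcon
  -- Rotations preserve the norm of the modes, so one radius serves for all seven.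
  have hall : ∀ i, dist (rotM i c) 0 < r := fun i => by
    rwa [dist_zero_right, norm_rotM, ← dist_zero_right]
  -- If no excess were positive, the sum with positive weights would be nonpositive, although it is
  -- at least ‖c‖² - 7K‖c‖³.
  have hle : ∑ i, (1 + weight (rotM i c)) * gap (rotM i c) ≤ 0 :=
    Finset.sum_nonpos fun i _ => by
      have := (h (hall i)).2.2.1
      exact mul_nonpos_of_nonneg_of_nonpos (by linarith) (hcon i)
  have heq : ∑ i, (1 + weight (rotM i c)) * gap (rotM i c) = ∑ i, gap₁ (rotM i c) +
      ∑ i, (gap₂ (rotM i c) + weight (rotM i c) * gap₁ (rotM i c)) + ∑ i, R (rotM i c) := by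
    rw [← Finset.sum_add_distrib, ← Finset.sum_add_distrib]
    refine Finset.sum_congr rfl fun i _ => ?_
    rw [(h (hall i)).1]
    simp only [hR]; ring
  have hRle : -(7 * K * ‖c‖ ^ 3) ≤ ∑ i, R (rotM i c) := by
    have : ∀ i ∈ Finset.univ, -(K * ‖c‖ ^ 3) ≤ R (rotM i c) := fun i _ => by
      have := (h (hall i)).2.1
      rw [norm_rotM, norm_pow, norm_norm] at this
      exact (abs_le.1 this).1
    have := Finset.sum_le_sum this
    rw [Finset.sum_const, Finset.card_univ, Fintype.card_fin, nsmul_eq_mul] at this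
    push_cast at this
    linarith
  have hq := norm_sq_le_sum_gap₂ c
  have hc0 : 0 < ‖c‖ ^ 2 := by have := norm_pos_iff.2 hne; positivity
  have h7 := (h hc).2.2.2
  rw [heq, sum_gap₁] at hle
  nlinarith

/-! ### Affine invariance and Fourier normalization -/

/-- The real linear map of the complex plane with coefficients `u, w`. -/
noncomputable def realLin (u w z : ℂ) : ℂ := u * z + w * starRingEnd ℂ z

/-- The determinant of `realLin`. -/
noncomputable def realLinDet (u w : ℂ) : ℝ := Complex.normSq u - Complex.normSq w

lemma realLin_add (u w a b : ℂ) : realLin u w (a + b) = realLin u w a + realLin u w b := by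
  simp [realLin]; ring
lemma realLin_sub (u w a b : ℂ) : realLin u w (a - b) = realLin u w a - realLin u w b := by
  simp [realLin]; ring
lemma realLin_real_mul (u w : ℂ) (r : ℝ) (a : ℂ) : realLin u w (r * a) = r * realLin u w a := by
  simp [realLin]; ring
lemma cross_realLin (u w a b : ℂ) :
    cross (realLin u w a) (realLin u w b) = realLinDet u w * cross a b := by
  simp [realLin, realLinDet, cross, Complex.normSq_apply]; ring

lemma shoelace_affine (c u w : ℂ) (q : Fin 7 → ℂ) :
    shoelace (fun k => c + realLin u w (q k)) = realLinDet u w * shoelace q := by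
  simp only [shoelace_eq_sum_orient, orient, add_sub_add_left_eq_sub, ← realLin_sub, cross_realLin]
  ring

lemma halfDiam_affine (c u w : ℂ) (q : Fin 7 → ℂ) (l : ℝ) :
    halfDiam (fun k => c + realLin u w (q k)) l = realLin u w (halfDiam q l) := by
  simp only [halfDiam, foot, realLin_real_mul, realLin_sub, realLin_add]
  ring

lemma cornerHeight_affine (s c a e g u w : ℂ) (h : realLinDet u w ≠ 0) :
    cornerHeight (realLin u w s) (c + realLin u w a) (realLin u w e) (realLin u w g) =
      cross (realLin u w s) c + realLinDet u w * cornerHeight s a e g := by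
  simp only [cornerHeight, cross_add_right, cross_realLin]
  rw [show realLinDet u w * cross s e * (realLinDet u w * cross s g) =
    realLinDet u w * (realLinDet u w * (cross s e * cross s g)) by ring,
    mul_div_mul_left _ _ h]
  ring

/-- Area and parallelogram area scale by the same determinant, so the comparison may be carried out
on the normalized heptagon. -/
lemma paraArea_affine (c u w : ℂ) (q : Fin 7 → ℂ) (l : ℝ) (h : realLinDet u w ≠ 0) :
    paraArea (fun k => c + realLin u w (q k)) l = realLinDet u w * paraArea q l := by
  simp only [paraArea, halfDiam_affine, add_sub_add_left_eq_sub, ← realLin_sub,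
    cornerHeight_affine _ _ _ _ _ _ _ h]
  ring

/-- The Fourier coefficients of a heptagon. -/
noncomputable def fourierCoef (p : Fin 7 → ℂ) (n : ℕ) : ℂ := (∑ k, p k * root k ^ (6 * n)) / 7

lemma continuous_fourierCoef (n : ℕ) : Continuous fun p => fourierCoef p n := by
  unfold fourierCoef; fun_prop

lemma fourierCoef_root (n : ℕ) :
    fourierCoef root n = if 7 ∣ 6 * n + 1 then 1 else 0 := by
  have : ∑ k, root k * root k ^ (6 * n) = ∑ k, root k ^ (6 * n + 1) :=
    Finset.sum_congr rfl fun k _ => by ring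
  rw [fourierCoef, this]
  split_ifs with h
  · rw [sum_root_pow_of_dvd h]; norm_num
  · rw [sum_root_pow h, zero_div]

lemma fourier_inversion (p : Fin 7 → ℂ) (k : Fin 7) :
    p k = ∑ n : Fin 7, fourierCoef p n * root k ^ (n : ℕ) := by
  have hpow : ∀ n : Fin 7, ∀ j : Fin 7, root j ^ (6 * (n : ℕ)) * root k ^ (n : ℕ) =
      root n ^ (6 * (j : ℕ) + k) := by
    intro n j
    simp only [root, ← pow_mul, ← pow_add]
    congr 1; ring
  have hsum : ∀ j : Fin 7, ∑ n : Fin 7, root n ^ (6 * (j : ℕ) + k) = if j = k then 7 else 0 := by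
    intro j
    split_ifs with h
    · exact sum_root_pow_of_dvd (by omega)
    · exact sum_root_pow (by omega)
  have : ∀ n : Fin 7, fourierCoef p n * root k ^ (n : ℕ) =
      ∑ j, p j / 7 * root n ^ (6 * (j : ℕ) + k) := by
    intro n
    rw [fourierCoef, Finset.sum_div, Finset.sum_mul]
    refine Finset.sum_congr rfl fun j _ => ?_
    rw [← hpow]; ring
  simp only [this]
  rw [Finset.sum_comm]
  simp only [← Finset.mul_sum, hsum]
  simp

/-- The modes of the affine normalization of a heptagon. -/
noncomputable def normalModes (p : Fin 7 → ℂ) : Modes := fun m =>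
  (starRingEnd ℂ (fourierCoef p 1) * fourierCoef p (m + 2)
    - fourierCoef p 6 * starRingEnd ℂ (fourierCoef p (m.rev + 2)))
  / (realLinDet (fourierCoef p 1) (fourierCoef p 6) : ℂ)

/-- Translations account for mode 0, real linear maps for modes 1 and 6. Their coefficients are read
off from the heptagon, and the linear map is inverted on the other modes. -/
lemma realLin_normalModes {p : Fin 7 → ℂ}
    (h : realLinDet (fourierCoef p 1) (fourierCoef p 6) ≠ 0) (k : Fin 7) :
    p k = fourierCoef p 0 +
      realLin (fourierCoef p 1) (fourierCoef p 6) (pert (normalModes p) k) := by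
  have h' : (realLinDet (fourierCoef p 1) (fourierCoef p 6) : ℂ) ≠ 0 := by exact_mod_cast h
  have h7 : root k ^ 7 = 1 := by rw [root, pow_right_comm, root_one_pow, one_pow]
  -- Conjugation exchanges modes n and 7 - n, that is, the indices `m` and `m.rev`. Each such pair
  -- satisfies a 2×2 system with determinant `realLinDet`, which `normalModes` solves.
  have key : ∀ m : Fin 4, fourierCoef p 1 * normalModes p m +
      fourierCoef p 6 * starRingEnd ℂ (normalModes p m.rev) = fourierCoef p (m + 2) := by
    intro m
    simp only [normalModes, map_div₀, map_sub, map_mul, Complex.conj_conj, Complex.conj_ofReal,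
      Fin.rev_rev]
    rw [mul_div_assoc', mul_div_assoc', ← add_div, div_eq_iff h', realLinDet]
    push_cast
    rw [Complex.normSq_eq_conj_mul_self, Complex.normSq_eq_conj_mul_self]
    ring
  conv_lhs => rw [fourier_inversion p k]
  have k0 := key 0; have k1 := key 1; have k2 := key 2; have k3 := key 3
  rw [show (0 : Fin 4).rev = 3 from rfl] at k0
  rw [show (1 : Fin 4).rev = 2 from rfl] at k1
  rw [show (2 : Fin 4).rev = 1 from rfl] at k2
  rw [show (3 : Fin 4).rev = 0 from rfl] at k3
  norm_num at k0 k1 k2 k3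
  rw [Fin.sum_univ_seven]
  simp only [pert, lin, modeAt, Fin.sum_univ_four, realLin, map_add, map_mul, conj_root_pow, map_pow]
  rw [show starRingEnd ℂ (root k) = root k ^ 6 by simpa using conj_root_pow k 1]
  norm_num
  rw [show root k ^ 12 = root k ^ 5 by linear_combination root k ^ 5 * h7,
    show root k ^ 18 = root k ^ 4 by linear_combination (root k ^ 11 + root k ^ 4) * h7,
    show root k ^ 24 = root k ^ 3 by
      linear_combination (root k ^ 17 + root k ^ 10 + root k ^ 3) * h7,
    show root k ^ 30 = root k ^ 2 by
      linear_combination (root k ^ 23 + root k ^ 16 + root k ^ 9 + root k ^ 2) * h7]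
  linear_combination (-root k ^ 2) * k0 - root k ^ 3 * k1 - root k ^ 4 * k2 - root k ^ 5 * k3

lemma tendsto_normalModes : Tendsto normalModes (𝓝 root) (𝓝 0) := by
  have h0 : normalModes root = 0 := by
    funext m
    fin_cases m <;> simp [normalModes, fourierCoef_root]
  rw [← h0]
  have hc : ContinuousAt normalModes root := by
    refine continuousAt_pi.2 fun m => ?_
    have := continuous_fourierCoef
    unfold normalModes
    refine ContinuousAt.div (Continuous.continuousAt ?_) (Continuous.continuousAt ?_) ?_
    · exact ((Complex.continuous_conj.comp (this 1)).mul (this _)).sub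
        ((this 6).mul (Complex.continuous_conj.comp (this _)))
    · unfold realLinDet
      exact Complex.continuous_ofReal.comp ((Complex.continuous_normSq.comp (this 1)).sub
        (Complex.continuous_normSq.comp (this 6)))
    · simp [fourierCoef_root, realLinDet]
  exact hc

lemma realLinDet_pos : ∀ᶠ p in 𝓝 root,
    0 < realLinDet (fourierCoef p 1) (fourierCoef p 6) := by
  have := continuous_fourierCoef
  have hc : Continuous fun p => realLinDet (fourierCoef p 1) (fourierCoef p 6) := by
    unfold realLinDet
    exact (Complex.continuous_normSq.comp (this 1)).sub (Complex.continuous_normSq.comp (this 6))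
  exact hc.continuousAt.eventually (lt_mem_nhds (by simp [fourierCoef_root, realLinDet]))

lemma continuous_tilt : Continuous tilt := Complex.continuous_re.comp (continuous_lin _)

lemma tilt_zero : tilt 0 = 0 := by simp [tilt, lin_zero]

lemma shoelace_shift (z : Fin 7 → ℂ) (i : Fin 7) : shoelace (fun k => z (i + k)) = shoelace z := by
  simp only [shoelace, ← add_assoc]
  congr 1
  exact Equiv.sum_comp (Equiv.addLeft i) fun k => cross (z k) (z (k + 1))

lemma root_mul_realLin (u w z : ℂ) (i : Fin 7) :
    realLin u w (root i * z) = realLin (u * root i) (w * starRingEnd ℂ (root i)) z := by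
  simp [realLin]; ring

/-- A heptagon close to the regular one either has a parallelogram of relative area less than
that of the regular heptagon, or is an affine image of the regular heptagon. -/
lemma exists_paraArea_lt_or_affine {U : Set ℝ} (hU : U ∈ 𝓝 (1 / 2 : ℝ)) :
    ∀ᶠ p in 𝓝 root, (∃ i, ∃ l ∈ U, shoelace root * paraArea (fun k => p (i + k)) l <
        paraArea root (1 / 2) * shoelace p) ∨
      ∃ c u w : ℂ, 0 < realLinDet u w ∧ p = fun k => c + realLin u w (root k) := by
  have hV : ∀ᶠ c in 𝓝 (0 : Modes), 1 / 2 + tilt c ∈ U := by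
    have : ContinuousAt (fun c => 1 / 2 + tilt c) 0 :=
      (continuous_const.add continuous_tilt).continuousAt
    exact this (by simpa [tilt_zero] using hU)
  obtain ⟨r, hr, hV⟩ := Metric.eventually_nhds_iff.1 hV
  filter_upwards [realLinDet_pos, tendsto_normalModes.eventually exists_gap_pos,
    tendsto_normalModes (Metric.ball_mem_nhds 0 hr)] with p hdet hgap hsmall
  have hp := realLin_normalModes hdet.ne'
  set c := normalModes p with hc
  by_cases h0 : c = 0
  · right
    exact ⟨_, _, _, hdet, funext fun k => by rw [hp k, h0, pert_zero]⟩
  left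
  obtain ⟨i, hi⟩ := hgap h0
  refine ⟨i, 1 / 2 + tilt (rotM i c), hV ?_, ?_⟩
  · rw [dist_zero_right, norm_rotM, ← dist_zero_right]; exact hsmall
  -- The shifted heptagon is an affine image of the rotated perturbation, with the same determinant,
  -- so the positive excess is transported back.
  have hshift : (fun k => p (i + k)) = fun k => fourierCoef p 0 +
      realLin (fourierCoef p 1 * root i) (fourierCoef p 6 * starRingEnd ℂ (root i))
        (pert (rotM i c) k) := by
    funext k
    rw [hp, pert_add, root_mul_realLin]
  have hd : realLinDet (fourierCoef p 1 * root i) (fourierCoef p 6 * starRingEnd ℂ (root i)) =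
      realLinDet (fourierCoef p 1) (fourierCoef p 6) := by
    simp [realLinDet, normSq_root]
  rw [← shoelace_shift p i, hshift, paraArea_affine _ _ _ _ _ (by rw [hd]; exact hdet.ne'),
    shoelace_affine, hd]
  have := mul_pos hdet hi
  unfold gap at this
  linarith

/-! ### The explicit parallelograms persist near the regular heptagon -/

/-- The heptagon `z` has a half-length parallelogram with parameter `l`. -/
structure Admissible (z : Fin 7 → ℂ) (l : ℝ) : Prop where
  nonneg : 0 ≤ l
  le_one : l ≤ 1
  oriented : Oriented z
  far : FarVertex z
  top : FitsCorner (halfDiam z l) (z 1 - z 2) (z 3 - z 2)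
  bot : FitsCorner (halfDiam z l) (z 6 - z 5) (z 4 - z 5)
  pos : 0 < paraArea z l

lemma FitsCorner.const_mul {s e g u : ℂ} (h : FitsCorner s e g) (hu : u ≠ 0) :
    FitsCorner (u * s) (u * e) (u * g) := by
  have : Complex.normSq u ≠ 0 := (Complex.normSq_pos.2 hu).ne'
  unfold FitsCorner
  rwa [cross_mul_mul, cross_mul_mul, cross_mul_mul, mul_div_mul_left _ _ this,
    mul_div_mul_left _ _ this]

lemma Admissible.const_mul {z : Fin 7 → ℂ} {l : ℝ} (h : Admissible z l) {u : ℂ} (hu : u ≠ 0) :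
    Admissible (fun k => u * z k) l := by
  have hs : halfDiam (fun k => u * z k) l = u * halfDiam z l := by
    simp only [halfDiam, foot]; ring
  refine ⟨h.nonneg, h.le_one, h.oriented.const_mul hu, h.far.const_mul u, ?_, ?_, ?_⟩
  · simp only [hs, ← mul_sub]; exact h.top.const_mul hu
  · simp only [hs, ← mul_sub]; exact h.bot.const_mul hu
  · have hn := Complex.normSq_pos.2 hu
    have := paraArea_affine 0 u 0 z l (by simpa [realLinDet] using hu)
    simp only [realLin, realLinDet, map_zero, sub_zero, zero_mul, add_zero, zero_add] at this
    rw [this]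
    exact mul_pos hn h.pos

lemma Admissible.leastHalfLengthArea_le {z : Fin 7 → ℂ} {l : ℝ} (h : Admissible z l) :
    leastHalfLengthArea (body z) ≤ paraArea z l := by
  obtain ⟨p, s, t, hp, ha⟩ :=
    h.oriented.isHalfLengthParallelogram h.far h.nonneg h.le_one h.top h.bot h.pos
  rw [← ha]
  exact _root_.leastHalfLengthArea_le hp

lemma Admissible.exists_isHalfLengthParallelogram {z : Fin 7 → ℂ} {l : ℝ} (h : Admissible z l) :
    ∃ p s t, IsHalfLengthParallelogram (body z) p s t := by
  obtain ⟨p, s, t, hp, -⟩ :=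
    h.oriented.isHalfLengthParallelogram h.far h.nonneg h.le_one h.top h.bot h.pos
  exact ⟨p, s, t, hp⟩

lemma cross_far_pos {j : Fin 7} (hj : j ≠ 0) :
    0 < cross (root 4 - root 3) (root 0 - root j) := by
  have n1 := near_C1; have n2 := near_C2; have n3 := near_C3; have m3 := near_S3
  unfold Near at n1 n2 n3 m3
  norm_num at n1 n2 n3 m3
  have h : ∀ w : ℂ, w.re < 1 → 0 < cross (root 4 - root 3) (root 0 - w) := by
    intro w hw
    have : cross (root 4 - root 3) (root 0 - w) = 2 * S3 * (1 - w.re) := by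
      rw [root3, root4, root_zero]; simp [cross]; ring
    rw [this]
    exact mul_pos (by linarith) (by linarith)
  fin_cases j
  · exact absurd rfl hj
  · exact h (root 1) (by rw [root1]; simp; linarith)
  · exact h (root 2) (by rw [root2]; simp; linarith)
  · exact h (root 3) (by rw [root3]; simp; linarith)
  · exact h (root 4) (by rw [root4]; simp; linarith)
  · exact h (root 5) (by rw [root5]; simp; linarith)
  · exact h (root 6) (by rw [root6]; simp; linarith)

lemma continuous_halfDiam : Continuous fun q : (Fin 7 → ℂ) × ℝ => halfDiam q.1 q.2 := by
  unfold halfDiam foot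
  fun_prop

lemma corner_root_values :
    cross (halfDiam root (1 / 2)) (root 3 - root 2) / cross (root 1 - root 2) (root 3 - root 2)
      = alpha ∧
    cross (halfDiam root (1 / 2)) (root 1 - root 2) / cross (root 1 - root 2) (root 3 - root 2)
      = beta ∧
    cross (halfDiam root (1 / 2)) (root 4 - root 5) / cross (root 6 - root 5) (root 4 - root 5)
      = alpha ∧
    cross (halfDiam root (1 / 2)) (root 6 - root 5) / cross (root 6 - root 5) (root 4 - root 5)
      = beta := by
  have hs := halfDiam_root (1 / 2)
  rw [sub_self, mul_zero] at hs
  have h1 : cross ⟨halfWidth, 0⟩ (root 3 - root 2) / cross (root 1 - root 2) (root 3 - root 2)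
      = alpha := by rw [cross_g_div, alpha]; ring
  have h2 : cross ⟨halfWidth, 0⟩ (root 1 - root 2) / cross (root 1 - root 2) (root 3 - root 2)
      = beta := by rw [cross_e_div, beta]; ring
  have hc : (⟨halfWidth, 0⟩ : ℂ) = starRingEnd ℂ ⟨halfWidth, 0⟩ := by
    apply Complex.ext <;> simp
  rw [hs]
  refine ⟨h1, h2, ?_, ?_⟩
  · rw [hc, root4_conj, root5_conj, root6_conj, ← map_sub, ← map_sub, cross_conj, cross_conj,
      neg_div_neg_eq, h1]
  · rw [hc, root4_conj, root5_conj, root6_conj, ← map_sub, ← map_sub, cross_conj, cross_conj,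
      neg_div_neg_eq, h2]

/-- At the regular heptagon the corner parameters are `alpha` and `beta`, strictly between 0 and 1,
hence they stay in this range nearby. -/
lemma eventually_fitsCorner {s e g : (Fin 7 → ℂ) × ℝ → ℂ} {q₀ : (Fin 7 → ℂ) × ℝ}
    (hs : Continuous s) (he : Continuous e) (hg : Continuous g)
    (h0 : cross (e q₀) (g q₀) ≠ 0) (h1 : cross (s q₀) (g q₀) / cross (e q₀) (g q₀) = alpha)
    (h2 : cross (s q₀) (e q₀) / cross (e q₀) (g q₀) = beta) :
    ∀ᶠ q in 𝓝 q₀, FitsCorner (s q) (e q) (g q) := by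
  have n1 := near_alpha_eq; have n2 := near_beta_eq
  unfold Near at n1 n2
  norm_num at n1 n2
  have c1 : ContinuousAt (fun q => cross (s q) (g q) / cross (e q) (g q)) q₀ :=
    (by fun_prop : Continuous fun q => cross (s q) (g q)).continuousAt.div
      (by fun_prop : Continuous fun q => cross (e q) (g q)).continuousAt h0
  have c2 : ContinuousAt (fun q => cross (s q) (e q) / cross (e q) (g q)) q₀ :=
    (by fun_prop : Continuous fun q => cross (s q) (e q)).continuousAt.div
      (by fun_prop : Continuous fun q => cross (e q) (g q)).continuousAt h0
  filter_upwards [c1.eventually (lt_mem_nhds (show (0 : ℝ) < _ by simp only [h1]; linarith)),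
    c1.eventually (gt_mem_nhds (show _ < (1 : ℝ) by simp only [h1]; linarith)),
    c2.eventually (lt_mem_nhds (show (0 : ℝ) < _ by simp only [h2]; linarith)),
    c2.eventually (gt_mem_nhds (show _ < (1 : ℝ) by simp only [h2]; linarith))] with q a b c d
  exact ⟨⟨a.le, b.le⟩, c.le, d.le⟩

lemma eventually_oriented : ∀ᶠ z in 𝓝 root, Oriented z := by
  unfold Oriented
  refine eventually_all.2 fun i => eventually_all.2 fun j => eventually_all.2 fun k => ?_
  by_cases h : i < j ∧ j < k
  · have hc : Continuous fun z : Fin 7 → ℂ => orient (z i) (z j) (z k) := by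
      unfold orient; fun_prop
    filter_upwards [hc.continuousAt.eventually (lt_mem_nhds (orient_root_pos h.1 h.2))]
      with z hz _ _ using hz
  · exact Eventually.of_forall fun z h1 h2 => absurd ⟨h1, h2⟩ h

lemma eventually_farVertex : ∀ᶠ z in 𝓝 root, FarVertex z := by
  unfold FarVertex
  refine eventually_all.2 fun j => ?_
  by_cases h : j = 0
  · subst h
    exact Eventually.of_forall fun z => by simp [cross]
  · have hc : Continuous fun z : Fin 7 → ℂ => cross (z 4 - z 3) (z 0 - z j) := by fun_prop
    filter_upwards [hc.continuousAt.eventually (lt_mem_nhds (cross_far_pos h))]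
      with z hz using hz.le

lemma eventually_admissible : ∀ᶠ q : (Fin 7 → ℂ) × ℝ in 𝓝 (root, 1 / 2), Admissible q.1 q.2 := by
  have hD : cross (root 1 - root 2) (root 3 - root 2) ≠ 0 := by
    rw [cross_corner_root]; exact cornerDet_neg.ne
  have hD' : cross (root 6 - root 5) (root 4 - root 5) ≠ 0 := by
    rw [root4_conj, root5_conj, root6_conj, ← map_sub, ← map_sub, cross_conj]
    exact neg_ne_zero.2 hD
  obtain ⟨v1, v2, v3, v4⟩ := corner_root_values
  have hhd := continuous_halfDiam
  have t1 := eventually_fitsCorner (q₀ := (root, 1 / 2)) hhd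
    (by fun_prop : Continuous fun q : (Fin 7 → ℂ) × ℝ => q.1 1 - q.1 2)
    (by fun_prop : Continuous fun q : (Fin 7 → ℂ) × ℝ => q.1 3 - q.1 2) hD v1 v2
  have t2 := eventually_fitsCorner (q₀ := (root, 1 / 2)) hhd
    (by fun_prop : Continuous fun q : (Fin 7 → ℂ) × ℝ => q.1 6 - q.1 5)
    (by fun_prop : Continuous fun q : (Fin 7 → ℂ) × ℝ => q.1 4 - q.1 5) hD' v3 v4
  have hp : ContinuousAt (fun q : (Fin 7 → ℂ) × ℝ => paraArea q.1 q.2) (root, 1 / 2) := by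
    unfold paraArea cornerHeight
    refine ContinuousAt.sub (ContinuousAt.add ?_ (ContinuousAt.div ?_ ?_ hD))
      (ContinuousAt.add ?_ (ContinuousAt.div ?_ ?_ hD')) <;>
    exact Continuous.continuousAt (by fun_prop)
  have hf : Tendsto (Prod.fst : (Fin 7 → ℂ) × ℝ → _) (𝓝 (root, 1 / 2)) (𝓝 root) :=
    continuous_fst.continuousAt
  have hl : Tendsto (Prod.snd : (Fin 7 → ℂ) × ℝ → _) (𝓝 (root, 1 / 2)) (𝓝 (1 / 2)) :=
    continuous_snd.continuousAt
  filter_upwards [hf.eventually eventually_oriented, hf.eventually eventually_farVertex, t1, t2,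
    hp.eventually (lt_mem_nhds paraArea_root_half_pos),
    hl.eventually (lt_mem_nhds (by norm_num : (0 : ℝ) < 1 / 2)),
    hl.eventually (gt_mem_nhds (by norm_num : (1 / 2 : ℝ) < 1))] with q a b c d e f g
  exact ⟨f.le, g.le, a, b, c, d, e⟩

lemma exists_nhds_admissible : ∃ U ∈ 𝓝 (1 / 2 : ℝ), ∀ᶠ p in 𝓝 root, ∀ l ∈ U, ∀ i,
    Admissible (fun k => p (i + k)) l := by
  have h := eventually_admissible
  rw [nhds_prod_eq] at h
  obtain ⟨P, hP, Q, hQ, hPQ⟩ := eventually_prod_iff.1 h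
  refine ⟨{l | Q l}, hQ, ?_⟩
  -- The shifted heptagon is near `root i` times the regular one; after rotating back, the
  -- neighbourhood found at vertex 0 applies.
  have hrot : ∀ i : Fin 7, ∀ᶠ p in 𝓝 root, P fun k => root (-i) * p (i + k) := by
    intro i
    have hc : Continuous fun (p : Fin 7 → ℂ) (k : Fin 7) => root (-i) * p (i + k) := by fun_prop
    have h0 : (fun k => root (-i) * root (i + k)) = root := by
      funext k; rw [← root_add, neg_add_cancel_left]
    exact hc.continuousAt.eventually (by simp only [h0]; exact hP)
  filter_upwards [eventually_all.2 hrot] with p hp l hl i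
  have := (hPQ (hp i) hl).const_mul (root_ne_zero i)
  convert this using 2 with k
  rw [← mul_assoc, ← root_add, add_neg_cancel, root_zero, one_mul]

/-- The comparison for labelled heptagons near the regular heptagon. -/
lemma eventually_comparison : ∀ᶠ p in 𝓝 root, planeArea (body p) = shoelace p ∧
    (∃ a s t, IsHalfLengthParallelogram (body p) a s t) ∧
    ((shoelace root * leastHalfLengthArea (body p) < paraArea root (1 / 2) * shoelace p) ∨
      (shoelace root * leastHalfLengthArea (body p) ≤ paraArea root (1 / 2) * shoelace p ∧
      ∃ c u w : ℂ, 0 < realLinDet u w ∧ p = fun k => c + realLin u w (root k))) := by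
  obtain ⟨U, hU, h⟩ := exists_nhds_admissible
  filter_upwards [h, exists_paraArea_lt_or_affine hU] with p hp hor
  have hU0 : (1 / 2 : ℝ) ∈ U := mem_of_mem_nhds hU
  have h00 := hp _ hU0 0
  simp only [zero_add] at h00
  have hA := oriented_root.shoelace_pos
  refine ⟨h00.oriented.planeArea_eq, h00.exists_isHalfLengthParallelogram, ?_⟩
  rcases hor with ⟨i, l, hl, hlt⟩ | ⟨c, u, w, hdet, hpe⟩
  · left
    have := (hp l hl i).leastHalfLengthArea_le
    rw [body_shift] at this
    exact (mul_le_mul_of_nonneg_left this hA.le).trans_lt hlt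
  · right
    -- For an affine image the parallelogram with l = 1/2 gives the non-strict comparison, since
    -- both sides scale by the determinant.
    refine ⟨?_, c, u, w, hdet, hpe⟩
    refine (mul_le_mul_of_nonneg_left h00.leastHalfLengthArea_le hA.le).trans_eq ?_
    rw [hpe, paraArea_affine _ _ _ _ _ hdet.ne', shoelace_affine]
    ring

/-! ### Labelling the vertices and conclusion -/

lemma root_injective : Function.Injective root := by
  intro i j h
  have hprim : IsPrimitiveRoot (Complex.exp (2 * Real.pi * Complex.I / 7)) 7 := by
    simpa using Complex.isPrimitiveRoot_exp 7 (by norm_num)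
  exact Fin.ext (hprim.pow_inj i.2 j.2 h)

lemma eventually_injective : ∀ᶠ p : Fin 7 → ℂ in 𝓝 root, Function.Injective p := by
  have h : ∀ᶠ p : Fin 7 → ℂ in 𝓝 root, ∀ i j, i ≠ j → p i ≠ p j := by
    refine eventually_all.2 fun i => eventually_all.2 fun j => ?_
    by_cases hij : i = j
    · exact Eventually.of_forall fun p hne => absurd hij hne
    · have h0 : root i - root j ≠ 0 := sub_ne_zero.2 fun h => hij (root_injective h)
      have hc : Continuous fun p : Fin 7 → ℂ => p i - p j := by fun_prop
      filter_upwards [hc.continuousAt.eventually_ne h0] with p hp _ using sub_ne_zero.1 hp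
  filter_upwards [h] with p hp i j hij
  by_contra hne
  exact hp i j hne hij

lemma body_comp_equiv (q : Fin 7 → ℂ) {σ : Fin 7 → Fin 7} (hσ : Function.Surjective σ) :
    body (fun k => q (σ k)) = body q := by
  unfold body
  congr 1
  exact hσ.range_comp fun k => toPlane (q k)

lemma norm_le_one_of_mem {w : ℂ} (hw : w ∈ convexHull ℝ (Set.range root)) : ‖w‖ ≤ 1 := by
  have : convexHull ℝ (Set.range root) ⊆ Metric.closedBall 0 1 :=
    convexHull_min (by rintro _ ⟨k, rfl⟩; simp [norm_root]) (convex_closedBall 0 1)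
  simpa using this hw

lemma re_conj_mul_lt_of_mem {q : Fin 7 → ℂ} {u w : ℂ} {a : ℝ}
    (h : ∀ j, (starRingEnd ℂ u * q j).re < a) (hw : w ∈ convexHull ℝ (Set.range q)) :
    (starRingEnd ℂ u * w).re < a := by
  have hlin : IsLinearMap ℝ fun w : ℂ => (starRingEnd ℂ u * w).re :=
    ⟨fun x y => by simp; ring, fun r x => by simp; ring⟩
  exact convexHull_min (t := {w : ℂ | (starRingEnd ℂ u * w).re < a})
    (by rintro _ ⟨j, rfl⟩; exact h j) (convex_halfSpace_lt hlin a) hw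

/-- The linear functional in direction `root i` is at least 1 - ε at some vertex, because (1 -
ε)·`root i` lies in the body. That vertex has norm at most 1 + ε, so its squared distance from `root
i` is at most (1 + ε)² + 1 - 2(1 - ε) = 4ε + ε². -/
lemma exists_vertex_near {q : Fin 7 → ℂ} {ε : ℝ} (h0 : 0 < ε) (h1 : ε < 1)
    (hsub : (1 - ε) • body root ⊆ body q) (hsup : body q ⊆ (1 + ε) • body root) (i : Fin 7) :
    ∃ j, ‖q j - root i‖ ^ 2 ≤ 5 * ε := by
  have hi : ((1 - ε : ℝ) : ℂ) * root i ∈ convexHull ℝ (Set.range q) := by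
    rw [← toPlane_mem_body]
    refine hsub ⟨toPlane (root i), toPlane_mem_body.2 (subset_convexHull ℝ _ ⟨i, rfl⟩), ?_⟩
    simp [← map_smul]
  have hval : (starRingEnd ℂ (root i) * (((1 - ε : ℝ) : ℂ) * root i)).re = 1 - ε := by
    rw [show starRingEnd ℂ (root i) * (((1 - ε : ℝ) : ℂ) * root i) =
      ((1 - ε : ℝ) : ℂ) * (starRingEnd ℂ (root i) * root i) by ring,
      ← Complex.normSq_eq_conj_mul_self, normSq_root, Complex.ofReal_one, mul_one,
      Complex.ofReal_re]
  obtain ⟨j, hj⟩ : ∃ j, 1 - ε ≤ (starRingEnd ℂ (root i) * q j).re := by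
    by_contra! hcon
    exact (re_conj_mul_lt_of_mem hcon hi).ne hval
  refine ⟨j, ?_⟩
  have hnorm : ‖q j‖ ≤ 1 + ε := by
    obtain ⟨w', hw', hw⟩ := hsup (toPlane_mem_body.2 (subset_convexHull ℝ _ ⟨j, rfl⟩))
    obtain ⟨w, rfl⟩ := toPlane.surjective w'
    have hq : q j = (1 + ε) • w := toPlane.injective (by rw [map_smul]; exact hw.symm)
    rw [hq, norm_smul, Real.norm_of_nonneg (by linarith)]
    have := norm_le_one_of_mem (toPlane_mem_body.1 hw')
    nlinarith
  have e : ‖q j - root i‖ ^ 2 = ‖q j‖ ^ 2 + 1 - 2 * (starRingEnd ℂ (root i) * q j).re := by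
    have hr := normSq_root i
    rw [← Complex.normSq_eq_norm_sq, ← Complex.normSq_eq_norm_sq, ← hr]
    simp [Complex.normSq_apply]; ring
  rw [e]
  nlinarith [norm_nonneg (q j)]

/-- `realLin` as a linear equivalence. -/
noncomputable def realLinEquiv (u w : ℂ) (h : realLinDet u w ≠ 0) : ℂ ≃ₗ[ℝ] ℂ :=
  LinearEquiv.ofInjectiveEndo
    { toFun := realLin u w
      map_add' := realLin_add u w
      map_smul' := fun r z => by simpa using realLin_real_mul u w r z } (by
    rw [← LinearMap.ker_eq_bot, LinearMap.ker_eq_bot']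
    intro z hz
    have hz' : realLin u w z = 0 := hz
    have key : ∀ b, cross z b = 0 := fun b => by
      have := cross_realLin u w z b
      rw [hz'] at this
      simpa [cross, h] using this
    have h1 := key 1
    have h2 := key Complex.I
    apply Complex.ext
    · simpa [cross] using h2
    · simpa [cross] using h1)

lemma realLinEquiv_apply (u w z : ℂ) (h : realLinDet u w ≠ 0) :
    realLinEquiv u w h z = realLin u w z := rfl

lemma affinelyEquivalent_body (q : Fin 7 → ℂ) (c : ℂ) {u w : ℂ} (h : realLinDet u w ≠ 0) :
    AffinelyEquivalent (body q) (body fun k => c + realLin u w (q k)) := by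
  set f : Plane ≃ᵃ[ℝ] Plane := ((toPlane.symm.toLinearEquiv.trans
    ((realLinEquiv u w h).trans toPlane.toLinearEquiv)).toAffineEquiv).trans
    (AffineEquiv.constVAdd ℝ Plane (toPlane c)) with hf
  have hval : ∀ z, f (toPlane z) = toPlane (c + realLin u w z) := by
    intro z
    simp [hf, realLinEquiv_apply]
  refine ⟨f, ?_⟩
  have := f.toAffineMap.image_convexHull (Set.range fun k => toPlane (q k))
  unfold body
  refine this.trans ?_
  rw [← Set.range_comp]
  congr 2
  funext k
  exact hval (q k)

lemma closedBall_subset_of_smul_subset {K : Set Plane} {ε : ℝ} (h1 : ε < 1)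
    (h : (1 - ε) • body root ⊆ K) : Metric.closedBall 0 ((1 - ε) / 4) ⊆ K := by
  intro x hx
  have hpos : 0 < 1 - ε := by linarith
  refine h ⟨(1 - ε)⁻¹ • x, closedBall_subset_body_root ?_, smul_inv_smul₀ hpos.ne' x⟩
  rw [mem_closedBall_zero_iff] at hx ⊢
  rw [norm_smul, norm_inv, Real.norm_of_nonneg hpos.le, inv_mul_le_iff₀ hpos]
  linarith

theorem mainTheorem2 :
    ∃ ε : ℝ, 0 < ε ∧ ε < 1 ∧
      ∀ M' : Set Plane, IsConvexHeptagon M' →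
        (1 - ε) • regularHeptagon ⊆ M' → M' ⊆ (1 + ε) • regularHeptagon →
          planeArea regularHeptagon / (2 * leastHalfLengthArea regularHeptagon) ≤
              planeArea M' / (2 * leastHalfLengthArea M') ∧
            (planeArea M' / (2 * leastHalfLengthArea M') =
                planeArea regularHeptagon / (2 * leastHalfLengthArea regularHeptagon) →
              AffinelyEquivalent regularHeptagon M') := by
  obtain ⟨δ, hδ, hnear⟩ :=
    Metric.eventually_nhds_iff.1 (eventually_comparison.and eventually_injective)
  -- The choice gives 5ε < δ², so that `exists_vertex_near` places vertices within δ of those of the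
  -- regular heptagon.
  have he0 : 0 < min (1 / 2) (δ ^ 2 / 10) := by positivity
  have he1 : min (1 / 2) (δ ^ 2 / 10) < 1 := (min_le_left _ _).trans_lt (by norm_num)
  have he2 : 5 * min (1 / 2) (δ ^ 2 / 10) < δ ^ 2 := by
    have := min_le_right (1 / 2) (δ ^ 2 / 10)
    nlinarith
  refine ⟨_, he0, he1, ?_⟩
  set ε := min (1 / 2) (δ ^ 2 / 10)
  rintro M' ⟨p', -, rfl⟩
  obtain ⟨q, hq⟩ : ∃ q : Fin 7 → ℂ, p' = fun k => toPlane (q k) :=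
    ⟨fun k => toPlane.symm (p' k), by simp⟩
  rw [hq, regularHeptagon_eq_body]
  change (1 - ε) • body root ⊆ body q → body q ⊆ (1 + ε) • body root →
    planeArea (body root) / _ ≤ planeArea (body q) / (2 * leastHalfLengthArea (body q)) ∧
      (planeArea (body q) / (2 * leastHalfLengthArea (body q)) = _ →
        AffinelyEquivalent (body root) (body q))
  intro hsub hsup
  choose σ hσ using exists_vertex_near he0 he1 hsub hsup
  have hdist : dist (fun k => q (σ k)) root < δ := by
    rw [dist_pi_lt_iff hδ]
    intro k
    rw [dist_eq_norm]
    exact lt_of_pow_lt_pow_left₀ 2 hδ.le ((hσ k).trans_lt he2)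
  obtain ⟨⟨harea, ⟨a, s, t, hhalf⟩, hcomp⟩, hinj⟩ := hnear hdist
  -- Tuples near the regular one are injective, so the choice of nearest vertices is a permutation
  -- of the seven labels and leaves the body unchanged.
  have hsurj : Function.Surjective σ :=
    Finite.injective_iff_surjective.1 (Function.Injective.of_comp hinj)
  rw [body_comp_equiv q hsurj] at harea hhalf hcomp
  have hM : planeArea (body root) = shoelace root := oriented_root.planeArea_eq
  have hpos : 0 < leastHalfLengthArea (body root) :=
    paraArea_root_half_pos.trans_le paraArea_root_le_leastHalfLengthArea
  have hpos' : 0 < leastHalfLengthArea (body q) :=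
    leastHalfLengthArea_pos (convex_body q) (isCompact_body q) (by linarith : 0 < (1 - ε) / 4)
      (closedBall_subset_of_smul_subset he1 hsub) hhalf
  rw [harea, hM, div_le_div_iff₀ (by linarith) (by linarith), eq_comm,
    div_eq_div_iff (by linarith) (by linarith)]
  have hA : 0 ≤ shoelace fun k => q (σ k) := by rw [← harea]; exact measureReal_nonneg
  -- For the regular heptagon only the lower bound on its least area enters. A strict comparison
  -- excludes equality; the other case provides the affine map.
  have hle := mul_le_mul_of_nonneg_right paraArea_root_le_leastHalfLengthArea hA
  rcases hcomp with hlt | ⟨hle', c, u, w, hdet, hq'⟩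
  · refine ⟨by nlinarith, fun heq => ?_⟩
    nlinarith
  · refine ⟨by nlinarith, fun _ => ?_⟩
    rw [← body_comp_equiv q hsurj, hq']
    exact affinelyEquivalent_body root c hdet.ne'
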